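/- Fix an integer $\mu\ge 2$ (MIN_ARITY; MAX_ARITY is $2\mu$). A FiBA window stores entries $(t,v)$, with $t$ in a totally ordered set and $v$ in a monoid $(V,\otimes,1)$, in a B-tree: all leaves have the same depth; a node of arity $a$ holds $a-1$ entries and, if it is not a leaf, $a$ children; timestamps strictly increase in the left-to-right order of the tree; non-root nodes have arity between $\mu$ and $2\mu$, the root has arity between $2$ and $2\mu$ (or is a leaf without entries if the window is empty). Parent pointers and pointers to the leftmost and rightmost leaf (the fingers) are available. Each node stores a partial aggregate: off the spines, the product of everything in its subtree (up aggregate); at the root, the product of its values and its inner children (inner aggregate); on the left (right) spine, the product of the part of its subtree outside its own leftmost (rightmost) child, combined with the aggregate of its parent unless the parent is the root. $\mathrm{bulkInsert}(B)$, for a bulk $B$ of $m\ge1$ entries with strictly increasing timestamps, adds the entries of $B$ to the window, where for a timestamp that is already present the new value is multiplied to the old one from the right. It works as follows. (1) Search: walk up from the right finger to the lowest right-spine node whose first timestamp is at most the earliest timestamp of $B$ (or to the root), then find the sites of all entries of $B$ in the subtree of that node in timestamp order, going from one site to the next through their least common ancestor. New timestamps belong to leaves, present ones to the node that contains them. (2)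 Pass up: for each affected node, from the leaves upwards, interleave the contents of the node with the entries destined for it; if its arity becomes $p>2\mu$, split it into nodes of arity $\mu+1$ and one last node of arity between $\mu$ and $2\mu$, and promote the entries between these nodes, with the new nodes, to the parent (to a new root if the root was split); recompute up and inner aggregates. This continues until nothing is promoted and, in the subtree where the search took place, the aggregates are up to date. (3) Pass down: repair the right aggregates on the right spine below the highest processed node and, if the bulk reaches the left spine or the root was split, the left aggregates on the left spine. $\mathrm{bulkEvict}(t)$ removes all entries with timestamps at most $t$: it cuts the tree along the path to $t$ and repairs underflows from the bottom up, by moving entries and children from the right neighbor of the underfull node if the deficit of the node is at most the surplus of the neighbor over $\mu$, and by merging the node into that neighbor otherwise; a right-spine node without right neighbor, or its only child, becomes the root. For an insertion of a bulk of size $m$ into a window of $n$ entries, let $d$ be the out-of-order distance of the earliest entry of the bulk, i.e. the number of entries of the window with a later timestamp, and let $\log^+x=\max(0,\log x)$, $\log^+0=0$. Time is the number of elementary steps (following a pointer, comparing timestamps, moving an entry or a child, handing over a promoted entry, applying $\otimes$). Theorem. For every $\mu\ge 2$ there is a constant $C$, depending only on $\mu$, such that for every totally ordered set of timestamps and every monoid: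 (a) (amortized time) in every finite sequence of operations $\mathrm{bulkInsert}$ and $\mathrm{bulkEvict}$ that starts from the empty window, the total time of the bulk insertions is at most $C\sum\bigl(\log^+ d+m\,(1+\log^+\tfrac dm)\bigr)$, where the sum runs over the bulk insertions of the sequence, with $d$ and $m$ taken at each of them; (b) (worst-case time) every single $\mathrm{bulkInsert}$ into a window that satisfies the height, order and arity invariants takes time at most $C\bigl(\log^+ d+m\,(1+\log\tfrac{m+n}{m})\bigr)$. -/

import Mathlib

universe u

namespace FiBA

/-! ### Running time

A computation of type `Timed α` returns a value together with the number of elementary steps it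
took.  Elementary steps are: following a pointer, comparing two timestamps, moving one entry or one
child pointer, creating or handing over one treelet, one application of the monoid operation. -/

/-- A result together with the number of elementary steps spent on it. -/
structure Timed (α : Type u) where
  val : α
  time : ℕ

instance : Monad Timed.{u} where
  pure a := ⟨a, 0⟩
  bind x f := ⟨(f x.val).val, x.time + (f x.val).time⟩

/-- Spend `k` elementary steps. -/
def tick (k : ℕ) : Timed PUnit.{u + 1} := ⟨PUnit.unit, k⟩

/-! ### The data structure -/

/-- A node with children of type `C`: a stored partial aggregate, a first child `c₀`, and the list
`(⟨t₀, v₀⟩, c₁), (⟨t₁, v₁⟩, c₂), …` of entries, each with the child that follows it. -/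
structure Node (T V C : Type u) where
  agg : V
  first : C
  rest : List ((T × V) × C)

/-- Trees in which all leaves have the same depth.  `Tree T V 0` is the null pointer, so a leaf is
a `Tree T V 1`, a node of arity `a` with `a - 1` entries and only null children. -/
def Tree (T V : Type u) : ℕ → Type u
  | 0 => PUnit
  | h + 1 => Node T V (Tree T V h)

section basics

variable {T V C : Type u}

/-- The arity: one more than the number of entries. -/
def Node.arity (y : Node T V C) : ℕ := y.rest.length + 1

/-- The last child. -/
def Node.last (y : Node T V C) : C := (y.rest.getLast?.map Prod.snd).getD y.first

/-- Replace the last entry's child. -/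
def setLastAux (c : C) : List ((T × V) × C) → List ((T × V) × C)
  | [] => []
  | [p] => [(p.1, c)]
  | p :: q :: r => p :: setLastAux c (q :: r)

/-- Replace the last child. -/
def Node.setLast (y : Node T V C) (c : C) : Node T V C :=
  match y.rest with
  | [] => { y with first := c }
  | p :: r => { y with rest := setLastAux c (p :: r) }

/-- The entries of a tree, from left to right. -/
def Tree.toList : (h : ℕ) → Tree T V h → List (T × V)
  | 0, _ => []
  | h + 1, y => Tree.toList h y.first ++ y.rest.flatMap fun p => p.1 :: Tree.toList h p.2

/-- The arity invariant for a subtree below the root: every node has arity between `μ` and `2μ`. -/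
def Tree.ArityOK (μ : ℕ) : (h : ℕ) → Tree T V h → Prop
  | 0, _ => True
  | h + 1, y => μ ≤ Node.arity y ∧ Node.arity y ≤ 2 * μ ∧
      Tree.ArityOK μ h y.first ∧ ∀ p ∈ y.rest, Tree.ArityOK μ h p.2

end basics

/-- A window: a tree of some height, given by its root. -/
structure Window (T V : Type u) where
  height : ℕ
  root : Tree T V (height + 1)

section window

variable {T V : Type u}

/-- The contents of the window, from left to right. -/
def Window.entries (F : Window T V) : List (T × V) := F.root.toList

/-- The empty window: a root without entries. -/
def Window.empty [Monoid V] : Window T V := ⟨0, (⟨1, PUnit.unit, []⟩ : Node T V PUnit)⟩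

/-- The arity invariants: the root has arity between `2` and `2μ` (or it is a leaf without entries,
if the window is empty), all other nodes have arity between `μ` and `2μ`. -/
def Window.ArityOK (μ : ℕ) (F : Window T V) : Prop :=
  ((2 ≤ Node.arity F.root ∧ Node.arity F.root ≤ 2 * μ) ∨ (F.height = 0 ∧ F.root.rest = [])) ∧
    Tree.ArityOK μ F.height F.root.first ∧ ∀ p ∈ F.root.rest, Tree.ArityOK μ F.height p.2

/-- The height, order and arity invariants.  The height invariant is part of the type.  The order
invariant says that the timestamps strictly increase from left to right. -/
def Window.Valid [LinearOrder T] (μ : ℕ) (F : Window T V) : Prop :=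
  F.ArityOK μ ∧ F.entries.Pairwise fun a b => a.1 < b.1

end window

/-! ### Location-sensitive partial aggregates -/

section aggregates

variable {T V : Type u} [Monoid V]

/-- The aggregate stored at a node; the neutral element for a null pointer. -/
def Tree.agg : (h : ℕ) → Tree T V h → V
  | 0, _ => 1
  | _ + 1, y => Node.agg y

/-- `v₀ ⊗ Π(c₁) ⊗ v₁ ⊗ … ⊗ Π(c_{a-2}) ⊗ v_{a-2}`: all entries and the inner children. -/
def innerAgg (h : ℕ) : List ((T × V) × Tree T V h) → V
  | [] => 1
  | [p] => p.1.2
  | p :: q :: r => p.1.2 * p.2.agg * innerAgg h (q :: r)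

/-- `Π(c₀) ⊗ v₀ ⊗ … ⊗ v_{a-2} ⊗ Π(c_{a-1})`: all entries and all children. -/
def upAgg (h : ℕ) (c : Tree T V h) (r : List ((T × V) × Tree T V h)) : V :=
  c.agg * (r.map fun p => p.1.2 * p.2.agg).prod

/-- Repair the left aggregates of the nodes of height at most `top` on the left spine of a subtree,
on the way down; `x` is the left aggregate of the parent (the neutral element below the root). -/
def repairLeft (top : ℕ) : (h : ℕ) → V → Tree T V h → Timed (Tree T V h)
  | 0, _, y => pure y
  | h + 1, x, y => do
      let a ← if h + 1 ≤ top then do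
          tick (2 * Node.arity y + 1)
          pure (innerAgg h y.rest * (Node.last y).agg * x)
        else pure y.agg
      let c ← repairLeft top h a y.first
      pure (⟨a, c, y.rest⟩ : Node T V (Tree T V h))

/-- Repair the right aggregates of the nodes of height at most `top` on the right spine of a
subtree, on the way down; `x` is the right aggregate of the parent (the neutral element below the
root). -/
def repairRight (top : ℕ) : (h : ℕ) → V → Tree T V h → Timed (Tree T V h)
  | 0, _, y => pure y
  | h + 1, x, y => do
      let a ← if h + 1 ≤ top then do
          tick (2 * Node.arity y + 1)
          pure (x * y.first.agg * innerAgg h y.rest)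
        else pure y.agg
      let c ← repairRight top h a (Node.last y)
      pure (Node.setLast (⟨a, y.first, y.rest⟩ : Node T V (Tree T V h)) c)

/-- The pass down: repair the right spine from height `top` down to the right finger and, if
`left` is set, the left spine from the root down to the left finger. -/
def passDown (top : ℕ) (left : Bool) (F : Window T V) : Timed (Window T V) := do
  let c ← repairRight top F.height 1 (Node.last F.root)
  let y : Node T V (Tree T V F.height) := Node.setLast F.root c
  if left then do
    let c' ← repairLeft F.height F.height 1 y.first
    pure ⟨F.height, (⟨y.agg, c', y.rest⟩ : Node T V (Tree T V F.height))⟩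
  else
    pure ⟨F.height, y⟩

/-- Store the up aggregate at every node of a subtree. -/
def Tree.refreshUp : (h : ℕ) → Tree T V h → Tree T V h
  | 0, y => y
  | h + 1, y =>
      let c := Tree.refreshUp h y.first
      let r := y.rest.map fun p => (p.1, Tree.refreshUp h p.2)
      (⟨upAgg h c r, c, r⟩ : Node T V (Tree T V h))

/-- Store at every node the aggregate that the aggregates invariants prescribe: the inner aggregate
at the root, left and right aggregates on the spines, up aggregates elsewhere. -/
def Window.refresh (F : Window T V) : Window T V :=
  let y : Node T V (Tree T V F.height) := Tree.refreshUp (F.height + 1) F.root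
  (passDown F.height true
    ⟨F.height, (⟨innerAgg F.height y.rest, y.first, y.rest⟩ : Node T V (Tree T V F.height))⟩).val

end aggregates

/-! ### Bulk insertion, step 1: insertion sites search -/

section search

variable {T V C S : Type u} [LinearOrder T]

/-- The events found below a node: what happens in the first child, and then, entry by entry, the
value to be combined with the entry (if its timestamp occurs in the bulk) and what happens in the
child after it.  Children that receive nothing have `none`, and the list stops with the last entry
that had to be looked at. -/
structure SiteNode (V S : Type u) where
  first : Option S
  rest : List (Option V × Option S)

/-- The result of the search, in timestamp order and grouped by the node that is to be changed.  At
a null pointer: the new entries that belong there. -/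
def Sites (T V : Type u) : ℕ → Type u
  | 0 => List (T × V)
  | h + 1 => SiteNode V (Sites T V h)

/-- Whether there is a next entry in the bulk and its timestamp lies before `hi`. -/
def before (hi : WithTop T) : List (T × V) → Bool
  | [] => false
  | b :: _ => decide ((b.1 : WithTop T) < hi)

/-- Read the entries of the bulk before `hi`; returns them and the remaining bulk. -/
def takeBefore (hi : WithTop T) : List (T × V) → Timed (List (T × V) × List (T × V))
  | [] => pure ([], [])
  | b :: B => do
      tick 1
      if (b.1 : WithTop T) < hi then do
        let p ← takeBefore hi B
        pure (b :: p.1, p.2)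
      else pure ([], b :: B)

/-- Go down into a child whose timestamps lie before `hi`, if the next entry belongs there. -/
def enter (descend : WithTop T → C → List (T × V) → Timed (S × List (T × V)))
    (hi : WithTop T) (c : C) (B : List (T × V)) : Timed (Option S × List (T × V)) :=
  if before hi B then do
    let p ← descend hi c B
    pure (some p.1, p.2)
  else pure (none, B)

/-- If the next entry of the bulk has timestamp `t`, take its value. -/
def matchEntry (t : T) : List (T × V) → Option V × List (T × V)
  | [] => (none, [])
  | b :: B => if b.1 = t then (some b.2, B) else (none, b :: B)

/-- Scan a node from left to right, going down into the children that receive entries, until the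
next entry of the bulk is not before `hi`, the upper end of the range of the node. -/
def scan (descend : WithTop T → C → List (T × V) → Timed (S × List (T × V))) (hi : WithTop T) :
    C → List ((T × V) × C) → List (T × V) → Timed (SiteNode V S × List (T × V))
  | c, [], B => do
      tick 1
      let p ← enter descend hi c B
      pure (⟨p.1, []⟩, p.2)
  | c, e :: r, B => do
      tick 1
      let p ← enter descend (e.1.1 : WithTop T) c B
      let q := matchEntry e.1.1 p.2
      if before hi q.2 then do
        let w ← scan descend hi e.2 r q.2
        pure (⟨p.1, (q.1, w.1.first) :: w.1.rest⟩, w.2)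
      else pure (⟨p.1, [(q.1, none)]⟩, q.2)

/-- Find the sites of all entries of the bulk before `hi` in the given subtree.  The bulk is read
once; between the sites of consecutive entries the search goes up to their least common ancestor
and down again.  Nothing is modified. -/
def search : (h : ℕ) → WithTop T → Tree T V h → List (T × V) →
    Timed (Sites T V h × List (T × V))
  | 0, hi, _, B => takeBefore hi B
  | h + 1, hi, y, B => scan (search h) hi y.first y.rest B

/-- Whether the first timestamp in the node is at most `t`. -/
def Node.startsBy (y : Node T V C) (t : T) : Bool :=
  match y.rest with
  | [] => false
  | e :: _ => decide (e.1.1 ≤ t)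

/-- The height of the lowest node on the right spine whose first timestamp is at most `t`. -/
def lowestOnSpine (t : T) : (h : ℕ) → Tree T V (h + 1) → Option ℕ
  | 0, y => if Node.startsBy y t then some 1 else none
  | h + 1, y => (lowestOnSpine t h (Node.last y)).or
      (if Node.startsBy y t then some (h + 2) else none)

/-- The height of the node at which the walk up from the right finger stops: the lowest node on the
right spine whose first timestamp is at most `t`, or the root.  This is also the number of nodes
that the walk looks at. -/
def fingerWalk (t : T) (F : Window T V) : ℕ :=
  (lowestOnSpine t F.height F.root).getD (F.height + 1)

end search

/-! ### Bulk insertion, step 2: the interleave&split pass up -/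

section passup

variable {T V C S : Type u} [LinearOrder T] [Monoid V]

/-- A treelet for a target whose children have type `C`: either an entry to be inserted, with the
child that follows it, or an entry of the bulk whose timestamp is already present in the target. -/
inductive Treelet (T V C : Type u) where
  | insertion (entry : T × V) (child : C)
  | recomputation (entry : T × V)

/-- Whether a treelet is a recomputation event. -/
def Treelet.isRecomputation : Treelet T V C → Bool
  | .insertion _ _ => false
  | .recomputation _ => true

/-- Interleave the contents of a node with the treelets that target it, as in merge sort. -/
def interleave : List ((T × V) × C) → List (Treelet T V C) → Timed (List ((T × V) × C))
  | r, [] => pure r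
  | [], .insertion e c :: L => do
      tick 1
      let r ← interleave [] L
      pure ((e, c) :: r)
  | [], .recomputation _ :: L => do
      tick 1
      interleave [] L
  | p :: r, .insertion e c :: L => do
      tick 1
      if e.1 < p.1.1 then do
        let r' ← interleave (p :: r) L
        pure ((e, c) :: r')
      else do
        let r' ← interleave r (.insertion e c :: L)
        pure (p :: r')
  | p :: r, .recomputation e :: L => do
      tick 1
      if e.1 = p.1.1 then do
        let r' ← interleave r L
        pure (((p.1.1, p.1.2 * e.2), p.2) :: r')
      else do
        let r' ← interleave r (.recomputation e :: L)
        pure (p :: r')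
termination_by r L => r.length + L.length

/-- Whether a node lies on the left and on the right spine; the root lies on both. -/
structure Loc where
  left : Bool
  right : Bool

/-- Build a node and compute the aggregates that depend on children only: the up aggregate off the
spines and the inner aggregate at the root.  Left and right aggregates are left to the pass down. -/
def mkNode (h : ℕ) (loc : Loc) (c : Tree T V h) (r : List ((T × V) × Tree T V h)) :
    Timed (Tree T V (h + 1)) := do
  tick (2 * r.length + 2)
  pure (⟨match loc.left, loc.right with
    | false, false => upAgg h c r
    | true, true => innerAgg h r
    | _, _ => 1, c, r⟩ : Node T V (Tree T V h))

/-- The number of arity-`(μ + 1)` nodes that a node of arity `p > 2μ` is split into, besides the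
last node, whose arity is between `μ` and `2μ`. -/
def splitCount (μ p : ℕ) : ℕ :=
  if p % (μ + 1) = μ then p / (μ + 1) else p / (μ + 1) - 1

/-- Cut off `k` nodes of arity `μ + 1`, with one entry between consecutive nodes.  The nodes after
the first one come as treelets for the parent. -/
def bulkSplit (μ h : ℕ) (left right : Bool) : ℕ → Tree T V h → List ((T × V) × Tree T V h) →
    Timed (Tree T V (h + 1) × List (Treelet T V (Tree T V (h + 1))))
  | 0, c, r => do
      let y ← mkNode h ⟨left, right⟩ c r
      pure (y, [])
  | k + 1, c, r =>
      match r.drop μ with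
      | [] => do
          let y ← mkNode h ⟨left, right⟩ c r
          pure (y, [])
      | p :: r' => do
          tick (μ + 1)
          let y ← mkNode h ⟨left, false⟩ c (r.take μ)
          let q ← bulkSplit μ h false right k p.2 r'
          pure (y, .insertion p.1 q.1 :: q.2)

/-- Process one target: interleave its contents with its treelets, and split it if its arity
exceeds `2μ`.  Returns the node that stays in place and the treelets for its parent. -/
def processTarget (μ h : ℕ) (loc : Loc) (c : Tree T V h) (r : List ((T × V) × Tree T V h))
    (L : List (Treelet T V (Tree T V h))) :
    Timed (Tree T V (h + 1) × List (Treelet T V (Tree T V (h + 1)))) := do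
  tick 1
  let r' ← interleave r L
  if r'.length + 1 ≤ 2 * μ then do
    let y ← mkNode h loc c r'
    pure (y, [])
  else
    bulkSplit μ h loc.left loc.right (splitCount μ (r'.length + 1)) c r'

/-- Process the events in a child, if there are any. -/
def visit (up : Loc → C → S → Timed (C × List (Treelet T V C))) (loc : Loc) (c : C) :
    Option S → Timed (C × List (Treelet T V C))
  | none => pure (c, [])
  | some s => do
      let p ← up loc c s
      tick (p.2.length + 1)
      pure p

/-- Process the events in all children of a node and gather, in timestamp order, the treelets that
target the node. -/
def gather (up : Loc → C → S → Timed (C × List (Treelet T V C))) (left right : Bool) :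
    C → List ((T × V) × C) → SiteNode V S →
      Timed ((C × List ((T × V) × C)) × List (Treelet T V C))
  | c, [], s => do
      let p ← visit up ⟨left, right⟩ c s.first
      pure ((p.1, []), p.2)
  | c, e :: r, ⟨s, []⟩ => do
      let p ← visit up ⟨left, false⟩ c s
      pure ((p.1, e :: r), p.2)
  | c, e :: r, ⟨s, w :: ws⟩ => do
      tick 1
      let p ← visit up ⟨left, false⟩ c s
      let q ← gather up false right e.2 r ⟨w.2, ws⟩
      pure ((p.1, (e.1, q.1.1) :: q.1.2),
        p.2 ++ (w.1.map fun v => .recomputation (e.1.1, v)).toList ++ q.2)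

/-- The pass up in a subtree: a node becomes a target once the targets below it are done; it gets
their promoted entries and the recomputation events for its own entries.  At a null pointer, the
new entries become the treelets that target the leaf above.  A recomputation event rides along with
the treelets of all levels below its node, which costs one step for each level. -/
def passUp (μ : ℕ) : (h : ℕ) → Loc → Tree T V h → Sites T V h →
    Timed (Tree T V h × List (Treelet T V (Tree T V h)))
  | 0, _, y, s => do
      tick (List.length (α := T × V) s)
      pure (y, List.map (fun e : T × V => .insertion e y) s)
  | h + 1, loc, y, s => do
      let p ← gather (passUp μ h) loc.left loc.right y.first y.rest s
      tick ((h + 1) * p.2.countP Treelet.isRecomputation)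
      processTarget μ h loc p.1.1 p.1.2 p.2

/-- Search and pass up on the subtree whose root is the node of height `k` on the right spine, and
pass up from there as long as there are treelets.  Returns the new node, the treelets for its
parent, and the height of the highest node that was processed.

The recursion leads from the root to the node of height `k`; the algorithm itself is at that node
already, after its walk up from the right finger, and reaches the nodes above it through parent
pointers.  So a node above it takes time only if it is the target of some treelet. -/
def passUpSpine (μ k : ℕ) (B : List (T × V)) : (h : ℕ) → Loc → Tree T V (h + 1) →
    Timed ((Tree T V (h + 1) × List (Treelet T V (Tree T V (h + 1)))) × ℕ)
  | 0, loc, y => do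
      let s ← search 1 ⊤ y B
      let p ← passUp μ 1 loc y s.1
      pure (p, 1)
  | h + 1, loc, y =>
      if h + 2 ≤ k then do
        let s ← search (h + 2) ⊤ y B
        let p ← passUp μ (h + 2) loc y s.1
        pure (p, h + 2)
      else do
        let p ← passUpSpine μ k B h ⟨false, loc.right⟩ (Node.last y)
        let y' : Node T V (Tree T V (h + 1)) := Node.setLast y p.1.1
        if p.1.2.isEmpty then
          pure ((y', []), p.2)
        else do
          let q ← processTarget μ (h + 1) loc y'.first y'.rest p.1.2
          pure (q, h + 2)

/-- While there are treelets promoted out of the root, put a new root on top, which is their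
target.  Each round leaves fewer treelets, so that a number of rounds equal to the number of
treelets suffices. -/
def growRoot (μ : ℕ) : ℕ → (h : ℕ) → Tree T V (h + 1) → List (Treelet T V (Tree T V (h + 1))) →
    Timed (Window T V)
  | 0, h, y, _ => pure ⟨h, y⟩
  | n + 1, h, y, L =>
      if L.isEmpty then pure ⟨h, y⟩
      else do
        let p ← processTarget μ (h + 1) ⟨true, true⟩ y [] L
        growRoot μ n (h + 1) p.1 p.2

/-- `bulkInsert`, for a bulk in increasing timestamp order: insertion sites search from the right
finger, pass up, and pass down the right spine from the highest node that was processed; the left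
spine is repaired if the bulk reaches it or if the root was split. -/
def bulkInsert (μ : ℕ) (F : Window T V) : List (T × V) → Timed (Window T V)
  | [] => pure F
  | b :: B => do
      let k := fingerWalk b.1 F
      tick k
      let p ← passUpSpine μ k (b :: B) F.height ⟨true, true⟩ F.root
      let G ← growRoot μ p.1.2.length F.height p.1.1 p.1.2
      if F.height < G.height then
        passDown G.height true G
      else
        passDown p.2 (decide (k = F.height + 1) && !(Node.startsBy F.root b.1)) G

end passup

/-! ### Bulk eviction

Only the effect of `bulkEvict` on the tree is needed, not its running time. -/

section evict

variable {T V C : Type u} [LinearOrder T] [Monoid V]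

/-- What is left of a node after its local eviction: either `t` is one of its timestamps and
nothing below needs to change, or the eviction boundary runs through its new first child. -/
inductive Cut (T V C : Type u) where
  | exact (c : C) (r : List ((T × V) × C))
  | inside (c : C) (r : List ((T × V) × C))

/-- Local eviction: drop all entries with timestamps at most `t` and the children before them. -/
def cut (t : T) : C → List ((T × V) × C) → Cut T V C
  | c, [] => .inside c []
  | c, p :: r =>
      if t < p.1.1 then .inside c (p :: r)
      else if p.1.1 = t then .exact p.2 r
      else cut t p.2 r

/-- Repair an underflow of the node with children and entries `c, r` by means of its right neighbor
`z`, where `e` is the entry between the two in their least common ancestor.  If the deficit of the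
node is at most the surplus of `z`, a batch is moved from `z` to the node; otherwise the node is
merged into `z`.  Returns what is left of the node and the new separating entry (nothing after a
merge), and the new neighbor. -/
def rebalance (μ : ℕ) (c : C) (r : List ((T × V) × C)) (e : T × V) (z : Node T V C) :
    Option (Node T V C × (T × V)) × Node T V C :=
  if μ ≤ r.length + 1 then (some (⟨1, c, r⟩, e), z)
  else
    let k := μ - (r.length + 1)
    if k ≤ z.arity - μ then
      match z.rest.drop (k - 1) with
      | [] => (some (⟨1, c, r⟩, e), z)
      | p :: r' => (some (⟨1, c, r ++ (e, z.first) :: z.rest.take (k - 1)⟩, p.1), ⟨1, p.2, r'⟩)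
    else (none, ⟨1, c, r ++ (e, z.first) :: z.rest⟩)

/-- Evict up to `t` in the subtree `x`, through which the eviction boundary runs; `z` is the
neighbor of `x` to the right, at the same height, and `e` the entry between them. -/
def evictPair (μ : ℕ) (t : T) : (h : ℕ) → Tree T V h → T × V → Tree T V h →
    Option (Tree T V h × (T × V)) × Tree T V h
  | 0, x, e, z => (some (x, e), z)
  | h + 1, x, e, z =>
      match cut t x.first x.rest with
      | .exact c r => rebalance μ c r e z
      | .inside c (p :: r) =>
          match evictPair μ t h c p.1 p.2 with
          | (some q, c') => rebalance μ q.1 ((q.2, c') :: r) e z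
          | (none, c') => rebalance μ c' r e z
      | .inside c [] =>
          match evictPair μ t h c e z.first with
          | (some q, z₀) =>
              rebalance μ q.1 [] q.2 (⟨z.agg, z₀, z.rest⟩ : Node T V (Tree T V h))
          | (none, z₀) => (none, (⟨z.agg, z₀, z.rest⟩ : Node T V (Tree T V h)))

/-- Make a node the root, or its only child if it has no entries and is not a leaf. -/
def makeRoot : (h : ℕ) → Tree T V h → List ((T × V) × Tree T V h) → Window T V
  | 0, c, r => ⟨0, (⟨1, c, r⟩ : Node T V (Tree T V 0))⟩
  | h + 1, c, [] => ⟨h, c⟩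
  | h + 1, c, p :: r => ⟨h + 1, (⟨1, c, p :: r⟩ : Node T V (Tree T V (h + 1)))⟩

/-- Evict up to `t` in a node of the right spine all ancestors of which are gone, or in the root. -/
def evictRoot (μ : ℕ) (t : T) : (h : ℕ) → Tree T V (h + 1) → Window T V
  | 0, y =>
      match cut t y.first y.rest with
      | .exact c r => makeRoot 0 c r
      | .inside c r => makeRoot 0 c r
  | h + 1, y =>
      match cut t y.first y.rest with
      | .exact c r => makeRoot (h + 1) c r
      | .inside c [] => evictRoot μ t h c
      | .inside c (p :: r) =>
          match evictPair μ t (h + 1) c p.1 p.2 with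
          | (some q, c') => makeRoot (h + 1) q.1 ((q.2, c') :: r)
          | (none, c') => makeRoot (h + 1) c' r

/-- `bulkEvict t` removes all entries with timestamps at most `t`. -/
def bulkEvict (μ : ℕ) (t : T) (F : Window T V) : Window T V :=
  (evictRoot μ t F.height F.root).refresh

end evict

/-! ### Sequences of operations and the bounds -/

section operations

variable {T V : Type u} [LinearOrder T]

/-- The operations that change the window. -/
inductive Op (T V : Type u) where
  | insert (B : List (T × V))
  | evict (t : T)

/-- A bulk is a nonempty sequence of entries with strictly increasing timestamps. -/
def IsBulk (B : List (T × V)) : Prop := B ≠ [] ∧ B.Pairwise fun a b => a.1 < b.1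

/-- Every bulk that is inserted is a bulk indeed. -/
def Op.WellFormed : Op T V → Prop
  | .insert B => IsBulk B
  | .evict _ => True

/-- The total time of all bulk insertions in a sequence of operations that starts from `F`. -/
def totalInsertTime [Monoid V] (μ : ℕ) : Window T V → List (Op T V) → ℕ
  | _, [] => 0
  | F, .insert B :: ops =>
      (bulkInsert μ F B).time + totalInsertTime μ (bulkInsert μ F B).val ops
  | F, .evict t :: ops => totalInsertTime μ (bulkEvict μ t F) ops

/-- The out-of-order distance `d` of the earliest entry of the bulk: the number of entries of the
window that are later than it. -/
def outOfOrderDistance (F : Window T V) : List (T × V) → ℕ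
  | [] => 0
  | b :: _ => F.entries.countP fun e => decide (b.1 < e.1)

open Real in
/-- `log d + m (1 + log (d / m))`, where negative logarithms, and those of `0`, count as `0`. -/
noncomputable def amortizedBound (F : Window T V) (B : List (T × V)) : ℝ :=
  log⁺ (outOfOrderDistance F B : ℝ) +
    (B.length : ℝ) * (1 + log⁺ ((outOfOrderDistance F B : ℝ) / (B.length : ℝ)))

open Real in
/-- `log d + m (1 + log ((m + n) / m))`, where `log 0` counts as `0`. -/
noncomputable def worstCaseBound (F : Window T V) (B : List (T × V)) : ℝ :=
  log⁺ (outOfOrderDistance F B : ℝ) + (B.length : ℝ) *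
    (1 + Real.log (((B.length : ℝ) + (F.entries.length : ℝ)) / (B.length : ℝ)))

/-- The sum of the amortized bounds of all bulk insertions in a sequence of operations that starts
from `F`, each taken for the window at the time of the insertion. -/
noncomputable def totalAmortizedBound [Monoid V] (μ : ℕ) : Window T V → List (Op T V) → ℝ
  | _, [] => 0
  | F, .insert B :: ops =>
      amortizedBound F B + totalAmortizedBound μ (bulkInsert μ F B).val ops
  | F, .evict t :: ops => totalAmortizedBound μ (bulkEvict μ t F) ops

end operations

end FiBA

/-!
The search takes place in a subtree of height `k` of the right spine.  On the way up from the right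
finger to it the walk only meets nodes that lie entirely after the bulk, so `2 ^ k` is at most a
multiple of `d + 1`.  In this subtree each of the lowest `l` levels has at most `m` affected nodes,
and of the late nodes above them there are only about `d / 2 ^ l`; with `l = log₂ (d / m)` both
contributions have the size of `m * (1 + log⁺ (d / m))`.

The pass up may continue along the spine above this subtree for as long as nodes are split there.
Apart from a number of nodes bounded by the work already done, such a node receives just one entry,
so it overflows only if its arity is `2 * μ`, and it is then replaced by nodes of arities `μ + 1`
and `μ`.  Hence the number of nodes of arity `2 * μ` is a potential that pays for these splits; bulk
eviction does not increase it.
-/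

namespace FiBA

/-! ### Timed computations -/

section timed

variable {α β : Type u}

@[simp] theorem Timed.val_pure (a : α) : (pure a : Timed α).val = a := rfl

@[simp] theorem Timed.time_pure (a : α) : (pure a : Timed α).time = 0 := rfl

@[simp] theorem Timed.val_bind (x : Timed α) (f : α → Timed β) :
    (x >>= f).val = (f x.val).val := rfl

@[simp] theorem Timed.time_bind (x : Timed α) (f : α → Timed β) :
    (x >>= f).time = x.time + (f x.val).time := rfl

@[simp] theorem time_tick (k : ℕ) : (tick.{u} k).time = k := rfl

end timed

/-! ### Timestamps, arities and nodes of maximal arity -/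

section bounds

variable {T : Type u} [LinearOrder T]

/-- A strictly increasing list of timestamps, all of them strictly between `lo` and `hi`. -/
def Bounded (lo : WithBot T) (hi : WithTop T) (l : List T) : Prop :=
  l.Pairwise (· < ·) ∧ ∀ x ∈ l, lo < (x : WithBot T) ∧ (x : WithTop T) < hi

theorem bounded_bot_top {l : List T} : Bounded ⊥ ⊤ l ↔ l.Pairwise (· < ·) := by
  simp [Bounded]

theorem bounded_append_cons {lo : WithBot T} {hi : WithTop T} {l l' : List T} {x : T} :
    Bounded lo hi (l ++ x :: l') ↔
      Bounded lo x l ∧ Bounded x hi l' ∧ lo < (x : WithBot T) ∧ (x : WithTop T) < hi := by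
  simp only [Bounded, List.pairwise_append, List.pairwise_cons, List.forall_mem_append,
    List.forall_mem_cons, WithTop.coe_lt_coe, WithBot.coe_lt_coe]
  constructor
  · rintro ⟨⟨hl, ⟨hx, hl'⟩, hlt⟩, hbl, hbx, hbl'⟩
    exact ⟨⟨hl, fun y hy => ⟨(hbl y hy).1, (hlt y hy).1⟩⟩,
      ⟨hl', fun y hy => ⟨hx y hy, (hbl' y hy).2⟩⟩, hbx⟩
  · rintro ⟨⟨hl, hbl⟩, ⟨hl', hbl'⟩, hlo, hhi⟩
    refine ⟨⟨hl, ⟨fun y hy => (hbl' y hy).1, hl'⟩, fun y hy =>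
      ⟨(hbl y hy).2, fun z hz => (hbl y hy).2.trans (hbl' z hz).1⟩⟩, fun y hy => ⟨(hbl y hy).1, ?_⟩,
      ⟨hlo, hhi⟩, fun y hy => ⟨?_, (hbl' y hy).2⟩⟩
    · exact (WithTop.coe_lt_coe.2 (hbl y hy).2).trans hhi
    · exact hlo.trans (WithBot.coe_lt_coe.2 (hbl' y hy).1)

end bounds

section measures

variable {T V C : Type u}

/-- The timestamps of a list of entries with children, where `f` gives those of a child. -/
def flatKeys (f : C → List T) (r : List ((T × V) × C)) : List T :=
  r.flatMap fun p => p.1.1 :: f p.2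

@[simp] theorem flatKeys_nil (f : C → List T) : flatKeys (V := V) f [] = [] := rfl

@[simp] theorem flatKeys_cons (f : C → List T) (p : (T × V) × C) (r : List ((T × V) × C)) :
    flatKeys f (p :: r) = p.1.1 :: (f p.2 ++ flatKeys f r) := by
  simp [flatKeys]

@[simp] theorem flatKeys_append (f : C → List T) (r r' : List ((T × V) × C)) :
    flatKeys f (r ++ r') = flatKeys f r ++ flatKeys f r' := by
  simp [flatKeys]

/-- The timestamps of a tree, from left to right. -/
def Tree.keys (h : ℕ) (y : Tree T V h) : List T := (Tree.toList h y).map Prod.fst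

theorem Tree.keys_zero (y : Tree T V 0) : Tree.keys 0 y = [] := rfl

theorem Tree.keys_succ (h : ℕ) (y : Tree T V (h + 1)) :
    Tree.keys (h + 1) y = Tree.keys h y.first ++ flatKeys (Tree.keys h) y.rest := by
  simp [Tree.keys, Tree.toList, flatKeys, List.map_flatMap]

theorem Tree.keys_mk (h : ℕ) (a : V) (c : Tree T V h) (r : List ((T × V) × Tree T V h)) :
    Tree.keys (h + 1) (⟨a, c, r⟩ : Node T V (Tree T V h)) =
      Tree.keys h c ++ flatKeys (Tree.keys h) r :=
  Tree.keys_succ h _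

/-- The sum of a function over the children in a list of entries with children. -/
def childSum {M : Type*} [AddMonoid M] (f : C → M) (r : List ((T × V) × C)) : M :=
  (r.map fun p => f p.2).sum

section childSum

variable {M : Type*} [AddMonoid M] (f : C → M)

@[simp] theorem childSum_nil : childSum (T := T) (V := V) f [] = 0 := rfl

@[simp] theorem childSum_cons (p : (T × V) × C) (r : List ((T × V) × C)) :
    childSum f (p :: r) = f p.2 + childSum f r := by
  simp [childSum]

@[simp] theorem childSum_append (r r' : List ((T × V) × C)) :
    childSum f (r ++ r') = childSum f r + childSum f r' := by
  simp [childSum]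

end childSum

/-- `1` if a node with `n` entries has the maximal arity `2μ`, and `0` otherwise. -/
def fullIndicator (μ n : ℕ) : ℕ := if n + 1 = 2 * μ then 1 else 0

theorem fullIndicator_le_one (μ n : ℕ) : fullIndicator μ n ≤ 1 := by
  unfold fullIndicator; split <;> omega

theorem fullIndicator_eq_zero {μ n : ℕ} (h : n + 1 < 2 * μ) : fullIndicator μ n = 0 :=
  if_neg h.ne

theorem fullIndicator_mono {μ m n : ℕ} (h : m ≤ n) (hn : n + 1 ≤ 2 * μ) :
    fullIndicator μ m ≤ fullIndicator μ n := by
  unfold fullIndicator; split <;> split <;> omega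

/-- The number of nodes of maximal arity `2μ`: the potential of the amortized analysis. -/
def Tree.fullCount (μ : ℕ) : (h : ℕ) → Tree T V h → ℕ
  | 0, _ => 0
  | h + 1, y =>
      fullIndicator μ (List.length (α := (T × V) × Tree T V h) y.rest) +
        Tree.fullCount μ h y.first + childSum (Tree.fullCount μ h) y.rest

theorem Tree.fullCount_mk (μ h : ℕ) (a : V) (c : Tree T V h) (r : List ((T × V) × Tree T V h)) :
    Tree.fullCount μ (h + 1) (⟨a, c, r⟩ : Node T V (Tree T V h)) =
      fullIndicator μ r.length + Tree.fullCount μ h c + childSum (Tree.fullCount μ h) r := rfl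

/-- A node of arity between `a` and `2μ` whose subtrees satisfy the arity invariant.  The bound `a`
is `μ` below the root, and smaller for the root or for a node with an underflow. -/
def NodeArityOK (μ a h : ℕ) (y : Tree T V (h + 1)) : Prop :=
  a ≤ Node.arity y ∧ Node.arity y ≤ 2 * μ ∧
    Tree.ArityOK μ h y.first ∧ ∀ p ∈ y.rest, Tree.ArityOK μ h p.2

theorem arityOK_succ {μ h : ℕ} {y : Tree T V (h + 1)} :
    Tree.ArityOK μ (h + 1) y ↔ NodeArityOK μ μ h y := Iff.rfl

theorem NodeArityOK.mono {μ a b h : ℕ} {y : Tree T V (h + 1)} (hy : NodeArityOK μ a h y)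
    (hab : b ≤ a) : NodeArityOK μ b h y :=
  ⟨hab.trans hy.1, hy.2⟩

theorem nodeArityOK_mk {μ a h : ℕ} {x : V} {c : Tree T V h} {r : List ((T × V) × Tree T V h)} :
    NodeArityOK μ a h (⟨x, c, r⟩ : Node T V (Tree T V h)) ↔
      a ≤ r.length + 1 ∧ r.length + 1 ≤ 2 * μ ∧ Tree.ArityOK μ h c ∧
        ∀ p ∈ r, Tree.ArityOK μ h p.2 := Iff.rfl

/-- The least arity of the root of a window of height `h + 1`; only a leaf may be without
entries. -/
def rootMinArity (h : ℕ) : ℕ := if h = 0 then 1 else 2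

theorem one_le_rootMinArity (h : ℕ) : 1 ≤ rootMinArity h := by
  unfold rootMinArity; split <;> omega

theorem rootMinArity_le_two (h : ℕ) : rootMinArity h ≤ 2 := by
  unfold rootMinArity; split <;> omega

theorem Window.arityOK_iff {μ : ℕ} (hμ : 1 ≤ μ) (F : Window T V) :
    F.ArityOK μ ↔ NodeArityOK μ (rootMinArity F.height) F.height F.root := by
  have hlen : Node.arity F.root = F.root.rest.length + 1 := rfl
  have hroot : (2 ≤ Node.arity F.root ∧ Node.arity F.root ≤ 2 * μ) ∨
      (F.height = 0 ∧ F.root.rest = []) ↔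
      rootMinArity F.height ≤ Node.arity F.root ∧ Node.arity F.root ≤ 2 * μ := by
    rw [hlen, rootMinArity, ← List.length_eq_zero_iff]
    split <;> omega
  unfold Window.ArityOK NodeArityOK
  rw [hroot, and_assoc]

/-- The timestamps of a window, from left to right. -/
def Window.keys (F : Window T V) : List T := Tree.keys (F.height + 1) F.root

/-- The number of nodes of maximal arity in a window. -/
def Window.fullCount (μ : ℕ) (F : Window T V) : ℕ := Tree.fullCount μ (F.height + 1) F.root

theorem Window.valid_iff [LinearOrder T] {μ : ℕ} (hμ : 1 ≤ μ) (F : Window T V) :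
    F.Valid μ ↔
      NodeArityOK μ (rootMinArity F.height) F.height F.root ∧ F.keys.Pairwise (· < ·) := by
  rw [Window.Valid, F.arityOK_iff hμ, Window.keys, Tree.keys, List.pairwise_map]
  rfl

end measures

/-! ### Skeletons -/

section skeleton

variable {T V C : Type u}

/-- The shape and the timestamps of a tree.  The passes that only repair aggregates preserve it. -/
def Tree.skeleton : (h : ℕ) → Tree T V h → Tree T PUnit.{u + 1} h
  | 0, _ => PUnit.unit
  | h + 1, y => (⟨PUnit.unit, Tree.skeleton h y.first,
      y.rest.map fun p => ((p.1.1, PUnit.unit), Tree.skeleton h p.2)⟩ :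
        Node T PUnit (Tree T PUnit h))

theorem Tree.keys_skeleton :
    ∀ (h : ℕ) (y : Tree T V h), Tree.keys h (Tree.skeleton h y) = Tree.keys h y
  | 0, _ => rfl
  | h + 1, y => by
    rw [Tree.keys_succ, Tree.keys_succ]
    simp [Tree.skeleton, flatKeys, List.flatMap_map, Tree.keys_skeleton h]

theorem Tree.fullCount_skeleton (μ : ℕ) :
    ∀ (h : ℕ) (y : Tree T V h), Tree.fullCount μ h (Tree.skeleton h y) = Tree.fullCount μ h y
  | 0, _ => rfl
  | h + 1, y => by
    simp [Tree.skeleton, Tree.fullCount, childSum, Tree.fullCount_skeleton μ h, Function.comp_def]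

theorem Tree.arityOK_skeleton (μ : ℕ) :
    ∀ (h : ℕ) (y : Tree T V h), Tree.ArityOK μ h (Tree.skeleton h y) ↔ Tree.ArityOK μ h y
  | 0, _ => Iff.rfl
  | h + 1, y => by
    simp only [Tree.skeleton, Tree.ArityOK, Node.arity, Tree.arityOK_skeleton μ h, List.length_map,
      List.forall_mem_map]

/-- The shape and the timestamps of a window. -/
def Window.skeleton (F : Window T V) : Window T PUnit.{u + 1} :=
  ⟨F.height, Tree.skeleton (F.height + 1) F.root⟩

theorem Window.fullCount_skeleton (μ : ℕ) (F : Window T V) :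
    F.skeleton.fullCount μ = F.fullCount μ :=
  Tree.fullCount_skeleton μ _ F.root

theorem Window.valid_skeleton [LinearOrder T] {μ : ℕ} (F : Window T V) :
    F.skeleton.Valid μ ↔ F.Valid μ := by
  have hentries : (F.skeleton.entries.Pairwise fun a b => a.1 < b.1) ↔
      F.entries.Pairwise fun a b => a.1 < b.1 := by
    have := Tree.keys_skeleton _ F.root
    rw [Tree.keys, Tree.keys] at this
    unfold Window.entries
    rw [← List.pairwise_map (f := Prod.fst) (R := (· < ·)),
      ← List.pairwise_map (f := Prod.fst) (R := (· < ·)), ← this]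
    rfl
  rw [Window.Valid, Window.Valid, hentries]
  refine and_congr_left' (and_congr ?_ (and_congr (Tree.arityOK_skeleton μ _ _) ?_))
  · simp only [Window.skeleton, Tree.skeleton, Node.arity, List.length_map, List.map_eq_nil_iff]
  · exact List.forall_mem_map.trans
      (forall₂_congr fun p _ => Tree.arityOK_skeleton μ F.height p.2)

theorem setLastAux_concat (c : C) (e : T × V) (c' : C) :
    ∀ l : List ((T × V) × C), setLastAux c (l ++ [(e, c')]) = l ++ [(e, c)]
  | [] => rfl
  | [_] => rfl
  | p :: q :: l => congrArg (p :: ·) (setLastAux_concat c e c' (q :: l))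

theorem Node.last_concat (a : V) (f : C) (l : List ((T × V) × C)) (e : T × V) (c : C) :
    Node.last ⟨a, f, l ++ [(e, c)]⟩ = c := by
  simp [Node.last]

theorem Node.setLast_concat (a : V) (f : C) (l : List ((T × V) × C)) (e : T × V) (c c' : C) :
    Node.setLast ⟨a, f, l ++ [(e, c)]⟩ c' = ⟨a, f, l ++ [(e, c')]⟩ := by
  have haux := setLastAux_concat c' e c l
  cases l with
  | nil => rfl
  | cons p l => simpa [Node.setLast] using haux

theorem Node.eq_nil_or_concat (y : Node T V C) : y = ⟨y.agg, y.first, []⟩ ∨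
    ∃ l e c, y = ⟨y.agg, y.first, l ++ [(e, c)]⟩ := by
  obtain ⟨a, f, r⟩ := y
  rcases List.eq_nil_or_concat r with rfl | ⟨l, p, rfl⟩
  · exact Or.inl rfl
  · exact Or.inr ⟨l, p.1, p.2, by simp⟩

theorem Tree.skeleton_mk_first (h : ℕ) (a : V) (y : Node T V (Tree T V h)) (c : Tree T V h)
    (hc : Tree.skeleton h c = Tree.skeleton h y.first) :
    Tree.skeleton (h + 1) (⟨a, c, y.rest⟩ : Node T V (Tree T V h)) =
      Tree.skeleton (h + 1) y := by
  simp only [Tree.skeleton, hc]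
  rfl

theorem Tree.skeleton_setLast (h : ℕ) (a : V) (y : Node T V (Tree T V h)) (c : Tree T V h)
    (hc : Tree.skeleton h c = Tree.skeleton h y.last) :
    Tree.skeleton (h + 1) (Node.setLast (⟨a, y.first, y.rest⟩ : Node T V (Tree T V h)) c) =
      Tree.skeleton (h + 1) y := by
  rcases y.eq_nil_or_concat with hy | ⟨l, e, c', hy⟩
  · rw [hy] at hc ⊢
    exact Tree.skeleton_mk_first h a ⟨y.agg, y.first, []⟩ c hc
  · rw [hy, Node.last_concat] at hc
    rw [hy, Node.setLast_concat]
    simp only [Tree.skeleton, List.map_append, List.map_cons, List.map_nil, hc]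
    rfl

variable [Monoid V]

theorem Tree.skeleton_repairLeft (top : ℕ) : ∀ (h : ℕ) (x : V) (y : Tree T V h),
    Tree.skeleton h (repairLeft top h x y).val = Tree.skeleton h y
  | 0, _, _ => rfl
  | h + 1, x, y => by
    unfold repairLeft
    split <;> exact Tree.skeleton_mk_first h _ y _ (Tree.skeleton_repairLeft top h _ _)

theorem Tree.skeleton_repairRight (top : ℕ) : ∀ (h : ℕ) (x : V) (y : Tree T V h),
    Tree.skeleton h (repairRight top h x y).val = Tree.skeleton h y
  | 0, _, _ => rfl
  | h + 1, x, y => by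
    unfold repairRight
    split <;> exact Tree.skeleton_setLast h _ y _ (Tree.skeleton_repairRight top h _ _)

theorem Tree.skeleton_refreshUp : ∀ (h : ℕ) (y : Tree T V h),
    Tree.skeleton h (Tree.refreshUp h y) = Tree.skeleton h y
  | 0, _ => rfl
  | h + 1, y => by
    simp only [Tree.refreshUp, Tree.skeleton, Tree.skeleton_refreshUp h, List.map_map,
      Function.comp_def]
    rfl

theorem skeleton_passDown (top : ℕ) (left : Bool) (F : Window T V) :
    (passDown top left F).val.skeleton = F.skeleton := by
  have hright := Tree.skeleton_setLast F.height (Node.agg F.root) F.root _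
    (Tree.skeleton_repairRight top F.height 1 (Node.last F.root))
  cases left with
  | false => exact congrArg (Window.mk F.height) hright
  | true =>
    exact congrArg (Window.mk F.height) ((Tree.skeleton_mk_first F.height _ _ _
      (Tree.skeleton_repairLeft F.height F.height 1 _)).trans hright)

theorem skeleton_refresh (F : Window T V) : F.refresh.skeleton = F.skeleton :=
  (skeleton_passDown _ _ _).trans (congrArg (Window.mk F.height)
    (Tree.skeleton_refreshUp (F.height + 1) F.root))

end skeleton

/-! ### Bulk eviction creates no nodes of maximal arity -/

section evict

variable {T V C : Type u}

/-- The node `y` has arity between `a` and `2μ` and valid subtrees, its timestamps are among those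
of `l`, in the same order, and at most `n` nodes of its subtree have maximal arity.  Eviction
preserves these properties, up to a smaller `a`. -/
structure NodeWithin (μ a h : ℕ) (l : List T) (n : ℕ) (y : Tree T V (h + 1)) : Prop where
  arityOK : NodeArityOK μ a h y
  keys_sublist : (Tree.keys (h + 1) y).Sublist l
  fullCount_le : Tree.fullCount μ (h + 1) y ≤ n

/-- The content of the node that is left by a local eviction. -/
def Cut.content : Cut T V C → C × List ((T × V) × C)
  | .exact c r => (c, r)
  | .inside c r => (c, r)

theorem NodeWithin.drop_first [Monoid V] {μ a h n : ℕ} {l : List T} {x : V} {c : Tree T V h}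
    {p : (T × V) × Tree T V h} {r : List ((T × V) × Tree T V h)}
    (hy : NodeWithin μ a h l n (⟨x, c, p :: r⟩ : Node T V (Tree T V h))) :
    NodeWithin μ 1 h l n (⟨1, p.2, r⟩ : Node T V (Tree T V h)) := by
  obtain ⟨harity, hkeys, hfull⟩ := hy
  obtain ⟨-, hlen, -, hr⟩ := nodeArityOK_mk.1 harity
  rw [List.forall_mem_cons] at hr
  rw [List.length_cons] at hlen
  refine ⟨nodeArityOK_mk.2 ⟨by omega, by omega, hr⟩, ?_, ?_⟩
  · simp only [Tree.keys_mk, flatKeys_cons] at hkeys ⊢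
    exact ((List.sublist_cons_self _ _).trans (List.sublist_append_right _ _)).trans hkeys
  · have hmono := fullIndicator_mono (μ := μ) (Nat.le_add_right r.length 1) hlen
    simp only [Tree.fullCount_mk, childSum_cons, List.length_cons] at hfull ⊢
    omega

theorem NodeWithin.cut [Monoid V] [LinearOrder T] {μ h n : ℕ} {l : List T} (t : T) :
    ∀ {a : ℕ} {x : V} {c : Tree T V h} {r : List ((T × V) × Tree T V h)}, 1 ≤ a →
      NodeWithin μ a h l n (⟨x, c, r⟩ : Node T V (Tree T V h)) →
      NodeWithin μ 1 h l n
        (⟨1, (cut t c r).content.1, (cut t c r).content.2⟩ : Node T V (Tree T V h))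
  | _, _, _, [], ha, hy => ⟨hy.arityOK.mono ha, hy.keys_sublist, hy.fullCount_le⟩
  | _, _, _, p :: r, ha, hy => by
    rw [FiBA.cut]
    split
    · exact ⟨hy.arityOK.mono ha, hy.keys_sublist, hy.fullCount_le⟩
    · split
      · exact hy.drop_first
      · exact hy.drop_first.cut t le_rfl

/-- The timestamps in two neighboring trees, or in one after a merge. -/
def pairKeys (h : ℕ) : Option (Tree T V h × (T × V)) × Tree T V h → List T
  | (some q, z) => Tree.keys h q.1 ++ q.2.1 :: Tree.keys h z
  | (none, z) => Tree.keys h z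

/-- The number of nodes of maximal arity in two neighboring trees, or in one after a merge. -/
def pairFullCount (μ h : ℕ) : Option (Tree T V h × (T × V)) × Tree T V h → ℕ
  | (some q, z) => Tree.fullCount μ h q.1 + Tree.fullCount μ h z
  | (none, z) => Tree.fullCount μ h z

/-- The counterpart of `NodeWithin` for two neighboring trees, or for one after a merge. -/
structure PairWithin (μ h : ℕ) (l : List T) (n : ℕ)
    (o : Option (Tree T V h × (T × V)) × Tree T V h) : Prop where
  arityOK_right : Tree.ArityOK μ h o.2
  arityOK_left : ∀ q ∈ o.1, Tree.ArityOK μ h q.1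
  keys_sublist : (pairKeys h o).Sublist l
  fullCount_le : pairFullCount μ h o ≤ n

theorem PairWithin.mono {μ h : ℕ} {l l' : List T} {n n' : ℕ}
    {o : Option (Tree T V h × (T × V)) × Tree T V h} (ho : PairWithin μ h l n o)
    (hl : l.Sublist l') (hn : n ≤ n') : PairWithin μ h l' n' o :=
  ⟨ho.1, ho.2, ho.3.trans hl, ho.4.trans hn⟩

variable [Monoid V]

theorem rebalance_of_le {μ : ℕ} (c : C) {r : List ((T × V) × C)} (e : T × V) (z : Node T V C)
    (hr : μ ≤ r.length + 1) : rebalance μ c r e z = (some (⟨1, c, r⟩, e), z) :=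
  if_pos hr

theorem rebalance_of_deficit_le {μ : ℕ} (c : C) {r : List ((T × V) × C)} (e : T × V)
    {z : Node T V C} (hr : r.length + 1 < μ) (hz : μ - (r.length + 1) ≤ z.arity - μ) :
    ∃ s p r', z.rest = s ++ p :: r' ∧ r.length + s.length + 2 = μ ∧
      rebalance μ c r e z = (some (⟨1, c, r ++ (e, z.first) :: s⟩, p.1), ⟨1, p.2, r'⟩) := by
  obtain ⟨p, r', hdrop⟩ : ∃ p r', z.rest.drop (μ - (r.length + 1) - 1) = p :: r' := by
    refine List.exists_cons_of_ne_nil fun hdrop => ?_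
    rw [List.drop_eq_nil_iff] at hdrop
    rw [Node.arity] at hz
    omega
  refine ⟨z.rest.take (μ - (r.length + 1) - 1), p, r', ?_, ?_, ?_⟩
  · rw [← hdrop, List.take_append_drop]
  · rw [Node.arity] at hz
    rw [List.length_take]
    omega
  · simp only [rebalance, if_neg hr.not_ge, if_pos hz, hdrop]

theorem rebalance_of_lt_deficit {μ : ℕ} (c : C) {r : List ((T × V) × C)} (e : T × V)
    {z : Node T V C} (hr : r.length + 1 < μ) (hz : z.arity - μ < μ - (r.length + 1)) :
    rebalance μ c r e z = (none, ⟨1, c, r ++ (e, z.first) :: z.rest⟩) := by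
  simp only [rebalance, if_neg hr.not_ge, if_neg hz.not_ge]

/-- A batch leaves the node with the minimal arity and takes entries from its neighbor, and a merge
of a node with a deficit above the surplus of its neighbor has arity below `2μ`. -/
theorem NodeWithin.rebalance {μ h n : ℕ} (hμ : 2 ≤ μ) {l : List T} {x : V} {c : Tree T V h}
    {r : List ((T × V) × Tree T V h)}
    (hy : NodeWithin μ 1 h l n (⟨x, c, r⟩ : Node T V (Tree T V h))) (e : T × V)
    {z : Tree T V (h + 1)} (hz : Tree.ArityOK μ (h + 1) z) :
    PairWithin μ (h + 1) (l ++ e.1 :: Tree.keys (h + 1) z) (n + Tree.fullCount μ (h + 1) z)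
      (rebalance μ c r e z) := by
  obtain ⟨harity, hkeys, hfull⟩ := hy
  obtain ⟨-, hr, hc, hrc⟩ := nodeArityOK_mk.1 harity
  rcases le_or_gt μ (r.length + 1) with hle | hlt
  · rw [rebalance_of_le c e z hle]
    refine ⟨hz, ?_, hkeys.append_right _, Nat.add_le_add_right hfull _⟩
    rintro q ⟨⟩
    exact nodeArityOK_mk.2 ⟨hle, hr, hc, hrc⟩
  obtain ⟨a, zc, zr⟩ := z
  obtain ⟨hzμ, hz2μ, hzc, hzr⟩ := nodeArityOK_mk.1 hz
  rcases le_or_gt (μ - (r.length + 1)) (zr.length + 1 - μ) with hdef | hdef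
  · obtain ⟨s, p, r', rfl, hlen, heq⟩ := rebalance_of_deficit_le c e
      (z := (⟨a, zc, zr⟩ : Node T V (Tree T V h))) hlt hdef
    rw [heq]
    simp only [List.forall_mem_append, List.forall_mem_cons] at hzr
    simp only [List.length_append, List.length_cons] at hzμ hz2μ hdef
    refine ⟨nodeArityOK_mk.2 ⟨by omega, by omega, hzr.2⟩, ?_, ?_, ?_⟩
    · rintro q ⟨⟩
      refine nodeArityOK_mk.2 ⟨?_, ?_, hc, ?_⟩
      · simp only [List.length_append, List.length_cons]; omega
      · simp only [List.length_append, List.length_cons]; omega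
      · simpa only [List.forall_mem_append, List.forall_mem_cons] using ⟨hrc, hzc, hzr.1⟩
    · simp only [pairKeys, Tree.keys_mk, flatKeys_append, flatKeys_cons] at hkeys ⊢
      simpa using hkeys.append_right _
    · simp only [pairFullCount, Tree.fullCount_mk, childSum_append, childSum_cons] at hfull ⊢
      rw [fullIndicator_eq_zero (by simp only [List.length_append, List.length_cons]; omega),
        fullIndicator_eq_zero (n := r'.length) (by omega)]
      omega
  · rw [rebalance_of_lt_deficit c e (z := (⟨a, zc, zr⟩ : Node T V (Tree T V h))) hlt hdef]
    refine ⟨nodeArityOK_mk.2 ⟨?_, ?_, hc, ?_⟩, by rintro _ ⟨⟩, ?_, ?_⟩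
    · simp only [List.length_append, List.length_cons]; omega
    · simp only [List.length_append, List.length_cons]; omega
    · simpa only [List.forall_mem_append, List.forall_mem_cons] using ⟨hrc, hzc, hzr⟩
    · simp only [pairKeys, Tree.keys_mk, flatKeys_append, flatKeys_cons] at hkeys ⊢
      simpa using hkeys.append_right _
    · simp only [pairFullCount, Tree.fullCount_mk, childSum_append, childSum_cons] at hfull ⊢
      rw [fullIndicator_eq_zero (by simp only [List.length_append, List.length_cons]; omega)]
      omega

theorem NodeWithin.replace_pair {μ a h n : ℕ} {l : List T} {x : V} {c : Tree T V h}
    {p : (T × V) × Tree T V h} {r : List ((T × V) × Tree T V h)}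
    (hy : NodeWithin μ a h l n (⟨x, c, p :: r⟩ : Node T V (Tree T V h)))
    {q : Tree T V h × (T × V)} {c' : Tree T V h}
    (hq : PairWithin μ h (Tree.keys h c ++ p.1.1 :: Tree.keys h p.2)
      (Tree.fullCount μ h c + Tree.fullCount μ h p.2) (some q, c')) :
    NodeWithin μ a h l n (⟨1, q.1, (q.2, c') :: r⟩ : Node T V (Tree T V h)) := by
  obtain ⟨harity, hkeys, hfull⟩ := hy
  obtain ⟨ha, hlen, -, hr⟩ := nodeArityOK_mk.1 harity
  obtain ⟨hright, hleft, hqkeys, hqfull⟩ := hq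
  rw [List.forall_mem_cons] at hr
  refine ⟨nodeArityOK_mk.2 ⟨ha, hlen, hleft q rfl, List.forall_mem_cons.2 ⟨hright, hr.2⟩⟩, ?_, ?_⟩
  · simp only [Tree.keys_mk, flatKeys_cons, pairKeys] at hkeys hqkeys ⊢
    refine List.Sublist.trans ?_ hkeys
    simpa using hqkeys.append_right (flatKeys (Tree.keys h) r)
  · simp only [Tree.fullCount_mk, childSum_cons, pairFullCount, List.length_cons] at hfull hqfull ⊢
    omega

theorem NodeWithin.merge_pair {μ a h n : ℕ} {l : List T} {x : V} {c : Tree T V h}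
    {p : (T × V) × Tree T V h} {r : List ((T × V) × Tree T V h)}
    (hy : NodeWithin μ a h l n (⟨x, c, p :: r⟩ : Node T V (Tree T V h))) {c' : Tree T V h}
    (hq : PairWithin μ h (Tree.keys h c ++ p.1.1 :: Tree.keys h p.2)
      (Tree.fullCount μ h c + Tree.fullCount μ h p.2) (none, c')) :
    NodeWithin μ 1 h l n (⟨1, c', r⟩ : Node T V (Tree T V h)) := by
  obtain ⟨harity, hkeys, hfull⟩ := hy
  obtain ⟨-, hlen, -, hr⟩ := nodeArityOK_mk.1 harity
  obtain ⟨hright, -, hqkeys, hqfull⟩ := hq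
  rw [List.forall_mem_cons] at hr
  rw [List.length_cons] at hlen
  refine ⟨nodeArityOK_mk.2 ⟨by omega, by omega, hright, hr.2⟩, ?_, ?_⟩
  · simp only [Tree.keys_mk, flatKeys_cons, pairKeys] at hkeys hqkeys ⊢
    refine List.Sublist.trans ?_ hkeys
    simpa using hqkeys.append_right (flatKeys (Tree.keys h) r)
  · have hmono := fullIndicator_mono (μ := μ) (Nat.le_add_right r.length 1) hlen
    simp only [Tree.fullCount_mk, childSum_cons, pairFullCount, List.length_cons] at hfull hqfull ⊢
    omega

/-- If the eviction boundary runs through the last child of a node, this child is repaired together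
with the first child of the right neighbor of the node. -/
theorem PairWithin.rebalance_first {μ h n : ℕ} (hμ : 2 ≤ μ) {l : List T} {z : Tree T V (h + 1)}
    (hz : Tree.ArityOK μ (h + 1) z) {q : Tree T V h × (T × V)} {z₀ : Tree T V h}
    (hq : PairWithin μ h (l ++ Tree.keys h z.first) (n + Tree.fullCount μ h z.first)
      (some q, z₀)) :
    PairWithin μ (h + 1) (l ++ Tree.keys (h + 1) z) (n + Tree.fullCount μ (h + 1) z)
      (rebalance μ q.1 [] q.2 (⟨z.agg, z₀, z.rest⟩ : Node T V (Tree T V h))) := by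
  obtain ⟨hz1, hz2, -, hz4⟩ := hz
  obtain ⟨hright, hleft, hqkeys, hqfull⟩ := hq
  have hnode : NodeWithin μ 1 h (Tree.keys h q.1) (Tree.fullCount μ h q.1)
      (⟨1, q.1, []⟩ : Node T V (Tree T V h)) := by
    refine ⟨nodeArityOK_mk.2 ⟨by simp, by simp; omega, hleft q rfl, by simp⟩, ?_, ?_⟩
    · simp [Tree.keys_mk]
    · simp [Tree.fullCount_mk, fullIndicator_eq_zero (μ := μ) (n := 0) (by omega)]
  refine (hnode.rebalance hμ q.2 (z := (⟨z.agg, z₀, z.rest⟩ : Node T V (Tree T V h)))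
    ⟨hz1, hz2, hright, hz4⟩).mono ?_ ?_
  · rw [Tree.keys_mk, Tree.keys_succ h z]
    simpa [pairKeys] using hqkeys.append_right (flatKeys (Tree.keys h) z.rest)
  · simp only [pairFullCount, Tree.fullCount] at hqfull ⊢
    omega

theorem PairWithin.merge_first {μ h n : ℕ} {l : List T} {z : Tree T V (h + 1)}
    (hz : Tree.ArityOK μ (h + 1) z) {z₀ : Tree T V h}
    (hq : PairWithin μ h (l ++ Tree.keys h z.first) (n + Tree.fullCount μ h z.first) (none, z₀)) :
    PairWithin μ (h + 1) (l ++ Tree.keys (h + 1) z) (n + Tree.fullCount μ (h + 1) z)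
      (none, (⟨z.agg, z₀, z.rest⟩ : Node T V (Tree T V h))) := by
  obtain ⟨hz1, hz2, -, hz4⟩ := hz
  obtain ⟨hright, -, hqkeys, hqfull⟩ := hq
  refine ⟨⟨hz1, hz2, hright, hz4⟩, by simp, ?_, ?_⟩
  · simp only [pairKeys, Tree.keys_mk, Tree.keys_succ h z] at hqkeys ⊢
    simpa using hqkeys.append_right (flatKeys (Tree.keys h) z.rest)
  · simp only [pairFullCount, Tree.fullCount] at hqfull ⊢
    omega

theorem makeRoot_within {μ : ℕ} (hμ : 2 ≤ μ) {l : List T} {n : ℕ} : ∀ (h : ℕ) {x : V}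
    {c : Tree T V h} {r : List ((T × V) × Tree T V h)},
    NodeWithin μ 1 h l n (⟨x, c, r⟩ : Node T V (Tree T V h)) →
    NodeWithin μ (rootMinArity (makeRoot h c r).height) (makeRoot h c r).height l n
      (makeRoot h c r).root
  | 0, _, _, _, hy => ⟨hy.arityOK, hy.keys_sublist, hy.fullCount_le⟩
  | h + 1, x, c, [], hy => by
    refine ⟨(arityOK_succ.1 hy.arityOK.2.2.1).mono ((rootMinArity_le_two h).trans hμ), ?_,
      le_trans ?_ hy.fullCount_le⟩
    · simpa [Tree.keys_mk, makeRoot] using hy.keys_sublist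
    · rw [Tree.fullCount_mk, childSum_nil]
      exact Nat.le_add_left _ _
  | h + 1, x, c, p :: r, hy =>
    ⟨⟨by simp [makeRoot, rootMinArity, Node.arity], hy.arityOK.2⟩, hy.keys_sublist,
      hy.fullCount_le⟩

variable [LinearOrder T]

theorem evictPair_within {μ : ℕ} (hμ : 2 ≤ μ) (t : T) : ∀ (h : ℕ) (x : Tree T V h) (e : T × V)
    (z : Tree T V h), Tree.ArityOK μ h x → Tree.ArityOK μ h z →
    PairWithin μ h (Tree.keys h x ++ e.1 :: Tree.keys h z)
      (Tree.fullCount μ h x + Tree.fullCount μ h z) (evictPair μ t h x e z)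
  | 0, _, _, _, _, _ => ⟨trivial, fun _ _ => trivial, List.Sublist.refl _, le_rfl⟩
  | h + 1, x, e, z, hx, hz => by
    have hcut := NodeWithin.cut t (c := x.first) (r := x.rest) (by omega : 1 ≤ μ)
      ⟨hx, List.Sublist.refl _, le_rfl⟩
    rw [evictPair]
    split
    case h_1 c r heq =>
      rw [heq] at hcut
      exact hcut.rebalance hμ e hz
    case h_2 c p r heq =>
      rw [heq] at hcut
      obtain ⟨-, -, hc, hr⟩ := hcut.arityOK
      have ih := evictPair_within hμ t h c p.1 p.2 hc (hr p (by simp [Cut.content]))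
      split <;> rename_i hpair <;> rw [hpair] at ih
      · exact (hcut.replace_pair ih).rebalance hμ e hz
      · exact (hcut.merge_pair ih).rebalance hμ e hz
    case h_3 c heq =>
      rw [heq] at hcut
      obtain ⟨⟨-, -, hc, -⟩, hkeys, hfull⟩ := hcut
      have ih : PairWithin μ h ((Tree.keys (h + 1) x ++ [e.1]) ++ Tree.keys h z.first)
          (Tree.fullCount μ (h + 1) x + Tree.fullCount μ h z.first)
          (evictPair μ t h c e z.first) := by
        refine (evictPair_within hμ t h c e z.first hc hz.2.2.1).mono ?_ ?_
        · simp only [Cut.content, Tree.keys_mk, flatKeys_nil, List.append_nil] at hkeys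
          rw [← List.append_cons, Tree.keys_succ]
          exact hkeys.append_right _
        · simp only [Cut.content, Tree.fullCount_mk, childSum_nil] at hfull
          exact Nat.add_le_add_right (le_trans (by omega) hfull) _
      rw [List.append_cons]
      split <;> rename_i hpair <;> rw [hpair] at ih
      · exact ih.rebalance_first hμ hz
      · exact ih.merge_first hz

theorem evictRoot_within {μ : ℕ} (hμ : 2 ≤ μ) (t : T) {l : List T} {n : ℕ} : ∀ (h : ℕ)
    (y : Tree T V (h + 1)), NodeWithin μ 1 h l n y →
    NodeWithin μ (rootMinArity (evictRoot μ t h y).height) (evictRoot μ t h y).height l n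
      (evictRoot μ t h y).root
  | 0, y, hy => by
    have hcut := NodeWithin.cut t (c := y.first) (r := y.rest) le_rfl hy
    rw [evictRoot]
    split <;> rename_i heq <;> rw [heq] at hcut <;> exact makeRoot_within hμ 0 hcut
  | h + 1, y, hy => by
    have hcut := NodeWithin.cut t (c := y.first) (r := y.rest) le_rfl hy
    rw [evictRoot]
    split
    case h_1 c r heq =>
      rw [heq] at hcut
      exact makeRoot_within hμ (h + 1) hcut
    case h_2 c heq =>
      rw [heq] at hcut
      obtain ⟨⟨-, -, hc, -⟩, hkeys, hfull⟩ := hcut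
      refine evictRoot_within hμ t h c
        ⟨(arityOK_succ.1 hc).mono (by omega), ?_, le_trans ?_ hfull⟩
      · simpa [Cut.content, Tree.keys_mk] using hkeys
      · simp only [Cut.content, Tree.fullCount_mk, childSum_nil]
        exact Nat.le_add_left _ _
    case h_3 c p r heq =>
      rw [heq] at hcut
      obtain ⟨-, -, hc, hr⟩ := hcut.arityOK
      have ih := evictPair_within hμ t (h + 1) c p.1 p.2 hc (hr p (by simp [Cut.content]))
      dsimp only
      split <;> rename_i hpair <;> rw [hpair] at ih
      · exact makeRoot_within hμ (h + 1) (hcut.replace_pair ih)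
      · exact makeRoot_within hμ (h + 1) (hcut.merge_pair ih)

theorem bulkEvict_within {μ : ℕ} (hμ : 2 ≤ μ) (t : T) {F : Window T V} (hF : F.Valid μ) :
    NodeWithin μ (rootMinArity (evictRoot μ t F.height F.root).height)
      (evictRoot μ t F.height F.root).height F.keys (F.fullCount μ)
      (evictRoot μ t F.height F.root).root :=
  evictRoot_within hμ t F.height F.root
    ⟨((F.valid_iff (by omega)).1 hF).1.mono (one_le_rootMinArity _), List.Sublist.refl _, le_rfl⟩

theorem bulkEvict_valid {μ : ℕ} (hμ : 2 ≤ μ) (t : T) {F : Window T V} (hF : F.Valid μ) :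
    (bulkEvict μ t F).Valid μ := by
  have hwithin := bulkEvict_within hμ t hF
  rw [← Window.valid_skeleton, bulkEvict, skeleton_refresh, Window.valid_skeleton,
    Window.valid_iff (by omega)]
  exact ⟨hwithin.arityOK, ((F.valid_iff (by omega)).1 hF).2.sublist hwithin.keys_sublist⟩

theorem fullCount_bulkEvict_le {μ : ℕ} (hμ : 2 ≤ μ) (t : T) {F : Window T V} (hF : F.Valid μ) :
    (bulkEvict μ t F).fullCount μ ≤ F.fullCount μ := by
  rw [← Window.fullCount_skeleton, bulkEvict, skeleton_refresh, Window.fullCount_skeleton]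
  exact (bulkEvict_within hμ t hF).fullCount_le

end evict

/-! ### Interleaving and splitting -/

section interleave

variable {T V C : Type u}

/-- The timestamp of a treelet. -/
def Treelet.key : Treelet T V C → T
  | .insertion e _ => e.1
  | .recomputation e => e.1

/-- The treelets that insert the given entries, each with the child that follows it. -/
def insertions (R : List ((T × V) × C)) : List (Treelet T V C) :=
  R.map fun p => .insertion p.1 p.2

/-- The number of recomputation events among the treelets. -/
def recCount (L : List (Treelet T V C)) : ℕ := L.countP Treelet.isRecomputation

/-- The number of insertions among the treelets. -/
def insCount (L : List (Treelet T V C)) : ℕ := L.countP fun x => !x.isRecomputation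

theorem insCount_add_recCount (L : List (Treelet T V C)) :
    insCount L + recCount L = L.length := by
  have hcount := List.length_eq_countP_add_countP (l := L) Treelet.isRecomputation
  simp only [Bool.not_eq_true, Bool.decide_eq_false] at hcount
  rw [insCount, recCount]
  omega

@[simp] theorem length_insertions (R : List ((T × V) × C)) :
    (insertions R).length = R.length := by simp [insertions]

@[simp] theorem recCount_insertions (R : List ((T × V) × C)) : recCount (insertions R) = 0 := by
  simp [insertions, recCount, List.countP_map, Function.comp_def, Treelet.isRecomputation]

@[simp] theorem insCount_append (L L' : List (Treelet T V C)) :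
    insCount (L ++ L') = insCount L + insCount L' := by simp [insCount]

@[simp] theorem recCount_append (L L' : List (Treelet T V C)) :
    recCount (L ++ L') = recCount L + recCount L' := by simp [recCount]

variable [LinearOrder T] [Monoid V]

theorem interleave_nil (r : List ((T × V) × C)) : interleave r [] = pure r := by
  unfold interleave; cases r <;> rfl

theorem time_interleave_le (r : List ((T × V) × C)) (L : List (Treelet T V C)) :
    (interleave r L).time ≤ r.length + L.length := by
  fun_induction interleave r L <;> (try simp only [Timed.time_bind]) <;> (try split) <;>
    simp only [Timed.time_bind, Timed.time_pure, time_tick, List.length_cons] at * <;> omega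

theorem length_interleave (r : List ((T × V) × C)) (L : List (Treelet T V C)) :
    (interleave r L).val.length = r.length + insCount L := by
  fun_induction interleave r L <;> (try simp only [Timed.val_bind]) <;> (try split) <;>
    simp_all [insCount, Treelet.isRecomputation] <;> omega

theorem interleave_nil_insertions : ∀ R : List ((T × V) × C),
    (interleave [] (insertions R)).val = R
  | [] => by simp [insertions, interleave_nil]
  | p :: R => by
    have ih := interleave_nil_insertions R
    simp only [insertions, List.map_cons] at ih ⊢
    rw [interleave]
    simp [ih]

theorem interleave_cons_insertions_append (p : (T × V) × C) (r : List ((T × V) × C))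
    (L : List (Treelet T V C)) : ∀ R : List ((T × V) × C), (∀ x ∈ R, x.1.1 < p.1.1) →
      (interleave (p :: r) (insertions R ++ L)).val = R ++ (interleave (p :: r) L).val
  | [], _ => by simp [insertions]
  | q :: R, hlt => by
    rw [List.forall_mem_cons] at hlt
    have ih := interleave_cons_insertions_append p r L R hlt.2
    simp only [insertions, List.map_cons, List.cons_append] at ih ⊢
    rw [interleave]
    simp [hlt.1, ih]

theorem interleave_cons_of_lt_key (p : (T × V) × C) (r : List ((T × V) × C)) :
    ∀ L : List (Treelet T V C), (∀ x ∈ L, p.1.1 < x.key) →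
      (interleave (p :: r) L).val = p :: (interleave r L).val
  | [], _ => by simp [interleave_nil]
  | .insertion e _ :: _, hlt => by
    have hnot : ¬ e.1 < p.1.1 := not_lt_of_gt (hlt _ List.mem_cons_self)
    rw [interleave]
    simp [hnot]
  | .recomputation e :: _, hlt => by
    have hne : ¬ e.1 = p.1.1 := ne_of_gt (hlt _ List.mem_cons_self)
    rw [interleave]
    simp [hne]

theorem interleave_insertions_of_lt (R : List ((T × V) × C)) : ∀ r : List ((T × V) × C),
    (∀ p ∈ r, ∀ x ∈ R, p.1.1 < x.1.1) → (interleave r (insertions R)).val = r ++ R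
  | [], _ => interleave_nil_insertions R
  | p :: r, hlt => by
    rw [List.forall_mem_cons] at hlt
    have hkey : ∀ x ∈ insertions R, p.1.1 < x.key := List.forall_mem_map.2 hlt.1
    rw [interleave_cons_of_lt_key p r _ hkey, interleave_insertions_of_lt R r hlt.2,
      List.cons_append]

end interleave

section split

variable {T V : Type u}

/-- The node contents `c, r` are distributed, in order, over a node `y` and the nodes in `R`, with
at most `n` nodes of maximal arity on top of those below. -/
structure SplitInto (μ h : ℕ) (c : Tree T V h) (r : List ((T × V) × Tree T V h)) (n : ℕ)
    (y : Tree T V (h + 1)) (R : List ((T × V) × Tree T V (h + 1))) : Prop where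
  keys_eq : Tree.keys (h + 1) y ++ flatKeys (Tree.keys (h + 1)) R =
    Tree.keys h c ++ flatKeys (Tree.keys h) r
  fullCount_le : Tree.fullCount μ (h + 1) y + childSum (Tree.fullCount μ (h + 1)) R ≤
    Tree.fullCount μ h c + childSum (Tree.fullCount μ h) r + n
  arityOK : ∀ p ∈ R, Tree.ArityOK μ (h + 1) p.2

theorem splitInto_singleton (μ h : ℕ) (a : V) (c : Tree T V h) (r : List ((T × V) × Tree T V h)) :
    SplitInto μ h c r (fullIndicator μ r.length) (⟨a, c, r⟩ : Node T V (Tree T V h)) [] := by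
  refine ⟨by simp [Tree.keys_mk], ?_, by simp⟩
  rw [Tree.fullCount_mk, childSum_nil]
  omega

theorem SplitInto.cons {μ h n : ℕ} {c' : Tree T V h} {r' : List ((T × V) × Tree T V h)}
    {y : Tree T V (h + 1)} {R : List ((T × V) × Tree T V (h + 1))}
    (hsplit : SplitInto μ h c' r' n y R) (hy : Tree.ArityOK μ (h + 1) y) (a : V) (c : Tree T V h)
    {r : List ((T × V) × Tree T V h)} (hr : r.length + 1 < 2 * μ) (e : T × V) :
    SplitInto μ h c (r ++ (e, c') :: r') n (⟨a, c, r⟩ : Node T V (Tree T V h)) ((e, y) :: R) := by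
  obtain ⟨hkeys, hfull, hR⟩ := hsplit
  refine ⟨?_, ?_, List.forall_mem_cons.2 ⟨hy, hR⟩⟩
  · simp [Tree.keys_mk, hkeys]
  · simp only [Tree.fullCount_mk, fullIndicator_eq_zero hr, childSum_append, childSum_cons]
    omega

/-- The result of processing a target whose contents, after interleaving, are `c, I`. -/
structure TargetProcessed (μ h : ℕ) (c : Tree T V h) (I : List ((T × V) × Tree T V h))
    (y : Tree T V (h + 1)) (R : List ((T × V) × Tree T V (h + 1))) : Prop
    extends SplitInto μ h c I (if I.length = 2 * μ then 0 else 1) y R where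
  nodeArityOK : ∀ a ≤ μ, a ≤ I.length + 1 → NodeArityOK μ a h y
  length_eq : R.length = 0 ∨ 2 * μ ≤ I.length ∧ (R.length + 1) * (μ + 1) ≤ I.length + 2

theorem TargetProcessed.nodeArityOK_of_ne_nil {μ h : ℕ} {c : Tree T V h}
    {I : List ((T × V) × Tree T V h)} {y : Tree T V (h + 1)}
    {R : List ((T × V) × Tree T V (h + 1))} (htarget : TargetProcessed μ h c I y R) (hR : R ≠ []) :
    NodeArityOK μ μ h y := by
  have hpos := List.length_pos_iff.2 hR
  exact htarget.nodeArityOK μ le_rfl (by rcases htarget.length_eq with h | h <;> omega)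

theorem TargetProcessed.length_le {μ h n m : ℕ} (hμ : 2 ≤ μ) {c : Tree T V h}
    {I : List ((T × V) × Tree T V h)} {y : Tree T V (h + 1)}
    {R : List ((T × V) × Tree T V (h + 1))} (htarget : TargetProcessed μ h c I y R)
    (hI : I.length = n + m) (hn : n + 1 ≤ 2 * μ) (hm : 1 ≤ m) :
    R.length ≤ m ∧ (2 ≤ m → R.length < m) ∧ (n = 0 → R.length < m) := by
  rcases htarget.length_eq with hR | ⟨-, hR⟩
  · omega
  · rw [hI] at hR
    refine ⟨?_, fun _ => ?_, fun _ => ?_⟩ <;> by_contra <;> nlinarith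

/-- Two or more treelets become fewer; a single one is passed on only by a node of maximal arity,
and leaves two nodes of smaller arity. -/
theorem TargetProcessed.potential_le {μ h n m : ℕ} (hμ : 2 ≤ μ) {c : Tree T V h}
    {I : List ((T × V) × Tree T V h)} {y : Tree T V (h + 1)}
    {R : List ((T × V) × Tree T V (h + 1))} (htarget : TargetProcessed μ h c I y R)
    (hI : I.length = n + m) (hn : n + 1 ≤ 2 * μ) (hm : 1 ≤ m) :
    Tree.fullCount μ (h + 1) y + childSum (Tree.fullCount μ (h + 1)) R + 2 * R.length + 1 ≤
      fullIndicator μ n + (Tree.fullCount μ h c + childSum (Tree.fullCount μ h) I) + 2 * m := by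
  have hfull := htarget.fullCount_le
  obtain ⟨hle, hlt, -⟩ := htarget.length_le hμ hI hn hm
  rcases htarget.length_eq with hR | ⟨hlen, -⟩
  · split at hfull <;> omega
  · rcases Nat.lt_or_ge m 2 with hone | htwo
    · rw [if_pos (by omega)] at hfull
      rw [fullIndicator, if_pos (by omega)]
      omega
    · have := hlt htwo
      split at hfull <;> omega

variable [Monoid V]

theorem time_mkNode (h : ℕ) (loc : Loc) (c : Tree T V h) (r : List ((T × V) × Tree T V h)) :
    (mkNode h loc c r).time = 2 * r.length + 2 := rfl

theorem exists_mkNode_val_eq (h : ℕ) (loc : Loc) (c : Tree T V h)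
    (r : List ((T × V) × Tree T V h)) :
    ∃ a, (mkNode h loc c r).val = (⟨a, c, r⟩ : Node T V (Tree T V h)) := ⟨_, rfl⟩

theorem exists_eq_append_cons_of_lt_length {α : Type*} {n : ℕ} {l : List α} (hn : n < l.length) :
    ∃ l₁ a l₂, l = l₁ ++ a :: l₂ ∧ l₁.length = n :=
  ⟨l.take n, l[n], l.drop (n + 1), by simp, by simp [hn.le]⟩

theorem bulkSplit_zero (μ h : ℕ) (left right : Bool) (c : Tree T V h)
    (r : List ((T × V) × Tree T V h)) : bulkSplit μ h left right 0 c r =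
      (mkNode h ⟨left, right⟩ c r >>= fun y => pure (y, [])) := rfl

theorem bulkSplit_succ_append (μ h : ℕ) (left right : Bool) (k : ℕ) (c : Tree T V h)
    {l : List ((T × V) × Tree T V h)} (hl : l.length = μ) (p : (T × V) × Tree T V h)
    (r : List ((T × V) × Tree T V h)) :
    bulkSplit μ h left right (k + 1) c (l ++ p :: r) = (tick (μ + 1) >>= fun _ =>
      mkNode h ⟨left, false⟩ c l >>= fun y => bulkSplit μ h false right k p.2 r >>= fun q =>
      pure (y, .insertion p.1 q.1 :: q.2)) := by
  rw [bulkSplit, List.drop_left' hl, List.take_left' hl]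

theorem bulkSplit_splitInto {μ h : ℕ} (hμ : 2 ≤ μ) : ∀ (k : ℕ) (left right : Bool) (c : Tree T V h)
    (r : List ((T × V) × Tree T V h)), k * (μ + 1) + μ ≤ r.length + 1 →
    r.length + 1 ≤ k * (μ + 1) + 2 * μ → Tree.ArityOK μ h c → (∀ p ∈ r, Tree.ArityOK μ h p.2) →
    ∃ R, (bulkSplit μ h left right k c r).val.2 = insertions R ∧ R.length = k ∧
      SplitInto μ h c r (if r.length + 1 = k * (μ + 1) + 2 * μ then 1 else 0)
        (bulkSplit μ h left right k c r).val.1 R ∧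
      Tree.ArityOK μ (h + 1) (bulkSplit μ h left right k c r).val.1
  | 0, left, right, c, r, hlow, hhigh, hc, hr => by
    obtain ⟨a, ha⟩ := exists_mkNode_val_eq h ⟨left, right⟩ c r
    simp only [bulkSplit_zero, Timed.val_bind, Timed.val_pure, ha, zero_mul, zero_add] at *
    exact ⟨[], rfl, rfl, splitInto_singleton μ h a c r, nodeArityOK_mk.2 ⟨hlow, hhigh, hc, hr⟩⟩
  | k + 1, left, right, c, r, hlow, hhigh, hc, hr => by
    rw [Nat.succ_mul] at hlow hhigh
    obtain ⟨l, p, r, rfl, hl⟩ := exists_eq_append_cons_of_lt_length (by omega : μ < r.length)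
    rw [List.forall_mem_append, List.forall_mem_cons] at hr
    rw [List.length_append, List.length_cons] at *
    obtain ⟨a, ha⟩ := exists_mkNode_val_eq h ⟨left, false⟩ c l
    obtain ⟨R, hval, hlen, hsplit, hy⟩ := bulkSplit_splitInto hμ k false right p.2 r (by omega)
      (by omega) hr.2.1 hr.2.2
    rw [bulkSplit_succ_append μ h left right k c hl p r]
    simp only [Timed.val_bind, Timed.val_pure, ha]
    refine ⟨(p.1, (bulkSplit μ h false right k p.2 r).val.1) :: R, ?_, ?_, ?_,
      nodeArityOK_mk.2 ⟨by omega, by omega, hc, hr.1⟩⟩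
    · rw [hval]; rfl
    · rw [List.length_cons, hlen]
    · have hcond : l.length + (r.length + 1) + 1 = (k + 1) * (μ + 1) + 2 * μ ↔
          r.length + 1 = k * (μ + 1) + 2 * μ := by
        rw [Nat.succ_mul]
        omega
      simp only [hcond]
      exact hsplit.cons hy a c (r := l) (by omega) p.1

theorem splitCount_bounds {μ p : ℕ} (hp : 2 * μ < p) :
    splitCount μ p * (μ + 1) + μ ≤ p ∧ p ≤ splitCount μ p * (μ + 1) + 2 * μ ∧
      1 ≤ splitCount μ p := by
  have hdiv := Nat.div_add_mod p (μ + 1)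
  have hmod := Nat.mod_lt p (Nat.succ_pos μ)
  unfold splitCount
  generalize p / (μ + 1) = q at *
  generalize p % (μ + 1) = s at *
  rw [mul_comm] at hdiv
  rcases q with _ | _ | q
  · split <;> omega
  · split <;> omega
  · simp only [Nat.succ_eq_add_one, add_mul, one_mul, Nat.add_sub_cancel] at *
    split <;> simp only [add_mul, one_mul] <;> omega

theorem bulkSplit_cost (μ h : ℕ) : ∀ (k : ℕ) (left right : Bool) (c : Tree T V h)
    (r : List ((T × V) × Tree T V h)),
    (bulkSplit μ h left right k c r).time ≤ 2 * r.length + 2 + (μ + 1) * k ∧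
    (bulkSplit μ h left right k c r).val.2.length ≤ k ∧
    recCount (bulkSplit μ h left right k c r).val.2 = 0
  | 0, left, right, c, r => by simp [bulkSplit_zero, time_mkNode, recCount]
  | k + 1, left, right, c, r => by
    rcases Nat.lt_or_ge μ r.length with hlt | hle
    · obtain ⟨l, p, r, rfl, hl⟩ := exists_eq_append_cons_of_lt_length hlt
      obtain ⟨htime, hlen, hrec⟩ := bulkSplit_cost μ h k false right p.2 r
      simp only [bulkSplit_succ_append μ h left right k c hl p r, Timed.val_bind, Timed.time_bind,
        Timed.val_pure, Timed.time_pure, time_mkNode, time_tick, Nat.mul_succ, List.length_append,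
        List.length_cons]
      refine ⟨by omega, by omega, ?_⟩
      simpa [recCount, Treelet.isRecomputation] using hrec
    · simp [bulkSplit, List.drop_of_length_le hle, time_mkNode, recCount]

theorem mkNode_targetProcessed {μ h : ℕ} (loc : Loc) {c : Tree T V h}
    {I : List ((T × V) × Tree T V h)} (hlen : I.length + 1 ≤ 2 * μ) (hc : Tree.ArityOK μ h c)
    (hI : ∀ p ∈ I, Tree.ArityOK μ h p.2) :
    TargetProcessed μ h c I (mkNode h loc c I).val [] := by
  obtain ⟨a, ha⟩ := exists_mkNode_val_eq h loc c I
  obtain ⟨hkeys, hfull, hnil⟩ := splitInto_singleton μ h a c I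
  have hone := fullIndicator_le_one μ I.length
  rw [ha]
  refine ⟨⟨hkeys, ?_, hnil⟩, fun _ _ hle => nodeArityOK_mk.2 ⟨hle, hlen, hc, hI⟩, Or.inl rfl⟩
  rw [if_neg (by omega)]
  omega

theorem bulkSplit_targetProcessed {μ h : ℕ} (hμ : 2 ≤ μ) (left right : Bool) {c : Tree T V h}
    {I : List ((T × V) × Tree T V h)} (hlen : 2 * μ < I.length + 1) (hc : Tree.ArityOK μ h c)
    (hI : ∀ p ∈ I, Tree.ArityOK μ h p.2) :
    ∃ R, (bulkSplit μ h left right (splitCount μ (I.length + 1)) c I).val.2 = insertions R ∧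
      TargetProcessed μ h c I
        (bulkSplit μ h left right (splitCount μ (I.length + 1)) c I).val.1 R := by
  obtain ⟨hlow, hhigh, hpos⟩ := splitCount_bounds hlen
  obtain ⟨R, hval, hR, ⟨hkeys, hfull, harity⟩, hy⟩ := bulkSplit_splitInto hμ
    (splitCount μ (I.length + 1)) left right c I hlow hhigh hc hI
  refine ⟨R, hval, ⟨hkeys, hfull.trans (Nat.add_le_add_left ?_ _), harity⟩,
    fun a ha _ => (arityOK_succ.1 hy).mono ha, Or.inr ⟨by omega, ?_⟩⟩
  · have := Nat.le_mul_of_pos_left (μ + 1) hpos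
    split <;> split <;> omega
  · rw [hR, add_mul]
    omega

variable [LinearOrder T]

theorem one_le_time_processTarget (μ h : ℕ) (loc : Loc) (c : Tree T V h)
    (r : List ((T × V) × Tree T V h)) (L : List (Treelet T V (Tree T V h))) :
    1 ≤ (processTarget μ h loc c r L).time :=
  Nat.le_add_right 1 _

theorem processTarget_targetProcessed {μ h : ℕ} (hμ : 2 ≤ μ) (loc : Loc) (c : Tree T V h)
    (r : List ((T × V) × Tree T V h)) (L : List (Treelet T V (Tree T V h)))
    (hc : Tree.ArityOK μ h c) (hI : ∀ p ∈ (interleave r L).val, Tree.ArityOK μ h p.2) :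
    ∃ R, (processTarget μ h loc c r L).val.2 = insertions R ∧
      TargetProcessed μ h c (interleave r L).val (processTarget μ h loc c r L).val.1 R := by
  simp only [processTarget, Timed.val_bind]
  split
  case isTrue hlen => exact ⟨[], rfl, mkNode_targetProcessed loc hlen hc hI⟩
  case isFalse hlen => exact bulkSplit_targetProcessed hμ _ _ (by omega) hc hI

theorem processTarget_cost {μ h : ℕ} (hμ : 2 ≤ μ) (loc : Loc) (c : Tree T V h)
    (r : List ((T × V) × Tree T V h)) (L : List (Treelet T V (Tree T V h)))
    (hr : r.length + 1 ≤ 2 * μ) :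
    (processTarget μ h loc c r L).time + 9 * (processTarget μ h loc c r L).val.2.length ≤
      10 * μ + 7 * L.length ∧ recCount (processTarget μ h loc c r L).val.2 = 0 := by
  have htime := time_interleave_le r L
  have hlen := length_interleave r L
  have hL := insCount_add_recCount L
  simp only [processTarget, Timed.val_bind, Timed.time_bind, time_tick]
  generalize (interleave r L).val = I at *
  split
  · simp only [Timed.val_bind, Timed.time_bind, Timed.val_pure, Timed.time_pure, time_mkNode,
      List.length_nil]
    exact ⟨by omega, rfl⟩
  · obtain ⟨hlow, -, -⟩ := splitCount_bounds (by omega : 2 * μ < I.length + 1)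
    obtain ⟨hsplit, hlen', hrec⟩ :=
      bulkSplit_cost μ h (splitCount μ (I.length + 1)) loc.left loc.right c I
    refine ⟨?_, hrec⟩
    generalize splitCount μ (I.length + 1) = k at *
    have hk : 3 * k ≤ k * (μ + 1) := by
      rw [mul_comm]
      exact Nat.mul_le_mul_left k (by omega)
    rw [mul_comm (μ + 1) k] at hsplit
    omega

end split

/-! ### The result of the search and the pass up -/

section values

variable {T V C S : Type u}

theorem gather_none (up : Loc → C → S → Timed (C × List (Treelet T V C))) (left right : Bool)
    (c : C) (r : List ((T × V) × C)) :
    gather up left right c r ⟨none, []⟩ = ⟨((c, r), []), 0⟩ := by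
  cases r <;> rfl

theorem length_gather (up : Loc → C → S → Timed (C × List (Treelet T V C))) :
    ∀ (r : List ((T × V) × C)) (left right : Bool) (c : C) (s : SiteNode V S),
      (gather up left right c r s).val.1.2.length = r.length
  | [], _, _, _, _ => rfl
  | _ :: _, _, _, _, ⟨_, []⟩ => rfl
  | e :: r, _, right, _, ⟨_, w :: ws⟩ => by
    simp [gather, length_gather up r false right e.2 ⟨w.2, ws⟩]

theorem time_gather_cons (up : Loc → C → S → Timed (C × List (Treelet T V C))) (left right : Bool)
    (c : C) (e : (T × V) × C) (r : List ((T × V) × C)) (s : Option S) (o : Option V)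
    (w : SiteNode V S) :
    (gather up left right c (e :: r) ⟨s, (o, w.first) :: w.rest⟩).time =
      1 + ((visit up ⟨left, false⟩ c s).time + (gather up false right e.2 r w).time) := by
  simp [gather]

theorem val_gather_cons (up : Loc → C → S → Timed (C × List (Treelet T V C))) (left right : Bool)
    (c : C) (e : (T × V) × C) (r : List ((T × V) × C)) (s : Option S) (o : Option V)
    (w : SiteNode V S) :
    (gather up left right c (e :: r) ⟨s, (o, w.first) :: w.rest⟩).val =
      (((visit up ⟨left, false⟩ c s).val.1, (e.1, (gather up false right e.2 r w).val.1.1) ::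
          (gather up false right e.2 r w).val.1.2),
        (visit up ⟨left, false⟩ c s).val.2 ++
          (o.map fun v => .recomputation (e.1.1, v)).toList ++
          (gather up false right e.2 r w).val.2) := rfl

theorem mem_flatKeys {keys : C → List T} {R : List ((T × V) × C)} {x : (T × V) × C}
    (hx : x ∈ R) : x.1.1 ∈ flatKeys keys R :=
  List.mem_flatMap.2 ⟨x, hx, List.mem_cons_self⟩

variable [LinearOrder T]

/-- Scan a node if the next entry of the bulk belongs to its range. -/
def scanIf (descend : WithTop T → C → List (T × V) → Timed (S × List (T × V))) (hi : WithTop T)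
    (c : C) (r : List ((T × V) × C)) (B : List (T × V)) : Timed (SiteNode V S × List (T × V)) :=
  if before hi B then scan descend hi c r B else pure (⟨none, []⟩, B)

section scan

variable (descend : WithTop T → C → List (T × V) → Timed (S × List (T × V))) (hi : WithTop T)

theorem val_scan_nil (c : C) (B : List (T × V)) : (scan descend hi c [] B).val =
    (⟨(enter descend hi c B).val.1, []⟩, (enter descend hi c B).val.2) := rfl

theorem time_scan_nil (c : C) (B : List (T × V)) :
    (scan descend hi c [] B).time = 1 + (enter descend hi c B).time := rfl

theorem val_scan_cons (c : C) (e : (T × V) × C) (r : List ((T × V) × C)) (B : List (T × V)) :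
    (scan descend hi c (e :: r) B).val =
      (⟨(enter descend e.1.1 c B).val.1,
        ((matchEntry e.1.1 (enter descend e.1.1 c B).val.2).1,
          (scanIf descend hi e.2 r
            (matchEntry e.1.1 (enter descend e.1.1 c B).val.2).2).val.1.first) ::
          (scanIf descend hi e.2 r
            (matchEntry e.1.1 (enter descend e.1.1 c B).val.2).2).val.1.rest⟩,
        (scanIf descend hi e.2 r (matchEntry e.1.1 (enter descend e.1.1 c B).val.2).2).val.2) := by
  rw [scan]
  simp only [Timed.val_bind, scanIf]
  split <;> rfl

theorem time_scan_cons (c : C) (e : (T × V) × C) (r : List ((T × V) × C)) (B : List (T × V)) :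
    (scan descend hi c (e :: r) B).time = 1 + (enter descend e.1.1 c B).time +
      (scanIf descend hi e.2 r (matchEntry e.1.1 (enter descend e.1.1 c B).val.2).2).time := by
  rw [scan]
  simp only [Timed.time_bind, scanIf, time_tick]
  split <;> simp [add_assoc]

end scan

/-- `B'` is what remains of the bulk `B` after its entries before `hi` have been read. -/
def Remains (hi : WithTop T) (B B' : List (T × V)) : Prop :=
  B' <:+ B ∧ ∀ b ∈ B', hi ≤ (b.1 : WithTop T)

theorem remains_of_not_before {hi : WithTop T} : ∀ {B : List (T × V)},
    B.Pairwise (fun a b => a.1 < b.1) → ¬ before hi B → Remains hi B B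
  | [], _, _ => ⟨List.suffix_rfl, by simp⟩
  | a :: B, hB, hbefore => by
    have ha : hi ≤ (a.1 : WithTop T) := by simpa [before] using hbefore
    exact ⟨List.suffix_rfl, List.forall_mem_cons.2 ⟨ha, fun b hb =>
      ha.trans (WithTop.coe_le_coe.2 ((List.pairwise_cons.1 hB).1 b hb).le)⟩⟩

theorem matchEntry_suffix (t : T) (B : List (T × V)) : (matchEntry t B).2 <:+ B := by
  cases B with
  | nil => exact List.suffix_rfl
  | cons a B =>
    rw [matchEntry]
    split
    · exact List.suffix_cons a B
    · exact List.suffix_rfl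

theorem lt_of_mem_matchEntry (t : T) {B : List (T × V)} (hB : B.Pairwise fun a b => a.1 < b.1)
    (hle : ∀ b ∈ B, t ≤ b.1) : ∀ b ∈ (matchEntry t B).2, t < b.1 := by
  cases B with
  | nil => simp [matchEntry]
  | cons a B =>
    have hlt := (List.pairwise_cons.1 hB).1
    rw [matchEntry]
    split
    case isTrue heq => exact fun b hb => heq ▸ hlt b hb
    case isFalse hne =>
      have ha : t < a.1 := lt_of_le_of_ne (hle a List.mem_cons_self) (Ne.symm hne)
      exact List.forall_mem_cons.2 ⟨ha, fun b hb => ha.trans (hlt b hb)⟩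

/-- What a pass up returns for a subtree with timestamps between `lo` and `hi`: insertions of
entries with subtrees that satisfy `ok`, all in timestamp order, with `full`-values at most `n` in
total.  Here `keys` gives the timestamps of a subtree. -/
def ChildProcessed (keys : C → List T) (ok : C → Prop) (full : C → ℕ) (lo : WithBot T)
    (hi : WithTop T) (n : ℕ) (p : C × List (Treelet T V C)) : Prop :=
  ∃ R, p.2 = insertions R ∧ Bounded lo hi (keys p.1 ++ flatKeys keys R) ∧ ok p.1 ∧
    (∀ x ∈ R, ok x.2) ∧ full p.1 + childSum full R ≤ n

/-- The search `descend` and the pass up `up` are correct for subtrees. -/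
def ChildCorrect (keys : C → List T) (ok : C → Prop) (full : C → ℕ)
    (descend : WithTop T → C → List (T × V) → Timed (S × List (T × V)))
    (up : Loc → C → S → Timed (C × List (Treelet T V C))) : Prop :=
  ∀ (loc : Loc) (lo : WithBot T) (hi : WithTop T) (c : C) (B : List (T × V)),
    Bounded lo hi (keys c) → ok c → B.Pairwise (fun a b => a.1 < b.1) →
    (∀ b ∈ B, lo < (b.1 : WithBot T)) → before hi B →
    Remains hi B (descend hi c B).val.2 ∧
      ChildProcessed keys ok full lo hi (full c + (up loc c (descend hi c B).val.1).time)
        (up loc c (descend hi c B).val.1).val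

variable {keys : C → List T} {ok : C → Prop} {full : C → ℕ}
  {descend : WithTop T → C → List (T × V) → Timed (S × List (T × V))}
  {up : Loc → C → S → Timed (C × List (Treelet T V C))}

theorem ChildCorrect.visit (hchild : ChildCorrect keys ok full descend up) (loc : Loc)
    {lo : WithBot T} {hi : WithTop T} {c : C} {B : List (T × V)}
    (hc : Bounded lo hi (keys c)) (hok : ok c)
    (hB : B.Pairwise fun a b => a.1 < b.1) (hlo : ∀ b ∈ B, lo < (b.1 : WithBot T)) :
    Remains hi B (enter descend hi c B).val.2 ∧
      ChildProcessed keys ok full lo hi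
        (full c + (visit up loc c (enter descend hi c B).val.1).time)
        (visit up loc c (enter descend hi c B).val.1).val := by
  unfold enter
  split
  case isTrue hbefore =>
    obtain ⟨hrem, R, hins, hbdd, hp, hR, hfl⟩ := hchild loc lo hi c B hc hok hB hlo hbefore
    refine ⟨hrem, R, hins, hbdd, hp, hR, hfl.trans ?_⟩
    simp only [Timed.val_bind, Timed.val_pure, FiBA.visit, Timed.time_bind]
    omega
  case isFalse hbefore =>
    refine ⟨remains_of_not_before hB hbefore, [], rfl, ?_, hok, by simp, ?_⟩
    · simpa [FiBA.visit] using hc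
    · simp [FiBA.visit]

theorem ChildProcessed.lt_key {lo : WithBot T} {hi : WithTop T} {n : ℕ}
    {p : C × List (Treelet T V C)} (hp : ChildProcessed keys ok full lo hi n p) :
    ∀ x ∈ p.2, lo < (x.key : WithBot T) := by
  obtain ⟨R, hins, hbdd, -⟩ := hp
  rw [hins]
  exact List.forall_mem_map.2 fun x hx =>
    (hbdd.2 x.1.1 (List.mem_append_right _ (mem_flatKeys hx))).1

variable [Monoid V]

/-- A node with contents `g.1` and treelets `g.2` from its processed children: the interleaving of
the two is in timestamp order, with correct subtrees and `full`-values at most `n` in total. -/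
structure Gathered (keys : C → List T) (ok : C → Prop) (full : C → ℕ) (lo : WithBot T)
    (hi : WithTop T) (n : ℕ) (g : (C × List ((T × V) × C)) × List (Treelet T V C)) : Prop where
  bounded : Bounded lo hi (keys g.1.1 ++ flatKeys keys (interleave g.1.2 g.2).val)
  first_ok : ok g.1.1
  rest_ok : ∀ x ∈ (interleave g.1.2 g.2).val, ok x.2
  sum_le : full g.1.1 + childSum full (interleave g.1.2 g.2).val ≤ n
  lt_key : ∀ x ∈ g.2, lo < (x.key : WithBot T)

theorem gathered_nil {lo : WithBot T} {hi : WithTop T} {c : C} {r : List ((T × V) × C)}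
    (hbdd : Bounded lo hi (keys c ++ flatKeys keys r)) (hc : ok c) (hr : ∀ x ∈ r, ok x.2) :
    Gathered keys ok full lo hi (full c + childSum full r) ((c, r), []) :=
  ⟨by simpa [interleave_nil] using hbdd, hc, by simpa [interleave_nil] using hr,
    by simp [interleave_nil], by simp⟩

theorem ChildProcessed.gathered {lo : WithBot T} {hi : WithTop T} {n : ℕ}
    {p : C × List (Treelet T V C)} (hp : ChildProcessed keys ok full lo hi n p) :
    Gathered keys ok full lo hi n ((p.1, []), p.2) := by
  have hkey := hp.lt_key
  obtain ⟨R, hins, hbdd, hc, hR, hsum⟩ := hp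
  refine ⟨?_, hc, ?_, ?_, hkey⟩ <;> simpa only [hins, interleave_nil_insertions]

theorem interleave_recomputation_append (e : T × V) (c : C) (r : List ((T × V) × C)) (o : Option V)
    (L : List (Treelet T V C)) (hL : ∀ x ∈ L, e.1 < x.key) :
    ∃ v, (interleave ((e, c) :: r)
      ((o.map fun v => Treelet.recomputation (e.1, v)).toList ++ L)).val =
        ((e.1, v), c) :: (interleave r L).val := by
  cases o with
  | none => exact ⟨e.2, interleave_cons_of_lt_key (e, c) r L hL⟩
  | some v =>
    refine ⟨e.2 * v, ?_⟩
    simp only [Option.map_some, Option.toList_some, List.singleton_append]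
    rw [interleave]
    simp

theorem ChildProcessed.gathered_cons {lo : WithBot T} {hi : WithTop T} {n m : ℕ} {e : T × V}
    {p : C × List (Treelet T V C)} (hp : ChildProcessed keys ok full lo e.1 n p)
    {g : (C × List ((T × V) × C)) × List (Treelet T V C)} (hg : Gathered keys ok full e.1 hi m g)
    (hlo : lo < (e.1 : WithBot T)) (hhi : (e.1 : WithTop T) < hi) (o : Option V) :
    Gathered keys ok full lo hi (n + m) ((p.1, (e, g.1.1) :: g.1.2),
      p.2 ++ (o.map fun v => .recomputation (e.1, v)).toList ++ g.2) := by
  have hpkey := hp.lt_key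
  obtain ⟨R, hins, hbdd, hc, hR, hsum⟩ := hp
  obtain ⟨hgbdd, hgc, hgr, hgsum, hgkey⟩ := hg
  have hbelow : ∀ x ∈ R, x.1.1 < e.1 := fun x hx =>
    WithTop.coe_lt_coe.1 (hbdd.2 x.1.1 (List.mem_append_right _ (mem_flatKeys hx))).2
  obtain ⟨v, hv⟩ := interleave_recomputation_append e g.1.1 g.1.2 o g.2
    fun x hx => WithBot.coe_lt_coe.1 (hgkey x hx)
  have hinter : (interleave ((e, g.1.1) :: g.1.2)
      (p.2 ++ (o.map fun v => .recomputation (e.1, v)).toList ++ g.2)).val =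
        R ++ ((e.1, v), g.1.1) :: (interleave g.1.2 g.2).val := by
    rw [hins, List.append_assoc, interleave_cons_insertions_append (e, g.1.1) _ _ _ hbelow, hv]
  refine ⟨?_, hc, ?_, ?_, ?_⟩
  · rw [hinter, flatKeys_append, flatKeys_cons, ← List.append_assoc]
    exact bounded_append_cons.2 ⟨hbdd, hgbdd, hlo, hhi⟩
  · rw [hinter]
    exact List.forall_mem_append.2 ⟨hR, List.forall_mem_cons.2 ⟨hgc, hgr⟩⟩
  · simp only [hinter, childSum_append, childSum_cons]
    omega
  · refine List.forall_mem_append.2 ⟨List.forall_mem_append.2 ⟨hpkey, ?_⟩,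
      fun x hx => hlo.trans (hgkey x hx)⟩
    cases o <;> simp [Treelet.key, hlo]

theorem ChildCorrect.gathered (hchild : ChildCorrect keys ok full descend up) :
    ∀ (r : List ((T × V) × C)) (left right : Bool) (lo : WithBot T) (hi : WithTop T) (c : C)
      (B : List (T × V)), Bounded lo hi (keys c ++ flatKeys keys r) → ok c → (∀ x ∈ r, ok x.2) →
    B.Pairwise (fun a b => a.1 < b.1) → (∀ b ∈ B, lo < (b.1 : WithBot T)) →
    Remains hi B (scan descend hi c r B).val.2 ∧
      Gathered keys ok full lo hi
        (full c + childSum full r + (gather up left right c r (scan descend hi c r B).val.1).time)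
        (gather up left right c r (scan descend hi c r B).val.1).val
  | [], left, right, lo, hi, c, B, hbdd, hc, _, hB, hlo => by
    rw [flatKeys_nil, List.append_nil] at hbdd
    obtain ⟨hrem, hp⟩ := hchild.visit ⟨left, right⟩ hbdd hc hB hlo
    rw [val_scan_nil]
    exact ⟨hrem, hp.gathered⟩
  | e :: r, left, right, lo, hi, c, B, hbdd, hc, hr, hB, hlo => by
    rw [flatKeys_cons] at hbdd
    rw [List.forall_mem_cons] at hr
    obtain ⟨hbddc, hbddr, hloe, hehi⟩ := bounded_append_cons.1 hbdd
    obtain ⟨hremc, hp⟩ := hchild.visit ⟨left, false⟩ hbddc hc hB hlo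
    rw [val_scan_cons]
    generalize (enter descend e.1.1 c B).val = p at *
    have hBp := hB.sublist hremc.1.sublist
    have hsuffix := matchEntry_suffix e.1.1 p.2
    have hgt := lt_of_mem_matchEntry e.1.1 hBp fun b hb => WithTop.coe_le_coe.1 (hremc.2 b hb)
    generalize matchEntry e.1.1 p.2 = q at *
    have hBq := hBp.sublist hsuffix.sublist
    have htail : Remains hi q.2 (scanIf descend hi e.2 r q.2).val.2 ∧
        Gathered keys ok full e.1.1 hi (full e.2 + childSum full r +
            (gather up false right e.2 r (scanIf descend hi e.2 r q.2).val.1).time)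
          (gather up false right e.2 r (scanIf descend hi e.2 r q.2).val.1).val := by
      rw [scanIf]
      split
      case isTrue =>
        exact hchild.gathered r false right e.1.1 hi e.2 q.2 hbddr hr.1 hr.2 hBq
          fun b hb => WithBot.coe_lt_coe.2 (hgt b hb)
      case isFalse hbefore =>
        rw [Timed.val_pure, gather_none]
        exact ⟨remains_of_not_before hBq hbefore, gathered_nil hbddr hr.1 hr.2⟩
    generalize (scanIf descend hi e.2 r q.2).val = w at *
    obtain ⟨⟨hsuffix', hge⟩, hg⟩ := htail
    refine ⟨⟨hsuffix'.trans (hsuffix.trans hremc.1), hge⟩, ?_⟩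
    have hcons := hp.gathered_cons hg hloe hehi q.1
    rw [time_gather_cons, val_gather_cons, childSum_cons]
    exact ⟨hcons.1, hcons.2, hcons.3, hcons.4.trans (by omega), hcons.5⟩

end values

section passup

variable {T V : Type u} [LinearOrder T]

theorem takeBefore_append (hi : WithTop T) : ∀ B : List (T × V),
    (takeBefore hi B).val.1 ++ (takeBefore hi B).val.2 = B
  | [] => rfl
  | b :: B => by
    simp only [takeBefore, Timed.val_bind]
    split
    · simp [takeBefore_append hi B]
    · rfl

theorem lt_of_mem_takeBefore (hi : WithTop T) : ∀ B : List (T × V),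
    ∀ b ∈ (takeBefore hi B).val.1, (b.1 : WithTop T) < hi
  | [] => by simp [takeBefore]
  | b :: B => by
    simp only [takeBefore, Timed.val_bind]
    split
    case isTrue hb => exact List.forall_mem_cons.2 ⟨hb, lt_of_mem_takeBefore hi B⟩
    case isFalse => simp

theorem remains_takeBefore (hi : WithTop T) : ∀ B : List (T × V),
    B.Pairwise (fun a b => a.1 < b.1) → Remains hi B (takeBefore hi B).val.2
  | [], _ => ⟨List.suffix_rfl, by simp [takeBefore]⟩
  | b :: B, hB => by
    simp only [takeBefore, Timed.val_bind]
    split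
    case isTrue =>
      obtain ⟨hsuffix, hge⟩ := remains_takeBefore hi B (List.pairwise_cons.1 hB).2
      exact ⟨hsuffix.trans (List.suffix_cons b B), hge⟩
    case isFalse hb => exact remains_of_not_before hB (by simpa [before] using hb)

variable [Monoid V]

/-- What a pass up returns for a node whose arity must be at least `a`: the node that stays in
place, in `p.1`, and insertions of the entries and nodes in `R` into its parent. -/
structure NodeProcessed (μ a h : ℕ) (lo : WithBot T) (hi : WithTop T)
    (p : Tree T V (h + 1) × List (Treelet T V (Tree T V (h + 1))))
    (R : List ((T × V) × Tree T V (h + 1))) : Prop where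
  eq_insertions : p.2 = insertions R
  bounded : Bounded lo hi (Tree.keys (h + 1) p.1 ++ flatKeys (Tree.keys (h + 1)) R)
  nodeArityOK : NodeArityOK μ a h p.1
  nodeArityOK_of_ne_nil : R ≠ [] → NodeArityOK μ μ h p.1
  arityOK : ∀ x ∈ R, Tree.ArityOK μ (h + 1) x.2

theorem passUp_nodeProcessed {μ h : ℕ} (hμ : 2 ≤ μ)
    (hchild : ChildCorrect (Tree.keys h) (Tree.ArityOK μ h) (Tree.fullCount μ h) (search h)
      (passUp (T := T) (V := V) μ h)) (a : ℕ) (ha : a ≤ μ) (loc : Loc) (lo : WithBot T)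
    (hi : WithTop T) (y : Tree T V (h + 1)) (B : List (T × V))
    (hk : Bounded lo hi (Tree.keys (h + 1) y)) (hy : NodeArityOK μ a h y)
    (hB : B.Pairwise (fun a b => a.1 < b.1)) (hlo : ∀ b ∈ B, lo < (b.1 : WithBot T)) :
    Remains hi B (search (h + 1) hi y B).val.2 ∧
    ∃ R, NodeProcessed μ a h lo hi
        (passUp μ (h + 1) loc y (search (h + 1) hi y B).val.1).val R ∧
      Tree.fullCount μ (h + 1) (passUp μ (h + 1) loc y (search (h + 1) hi y B).val.1).val.1 +
        childSum (Tree.fullCount μ (h + 1)) R ≤ Tree.fullCount μ (h + 1) y +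
          (passUp μ (h + 1) loc y (search (h + 1) hi y B).val.1).time := by
  rw [Tree.keys_succ] at hk
  obtain ⟨ha', -, hc, hr⟩ := hy
  obtain ⟨hrem, hbdd, hgc, hgr, hsum, -⟩ := hchild.gathered y.rest loc.left loc.right lo hi y.first
    B hk hc hr hB hlo
  refine ⟨hrem, ?_⟩
  have hlen := length_gather (passUp μ h) y.rest loc.left loc.right y.first
    (scan (search h) hi y.first y.rest B).val.1
  simp only [search, passUp, Timed.val_bind, Timed.time_bind]
  generalize gather (passUp μ h) loc.left loc.right y.first y.rest
    (scan (search h) hi y.first y.rest B).val.1 = g at *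
  obtain ⟨R, hins, htarget⟩ :=
    processTarget_targetProcessed hμ loc g.val.1.1 g.val.1.2 g.val.2 hgc hgr
  have htime := one_le_time_processTarget μ h loc g.val.1.1 g.val.1.2 g.val.2
  refine ⟨R, ⟨hins, htarget.keys_eq ▸ hbdd, htarget.nodeArityOK a ha ?_,
    htarget.nodeArityOK_of_ne_nil, htarget.arityOK⟩, ?_⟩
  · rw [length_interleave, hlen]
    exact ha'.trans (Nat.add_le_add_right (Nat.le_add_right _ _) 1)
  · have hfull := htarget.fullCount_le
    have hy : Tree.fullCount μ (h + 1) y =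
        fullIndicator μ (List.length (α := (T × V) × Tree T V h) y.rest) +
          Tree.fullCount μ h y.first + childSum (Tree.fullCount μ h) y.rest := rfl
    split at hfull <;> omega

theorem passUp_childCorrect {μ : ℕ} (hμ : 2 ≤ μ) : ∀ h : ℕ, ChildCorrect (Tree.keys h)
    (Tree.ArityOK μ h) (Tree.fullCount μ h) (search h) (passUp (T := T) (V := V) μ h)
  | 0 => by
    intro loc lo hi c B _ _ hB hlo _
    have happend := takeBefore_append hi B
    have hlt := lt_of_mem_takeBefore hi B
    refine ⟨remains_takeBefore hi B hB, (takeBefore hi B).val.1.map fun e => (e, c), ?_, ?_,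
      trivial, fun _ _ => trivial, ?_⟩
    · simp [passUp, insertions, search, Function.comp_def]
    · have hflat : flatKeys (Tree.keys 0) ((takeBefore hi B).val.1.map fun e => (e, c)) =
          (takeBefore hi B).val.1.map Prod.fst := by
        generalize (takeBefore hi B).val.1 = l
        induction l with
        | nil => rfl
        | cons x l ih => simp [ih, Tree.keys_zero]
      rw [hflat, Tree.keys_zero, List.nil_append]
      rw [← happend] at hB hlo
      exact ⟨List.pairwise_map.2 (List.pairwise_append.1 hB).1, List.forall_mem_map.2 fun b hb =>
        ⟨hlo b (List.mem_append_left _ hb), hlt b hb⟩⟩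
    · simp [childSum, Tree.fullCount, Function.comp_def]
  | h + 1 => fun loc lo hi c B hk hc hB hlo _ => by
    obtain ⟨hrem, R, hnode, hfull⟩ := passUp_nodeProcessed hμ (passUp_childCorrect hμ h) μ le_rfl
      loc lo hi c B hk (arityOK_succ.1 hc) hB hlo
    exact ⟨hrem, R, hnode.eq_insertions, hnode.bounded, hnode.nodeArityOK, hnode.arityOK, hfull⟩

end passup

/-! ### The cost of a scan -/

section cost

variable {T V C S : Type u}

theorem childSum_nonneg {f : C → ℝ} {r : List ((T × V) × C)} (hf : ∀ x ∈ r, 0 ≤ f x.2) :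
    0 ≤ childSum f r :=
  List.sum_nonneg (List.forall_mem_map.2 hf)

theorem add_childSum_mul_length_sub (keys : C → List T) (β s : ℝ) :
    ∀ (r : List ((T × V) × C)) (c : C),
    (β * ((keys c).length + 1) - s) + childSum (fun c => β * ((keys c).length + 1) - s) r =
      β * ((keys c ++ flatKeys keys r).length + 1) - s * (r.length + 1)
  | [], c => by simp
  | e :: r, c => by
    rw [childSum_cons, add_childSum_mul_length_sub keys β s r e.2]
    simp only [List.length_append, flatKeys_cons, List.length_cons]
    push_cast
    ring

/-- The number of timestamps in the list that are at least `t`. -/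
def lateCount [LinearOrder T] (t : T) (l : List T) : ℕ := l.countP fun x => decide (t ≤ x)

theorem lateCount_append [LinearOrder T] (t : T) (l l' : List T) :
    lateCount t (l ++ l') = lateCount t l + lateCount t l' := by simp [lateCount]

theorem lateCount_eq_length [LinearOrder T] {t : T} {l : List T} (h : ∀ x ∈ l, t ≤ x) :
    lateCount t l = l.length := by
  rw [lateCount, List.countP_eq_length]
  simpa using h

/-- The number of entries of the bulk `B` that have been read when `B'` remains. -/
def consumed (B B' : List (T × V)) : ℝ := (B.length : ℝ) - B'.length

theorem length_matchEntry [LinearOrder T] (t : T) (B : List (T × V)) :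
    (matchEntry t B).1.toList.length + (matchEntry t B).2.length = B.length := by
  cases B with
  | nil => rfl
  | cons b B =>
    simp only [matchEntry]
    split <;> simp [add_comm]

theorem insCount_recomputation (t : T) (o : Option V) :
    insCount (C := C) (o.map fun v => .recomputation (t, v)).toList = 0 := by
  cases o <;> simp [insCount, Treelet.isRecomputation]

theorem recCount_recomputation (t : T) (o : Option V) :
    recCount (C := C) (o.map fun v => .recomputation (t, v)).toList = o.toList.length := by
  cases o <;> simp [recCount, Treelet.isRecomputation]

variable {descend : WithTop T → C → List (T × V) → Timed (S × List (T × V))}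
  {up : Loc → C → S → Timed (C × List (Treelet T V C))}

theorem recCount_visit (hrec : ∀ loc c s, recCount (up loc c s).val.2 = 0) (loc : Loc) (c : C)
    (o : Option S) : recCount (visit up loc c o).val.2 = 0 := by
  cases o with
  | none => rfl
  | some s => exact hrec loc c s

/-- The time of search and pass up in a subtree, with 9 steps put aside for each treelet that is
promoted out of it. -/
def workload (descend : WithTop T → C → List (T × V) → Timed (S × List (T × V)))
    (up : Loc → C → S → Timed (C × List (Treelet T V C))) (loc : Loc) (hi : WithTop T) (c : C)
    (B : List (T × V)) : ℕ :=
  (descend hi c B).time + (up loc c (descend hi c B).val.1).time +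
    9 * (up loc c (descend hi c B).val.1).val.2.length

theorem recCount_gather_le_length (hrec : ∀ loc c s, recCount (up loc c s).val.2 = 0) :
    ∀ (r : List ((T × V) × C)) (left right : Bool) (c : C) (w : SiteNode V S),
      recCount (gather up left right c r w).val.2 ≤ r.length
  | [], _, _, _, _ => (recCount_visit hrec _ _ _).le
  | _ :: _, _, _, _, ⟨_, []⟩ => (recCount_visit hrec _ _ _).le.trans (Nat.zero_le _)
  | e :: r, left, right, c, ⟨s, (o, s') :: ws⟩ => by
    rw [val_gather_cons up left right c e r s o ⟨s', ws⟩]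
    have htail := recCount_gather_le_length hrec r false right e.2 ⟨s', ws⟩
    have ho := Option.length_toList_le (o := o)
    simp only [recCount_append, recCount_recomputation, recCount_visit hrec, List.length_cons]
    omega

/-- The time of a scan of a node and of the subsequent visits to its children, with 8 steps put
aside for each treelet promoted out of a child. -/
def scanCost (up : Loc → C → S → Timed (C × List (Treelet T V C))) (left right : Bool) (c : C)
    (r : List ((T × V) × C)) (s : Timed (SiteNode V S × List (T × V))) : ℕ :=
  s.time + (gather up left right c r s.val.1).time +
    8 * insCount (gather up left right c r s.val.1).val.2

/-- The number of entries of a node that a scan of the node marks for recomputation. -/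
def scanRecs (up : Loc → C → S → Timed (C × List (Treelet T V C))) (left right : Bool) (c : C)
    (r : List ((T × V) × C)) (s : Timed (SiteNode V S × List (T × V))) : ℕ :=
  recCount (gather up left right c r s.val.1).val.2

theorem scanCost_pure_none (left right : Bool) (c : C) (r : List ((T × V) × C))
    (B : List (T × V)) : scanCost up left right c r (pure (⟨none, []⟩, B)) = 0 := by
  rw [scanCost, Timed.val_pure, gather_none]
  rfl

theorem scanRecs_pure_none (left right : Bool) (c : C) (r : List ((T × V) × C))
    (B : List (T × V)) : scanRecs up left right c r (pure (⟨none, []⟩, B)) = 0 := by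
  rw [scanRecs, Timed.val_pure, gather_none]
  rfl

/-- The scan `s` of a node costs at most 3 steps for each child, `α` for each entry read, and `x`,
even if it has to put aside `γ` steps for each entry marked for recomputation. -/
def ScanBound (up : Loc → C → S → Timed (C × List (Treelet T V C))) (α γ x : ℝ)
    (left right : Bool) (c : C) (r : List ((T × V) × C)) (B : List (T × V))
    (s : Timed (SiteNode V S × List (T × V))) : Prop :=
  (scanCost up left right c r s : ℝ) + γ * scanRecs up left right c r s ≤
    3 * (r.length + 1) + α * consumed B s.val.2 + x

theorem ScanBound.mono {α γ x y : ℝ} {left right : Bool} {c : C} {r : List ((T × V) × C)}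
    {B : List (T × V)} {s : Timed (SiteNode V S × List (T × V))}
    (hscan : ScanBound up α γ x left right c r B s) (hxy : x ≤ y) :
    ScanBound up α γ y left right c r B s :=
  hscan.trans (by linarith)

theorem ScanBound.add_mul_length {α γ x s : ℝ} {left right : Bool} {c : C}
    {r : List ((T × V) × C)} {B : List (T × V)} {p : Timed (SiteNode V S × List (T × V))}
    (hscan : ScanBound up α α x left right c r B p)
    (hrec : ∀ loc c s, recCount (up loc c s).val.2 = 0) (hs : 0 ≤ s) (hγ : γ ≤ α + s) :
    ScanBound up α γ (x + s * r.length) left right c r B p := by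
  have hrecs : scanRecs up left right c r p ≤ r.length :=
    recCount_gather_le_length hrec r left right c p.val.1
  have hγrecs : γ * scanRecs up left right c r p ≤ (α + s) * scanRecs up left right c r p := by
    gcongr
  have hsrecs : s * scanRecs up left right c r p ≤ s * r.length := by gcongr
  unfold ScanBound at *
  linarith

variable [LinearOrder T]

/-- In subtrees that satisfy `ok`, the workload of a bulk with earliest entry `b` is at most `α` for
each entry read, plus `f`. -/
def ChildCostFrom (b : T × V) (ok : C → Prop) (α : ℝ) (f : C → ℝ)
    (descend : WithTop T → C → List (T × V) → Timed (S × List (T × V)))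
    (up : Loc → C → S → Timed (C × List (Treelet T V C))) : Prop :=
  ∀ (loc : Loc) (hi : WithTop T) (c : C) (B : List (T × V)), ok c → before hi (b :: B) →
    (workload descend up loc hi c (b :: B) : ℝ) ≤
      α * consumed (b :: B) (descend hi c (b :: B)).val.2 + f c

/-- In subtrees that satisfy `ok`, the workload of any bulk is at most `α` for each entry read, plus
`f`. -/
def ChildCost (ok : C → Prop) (α : ℝ) (f : C → ℝ)
    (descend : WithTop T → C → List (T × V) → Timed (S × List (T × V)))
    (up : Loc → C → S → Timed (C × List (Treelet T V C))) : Prop :=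
  ∀ b, ChildCostFrom b ok α f descend up

/-- The time of entering a child and processing its events, with 8 steps put aside for each treelet
that is promoted out of it. -/
def visitCost (descend : WithTop T → C → List (T × V) → Timed (S × List (T × V)))
    (up : Loc → C → S → Timed (C × List (Treelet T V C))) (loc : Loc) (hi : WithTop T) (c : C)
    (B : List (T × V)) : ℕ :=
  (enter descend hi c B).time + (visit up loc c (enter descend hi c B).val.1).time +
    8 * insCount (visit up loc c (enter descend hi c B).val.1).val.2

theorem enter_of_not_before {hi : WithTop T} {B : List (T × V)} (hbefore : ¬ before hi B) (c : C) :
    enter descend hi c B = pure (none, B) := if_neg hbefore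

theorem visitCost_of_not_before {hi : WithTop T} {B : List (T × V)} (hbefore : ¬ before hi B)
    (loc : Loc) (c : C) : visitCost descend up loc hi c B = 0 := by
  rw [visitCost, enter_of_not_before hbefore]
  rfl

/-- Handing the promoted treelets over takes one of the 9 steps put aside for each of them. -/
theorem ChildCostFrom.visitCost_le {b : T × V} {ok : C → Prop} {α : ℝ} {f : C → ℝ}
    (hcost : ChildCostFrom b ok α f descend up) (hrec : ∀ loc c s, recCount (up loc c s).val.2 = 0)
    (loc : Loc) (hi : WithTop T) {c : C} (B : List (T × V)) (hc : ok c) (hf : 0 ≤ f c) :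
    (visitCost descend up loc hi c (b :: B) : ℝ) ≤
      1 + α * consumed (b :: B) (enter descend hi c (b :: B)).val.2 + f c := by
  by_cases hbefore : before hi (b :: B)
  · have hwork := hcost loc hi c B hc hbefore
    have hcount := insCount_add_recCount (up loc c (descend hi c (b :: B)).val.1).val.2
    rw [hrec, add_zero] at hcount
    rw [visitCost, enter, if_pos hbefore]
    simp only [workload, ← hcount, Timed.val_bind, Timed.val_pure, Timed.time_bind, Timed.time_pure,
      visit, time_tick] at hwork ⊢
    push_cast at hwork ⊢
    linarith
  · rw [visitCost_of_not_before hbefore, enter_of_not_before hbefore]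
    simp only [Timed.val_pure, consumed, sub_self, mul_zero, add_zero, Nat.cast_zero]
    linarith

theorem ChildCost.visitCost_le {ok : C → Prop} {α : ℝ} {f : C → ℝ}
    (hcost : ChildCost ok α f descend up) (hrec : ∀ loc c s, recCount (up loc c s).val.2 = 0)
    (loc : Loc) (hi : WithTop T) {c : C} (B : List (T × V)) (hc : ok c) (hf : 0 ≤ f c) :
    (visitCost descend up loc hi c B : ℝ) ≤
      1 + α * consumed B (enter descend hi c B).val.2 + f c := by
  cases B with
  | nil =>
    have hbefore : ¬ before hi ([] : List (T × V)) := by simp [before]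
    rw [visitCost_of_not_before hbefore, enter_of_not_before hbefore]
    simp only [Timed.val_pure, consumed, sub_self, mul_zero, add_zero, Nat.cast_zero]
    linarith
  | cons b B => exact (hcost b).visitCost_le hrec loc hi B hc hf

theorem scanIf_of_not_before {hi : WithTop T} {B : List (T × V)} (hbefore : ¬ before hi B) (c : C)
    (r : List ((T × V) × C)) : scanIf descend hi c r B = pure (⟨none, []⟩, B) := if_neg hbefore

theorem scanCost_nil (left right : Bool) (hi : WithTop T) (c : C) (B : List (T × V)) :
    scanCost up left right c [] (scan descend hi c [] B) =
      1 + visitCost descend up ⟨left, right⟩ hi c B := by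
  simp only [scanCost, visitCost, val_scan_nil, time_scan_nil, gather, Timed.val_bind,
    Timed.time_bind, Timed.val_pure, Timed.time_pure]
  omega

theorem scanRecs_nil (hrec : ∀ loc c s, recCount (up loc c s).val.2 = 0) (left right : Bool)
    (hi : WithTop T) (c : C) (B : List (T × V)) :
    scanRecs up left right c [] (scan descend hi c [] B) = 0 :=
  recCount_visit hrec _ _ _

section cons

variable (left right : Bool) (hi : WithTop T) (c : C) (e : (T × V) × C) (r : List ((T × V) × C))
  (B : List (T × V))

theorem scanCost_cons :
    scanCost up left right c (e :: r) (scan descend hi c (e :: r) B) =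
      2 + visitCost descend up ⟨left, false⟩ e.1.1 c B +
        scanCost up false right e.2 r
          (scanIf descend hi e.2 r (matchEntry e.1.1 (enter descend e.1.1 c B).val.2).2) := by
  simp only [scanCost, visitCost, val_scan_cons, time_scan_cons, val_gather_cons, time_gather_cons,
    insCount_append, insCount_recomputation]
  omega

theorem scanRecs_cons (hrec : ∀ loc c s, recCount (up loc c s).val.2 = 0) :
    scanRecs up left right c (e :: r) (scan descend hi c (e :: r) B) =
      (matchEntry e.1.1 (enter descend e.1.1 c B).val.2).1.toList.length +
        scanRecs up false right e.2 r
          (scanIf descend hi e.2 r (matchEntry e.1.1 (enter descend e.1.1 c B).val.2).2) := by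
  simp only [scanRecs, val_scan_cons, val_gather_cons, recCount_append, recCount_recomputation,
    recCount_visit hrec, zero_add]

end cons

theorem scanBound_nil (hrec : ∀ loc c s, recCount (up loc c s).val.2 = 0) {α x : ℝ} (γ : ℝ)
    {left right : Bool} {hi : WithTop T} {c : C} {B : List (T × V)}
    (hvisit : (visitCost descend up ⟨left, right⟩ hi c B : ℝ) ≤
      1 + α * consumed B (enter descend hi c B).val.2 + x) :
    ScanBound up α γ x left right c [] B (scan descend hi c [] B) := by
  rw [ScanBound, scanCost_nil, scanRecs_nil hrec, val_scan_nil]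
  simp only [Nat.cast_add, Nat.cast_one, Nat.cast_zero, mul_zero, List.length_nil]
  linarith

theorem scanBound_scanIf {α γ x : ℝ} {left right : Bool} {hi : WithTop T} {c : C}
    {r : List ((T × V) × C)} {B : List (T × V)} (hx : 0 ≤ x)
    (hscan : before hi B → ScanBound up α γ x left right c r B (scan descend hi c r B)) :
    ScanBound up α γ x left right c r B (scanIf descend hi c r B) := by
  by_cases hbefore : before hi B
  · rw [scanIf, if_pos hbefore]
    exact hscan hbefore
  · rw [scanIf_of_not_before hbefore, ScanBound, scanCost_pure_none, scanRecs_pure_none]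
    simp only [Timed.val_pure, consumed, sub_self, mul_zero, add_zero, Nat.cast_zero]
    positivity

theorem scanBound_cons (hrec : ∀ loc c s, recCount (up loc c s).val.2 = 0) {α γ x y : ℝ}
    {left right : Bool} {hi : WithTop T} {c : C} {e : (T × V) × C} {r : List ((T × V) × C)}
    {B : List (T × V)} {q : Option V × List (T × V)}
    (hq : matchEntry e.1.1 (enter descend e.1.1 c B).val.2 = q)
    (hvisit : (visitCost descend up ⟨left, false⟩ e.1.1 c B : ℝ) ≤
      1 + α * consumed B (enter descend e.1.1 c B).val.2 + x)
    (hγ : γ * q.1.toList.length ≤ α * q.1.toList.length)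
    (htail : ScanBound up α γ y false right e.2 r q.2 (scanIf descend hi e.2 r q.2)) :
    ScanBound up α γ (x + y) left right c (e :: r) B (scan descend hi c (e :: r) B) := by
  have hlen := length_matchEntry e.1.1 (enter descend e.1.1 c B).val.2
  rw [ScanBound, scanCost_cons, scanRecs_cons _ _ _ _ _ _ _ hrec, val_scan_cons, hq] at *
  have hconsumed : consumed B (scanIf descend hi e.2 r q.2).val.2 =
      consumed B (enter descend e.1.1 c B).val.2 + q.1.toList.length +
        consumed q.2 (scanIf descend hi e.2 r q.2).val.2 := by
    simp only [consumed, ← hlen]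
    push_cast
    ring
  rw [hconsumed, List.length_cons]
  push_cast
  linarith

theorem ChildCost.scanBound {ok : C → Prop} {α : ℝ} {f : C → ℝ}
    (hcost : ChildCost ok α f descend up) (hrec : ∀ loc c s, recCount (up loc c s).val.2 = 0)
    (hf : ∀ c, ok c → 0 ≤ f c) (right : Bool) (hi : WithTop T) :
    ∀ (r : List ((T × V) × C)) (left : Bool) (c : C) (B : List (T × V)), ok c →
      (∀ x ∈ r, ok x.2) →
      ScanBound up α α (f c + childSum f r) left right c r B (scan descend hi c r B)
  | [], left, c, B, hc, _ => by
    rw [childSum_nil, add_zero]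
    exact scanBound_nil hrec α (hcost.visitCost_le hrec _ hi B hc (hf c hc))
  | e :: r, left, c, B, hc, hr => by
    rw [List.forall_mem_cons] at hr
    rw [childSum_cons]
    have htail : 0 ≤ f e.2 + childSum f r :=
      add_nonneg (hf e.2 hr.1) (childSum_nonneg fun x hx => hf x.2 (hr.2 x hx))
    exact scanBound_cons hrec rfl (hcost.visitCost_le hrec _ e.1.1 B hc (hf c hc)) le_rfl
      (scanBound_scanIf htail fun _ =>
        hcost.scanBound hrec hf right hi r false e.2 _ hr.1 hr.2)

/-- A scan by a bulk with earliest entry `b`, where a visit costs at most `x + β n` if `n` of the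
timestamps in the subtree are not before `b`, and at most `β (n + 1) - s` if all `n` of them are
later.  Only the first child that the scan enters can contain timestamps before `b`, so that `x`
occurs once. -/
theorem ChildCost.scanBound_lateCount {keys : C → List T} {ok : C → Prop} {α β x s γ : ℝ}
    {b : T × V} (hcost : ChildCost ok α (fun c => β * ((keys c).length + 1) - s) descend up)
    (hfirst : ChildCostFrom b (fun c => ok c ∧ (keys c).Pairwise (· < ·)) α
      (fun c => x + β * lateCount b.1 (keys c)) descend up)
    (hrec : ∀ loc c s, recCount (up loc c s).val.2 = 0)
    (hf : ∀ c, ok c → 0 ≤ β * ((keys c).length + 1) - s) (hx : 0 ≤ x) (hβ : 0 ≤ β) (hs : 0 ≤ s)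
    (hγ : γ ≤ α + s) (right : Bool) (hi : WithTop T) (B : List (T × V)) :
    ∀ (r : List ((T × V) × C)) (left : Bool) (c : C), ok c → (∀ x ∈ r, ok x.2) →
      (keys c ++ flatKeys keys r).Pairwise (· < ·) →
      ScanBound up α γ (x + β * lateCount b.1 (keys c ++ flatKeys keys r)) left right c r (b :: B)
        (scan descend hi c r (b :: B))
  | [], left, c, hc, _, hk => by
    rw [flatKeys_nil, List.append_nil] at *
    exact scanBound_nil hrec γ (hfirst.visitCost_le hrec _ hi B ⟨hc, hk⟩ (by positivity))
  | e :: r, left, c, hc, hr, hk => by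
    rw [List.forall_mem_cons] at hr
    rw [flatKeys_cons] at *
    obtain ⟨hkc, hke, -⟩ := List.pairwise_append.1 hk
    obtain ⟨hgt, hkr⟩ := List.pairwise_cons.1 hke
    have hlate : lateCount b.1 (keys c ++ e.1.1 :: (keys e.2 ++ flatKeys keys r)) =
        lateCount b.1 (keys c) +
          (lateCount b.1 [e.1.1] + lateCount b.1 (keys e.2 ++ flatKeys keys r)) := by
      rw [lateCount_append, ← List.singleton_append, lateCount_append]
    rcases lt_or_ge e.1.1 b.1 with hlt | hge
    · have hbefore : ¬ before (e.1.1 : WithTop T) (b :: B) := by simpa [before] using hlt.le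
      have hmatch : matchEntry e.1.1 (enter descend e.1.1 c (b :: B)).val.2 = (none, b :: B) := by
        simp [enter_of_not_before hbefore, matchEntry, hlt.ne']
      have htail := scanBound_scanIf (left := false) (by positivity) fun _ =>
        hcost.scanBound_lateCount hfirst hrec hf hx hβ hs hγ right hi B r false e.2 hr.1 hr.2 hkr
      refine (scanBound_cons (x := 0) hrec hmatch ?_ (by simp) htail).mono ?_
      · rw [visitCost_of_not_before hbefore, enter_of_not_before hbefore]
        simp [consumed]
      · rw [zero_add]
        gcongr
        omega
    · have hchildren : lateCount b.1 [e.1.1] + lateCount b.1 (keys e.2 ++ flatKeys keys r) =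
          (keys e.2 ++ flatKeys keys r).length + 1 := by
        rw [lateCount_eq_length (by simpa using hge),
          lateCount_eq_length fun y hy => hge.trans (hgt y hy).le, List.length_singleton, add_comm]
      have hnonneg : 0 ≤ (β * ((keys e.2).length + 1) - s) +
          childSum (fun c => β * ((keys c).length + 1) - s) r :=
        add_nonneg (hf e.2 hr.1) (childSum_nonneg fun x hx => hf x.2 (hr.2 x hx))
      have hscan := scanBound_cons hrec rfl
        (hfirst.visitCost_le hrec ⟨left, false⟩ e.1.1 B ⟨hc, hkc⟩ (by positivity)) le_rfl
        (scanBound_scanIf hnonneg fun _ =>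
          hcost.scanBound hrec hf right hi r false e.2 _ hr.1 hr.2)
      refine (hscan.add_mul_length hrec hs hγ).mono ?_
      rw [add_childSum_mul_length_sub, hlate, hchildren, List.length_cons]
      push_cast
      linarith

end cost

/-! ### The cost of search and pass up in a subtree -/

section workload

variable {T V : Type u}

theorem childSum_zero {C : Type u} (r : List ((T × V) × C)) :
    childSum (fun _ => (0 : ℝ)) r = 0 :=
  List.sum_eq_zero (by simp)

theorem two_pow_le_length_keys {μ : ℕ} (hμ : 2 ≤ μ) : ∀ (h : ℕ) (y : Tree T V h),
    Tree.ArityOK μ h y → 2 ^ h ≤ (Tree.keys h y).length + 1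
  | 0, y, _ => by simp [Tree.keys_zero]
  | h + 1, ⟨_, c, []⟩, hy => absurd (hμ.trans hy.1) (by simp [Node.arity])
  | h + 1, ⟨_, c, e :: r⟩, hy => by
    have hc := two_pow_le_length_keys hμ h c hy.2.2.1
    have he := two_pow_le_length_keys hμ h e.2 (hy.2.2.2 e List.mem_cons_self)
    rw [Tree.keys_mk, flatKeys_cons, pow_succ]
    simp only [List.length_append, List.length_cons]
    omega

theorem consumed_le_length (B B' : List (T × V)) : consumed B B' ≤ B.length :=
  sub_le_self _ (Nat.cast_nonneg _)

/-- The part of the cost that a subtree of height `l + u` with `n` entries has to pay for itself.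
The term that is subtracted grows with `u`, which pays for walking to a node of the subtree whenever
one of its entries is marked for recomputation. -/
noncomputable def sizeCost (μ l u : ℕ) (n : ℕ) : ℝ :=
  60 * μ / 2 ^ l * (n + 1) - 30 * μ * (u + 2)

theorem sizeCost_nonneg {μ l u n : ℕ} (hn : 2 ^ (l + u) ≤ n + 1) : 0 ≤ sizeCost μ l u n := by
  have hpow : (2 : ℝ) ^ l * 2 ^ u ≤ n + 1 := by
    rw [← pow_add]
    exact_mod_cast hn
  have hu : (u : ℝ) + 1 ≤ 2 ^ u := by exact_mod_cast Nat.lt_two_pow_self (n := u)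
  rw [sizeCost, sub_nonneg]
  calc 30 * (μ : ℝ) * (u + 2) ≤ 30 * μ * (2 * 2 ^ u) := by
        gcongr
        linarith [Nat.cast_nonneg (α := ℝ) u]
    _ = 60 * μ / 2 ^ l * (2 ^ l * 2 ^ u) := by
        field_simp
        ring
    _ ≤ 60 * μ / 2 ^ l * (n + 1) := by gcongr

theorem sizeCost_scan_le {μ l u : ℕ} (hμ : 2 ≤ μ) (y : Tree T V (l + u + 1))
    (hy : μ ≤ Node.arity y) :
    (sizeCost μ l u (Tree.keys (l + u) y.first).length +
        childSum (fun c => sizeCost μ l u (Tree.keys (l + u) c).length) y.rest) +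
      30 * μ * u * List.length (α := (T × V) × Tree T V (l + u)) y.rest + 16 * μ ≤
      sizeCost μ l (u + 1) (Tree.keys (l + u + 1) y).length := by
  have hrest : (1 : ℝ) ≤ List.length (α := (T × V) × Tree T V (l + u)) y.rest := by
    exact_mod_cast Nat.le_of_succ_le_succ (hμ.trans hy)
  have hμrest : 60 * (μ : ℝ) * 1 ≤
      60 * μ * List.length (α := (T × V) × Tree T V (l + u)) y.rest := by gcongr
  have hsum := add_childSum_mul_length_sub (V := V) (Tree.keys (l + u)) (60 * μ / 2 ^ l)
    (30 * μ * (u + 2)) y.rest y.first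
  simp only [sizeCost]
  rw [hsum, Tree.keys_succ]
  push_cast
  linarith [Nat.cast_nonneg (α := ℝ) μ]

theorem add_le_scanRate {μ : ℕ} (hμ : 2 ≤ μ) (l u : ℕ) :
    ((l + u : ℕ) : ℝ) + 8 ≤ 40 * μ * (l + 1) + 30 * μ * u := by
  have hμ' : 2 ≤ (μ : ℝ) := by exact_mod_cast hμ
  push_cast
  nlinarith [Nat.cast_nonneg (α := ℝ) l, Nat.cast_nonneg (α := ℝ) u]

variable [LinearOrder T]

theorem takeBefore_length_add (hi : WithTop T) (B : List (T × V)) :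
    (takeBefore hi B).val.1.length + (takeBefore hi B).val.2.length = B.length := by
  rw [← List.length_append, takeBefore_append]

theorem time_takeBefore_le (hi : WithTop T) : ∀ B : List (T × V),
    (takeBefore hi B).time ≤ (takeBefore hi B).val.1.length + 1
  | [] => by simp [takeBefore]
  | b :: B => by
    have htail := time_takeBefore_le hi B
    simp only [takeBefore, Timed.val_bind, Timed.time_bind, time_tick]
    split
    · simp only [Timed.val_bind, Timed.val_pure, Timed.time_bind, Timed.time_pure, List.length_cons]
      omega
    · simp

theorem one_le_length_takeBefore {hi : WithTop T} {B : List (T × V)} (hB : before hi B) :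
    1 ≤ (takeBefore hi B).val.1.length := by
  cases B with
  | nil => simp [before] at hB
  | cons b B =>
    have hb : (b.1 : WithTop T) < hi := by simpa [before] using hB
    simp [takeBefore, hb]

section scan

variable {C S : Type u} {descend : WithTop T → C → List (T × V) → Timed (S × List (T × V))}

theorem scan_length_lt
    (hdescend : ∀ hi c B, before hi B → (descend hi c B).val.2.length < B.length)
    (hi : WithTop T) : ∀ (r : List ((T × V) × C)) (c : C) (B : List (T × V)), before hi B →
      (scan descend hi c r B).val.2.length < B.length
  | [], c, B, hB => by
    rw [val_scan_nil, enter, if_pos hB]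
    exact hdescend hi c B hB
  | e :: r, c, B, hB => by
    rw [val_scan_cons]
    have hrest : ∀ B', (scanIf descend hi e.2 r B').val.2.length ≤ B'.length ∧
        (before hi B' → (scanIf descend hi e.2 r B').val.2.length < B'.length) := by
      intro B'
      by_cases hB' : before hi B'
      · rw [scanIf, if_pos hB']
        have hlt := scan_length_lt hdescend hi r e.2 B' hB'
        exact ⟨hlt.le, fun _ => hlt⟩
      · rw [scanIf_of_not_before hB']
        exact ⟨le_rfl, fun h => absurd h hB'⟩
    have hmatch := length_matchEntry e.1.1 (enter descend e.1.1 c B).val.2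
    have hle := (hrest (matchEntry e.1.1 (enter descend e.1.1 c B).val.2).2).1
    by_cases hbe : before (e.1.1 : WithTop T) B
    · have hlt : (enter descend e.1.1 c B).val.2.length < B.length := by
        rw [enter, if_pos hbe]
        exact hdescend e.1.1 c B hbe
      exact hle.trans_lt (by omega)
    · simp only [enter_of_not_before hbe, Timed.val_pure] at hmatch hle ⊢
      rcases hv : (matchEntry e.1.1 B).1 with _ | v
      · have hunread : (matchEntry e.1.1 B).2 = B :=
          (matchEntry_suffix e.1.1 B).eq_of_length (by simpa [hv] using hmatch)
        rw [hunread]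
        exact (hrest B).2 hB
      · rw [hv, Option.toList_some, List.length_singleton] at hmatch
        exact hle.trans_lt (by omega)

end scan

theorem search_length_lt : ∀ (h : ℕ) (hi : WithTop T) (y : Tree T V h) (B : List (T × V)),
    before hi B → (search h hi y B).val.2.length < B.length
  | 0, hi, _, B, hB => by
    have hadd := takeBefore_length_add hi B
    have hone := one_le_length_takeBefore hB
    rw [search]
    omega
  | h + 1, hi, y, B, hB => scan_length_lt (search_length_lt h) hi y.rest y.first B hB

theorem one_le_consumed {h : ℕ} {hi : WithTop T} {y : Tree T V h} {B : List (T × V)}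
    (hB : before hi B) : 1 ≤ consumed B (search h hi y B).val.2 := by
  rw [consumed, le_sub_iff_add_le']
  exact_mod_cast search_length_lt h hi y B hB

variable [Monoid V]

theorem val_passUp_zero (μ : ℕ) (loc : Loc) (y : Tree T V 0) (s : List (T × V)) :
    (passUp μ 0 loc y s).val.2 = insertions (s.map fun e => (e, y)) := by
  rw [insertions, List.map_map]
  rfl

theorem passUp_succ (μ h : ℕ) (loc : Loc) (y : Tree T V (h + 1)) (s : Sites T V (h + 1)) :
    passUp μ (h + 1) loc y s =
      (gather (passUp μ h) loc.left loc.right y.first y.rest s >>= fun p =>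
        tick ((h + 1) * recCount p.2) >>= fun _ => processTarget μ h loc p.1.1 p.1.2 p.2) := rfl

theorem recCount_passUp (μ : ℕ) : ∀ (h : ℕ) (loc : Loc) (y : Tree T V h) (s : Sites T V h),
    recCount (passUp μ h loc y s).val.2 = 0
  | 0, loc, y, s => (congrArg recCount (val_passUp_zero μ loc y s)).trans (recCount_insertions _)
  | h + 1, loc, y, s => by
    rw [passUp_succ]
    simp only [Timed.val_bind]
    rw [processTarget]
    simp only [Timed.val_bind]
    split
    · rfl
    · exact (bulkSplit_cost _ _ _ _ _ _ _).2.2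

/-- Interleaving and splitting a node takes at most `10 μ` steps beyond those put aside for the
treelets that reach it. -/
theorem workload_succ_le {μ h : ℕ} (hμ : 2 ≤ μ) (loc : Loc) (hi : WithTop T)
    (y : Tree T V (h + 1)) (B : List (T × V)) (hy : Node.arity y ≤ 2 * μ) :
    workload (search (h + 1)) (passUp μ (h + 1)) loc hi y B ≤
      scanCost (passUp μ h) loc.left loc.right y.first y.rest
          (scan (search h) hi y.first y.rest B) +
        (h + 8) * scanRecs (passUp μ h) loc.left loc.right y.first y.rest
          (scan (search h) hi y.first y.rest B) + 10 * μ := by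
  have hsearch : search (h + 1) hi y B = scan (search h) hi y.first y.rest B := rfl
  have hlen := length_gather (passUp μ h) y.rest loc.left loc.right y.first
    (scan (search h) hi y.first y.rest B).val.1
  rw [workload, hsearch, passUp_succ, scanCost, scanRecs]
  generalize gather (passUp μ h) loc.left loc.right y.first y.rest
    (scan (search h) hi y.first y.rest B).val.1 = g at *
  have htarget := (processTarget_cost hμ loc g.val.1.1 g.val.1.2 g.val.2 (by rw [hlen]; exact hy)).1
  have hcount := insCount_add_recCount g.val.2
  simp only [Timed.val_bind, Timed.time_bind, time_tick, add_mul] at htarget ⊢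
  omega

theorem ScanBound.workload_le {μ h : ℕ} (hμ : 2 ≤ μ) {loc : Loc} {hi : WithTop T}
    {y : Tree T V (h + 1)} {B : List (T × V)} {α x : ℝ} (hy : Node.arity y ≤ 2 * μ)
    (hscan : ScanBound (passUp μ h) α (h + 8) x loc.left loc.right y.first y.rest B
      (scan (search h) hi y.first y.rest B)) :
    (workload (search (h + 1)) (passUp μ (h + 1)) loc hi y B : ℝ) ≤
      α * consumed B (search (h + 1) hi y B).val.2 + (x + 16 * μ) := by
  have hsucc := (Nat.cast_le (α := ℝ)).2 (workload_succ_le hμ loc hi y B hy)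
  have harity : ((List.length (α := (T × V) × Tree T V h) y.rest : ℝ) + 1) ≤ 2 * μ := by
    exact_mod_cast hy
  push_cast at hsucc
  rw [ScanBound] at hscan
  change _ ≤ α * consumed B (scan (search h) hi y.first y.rest B).val.2 + _
  linarith

theorem workload_zero_le {μ : ℕ} (hμ : 2 ≤ μ) (loc : Loc) (hi : WithTop T) (c : Tree T V 0)
    (B : List (T × V)) (hB : before hi B) :
    (workload (search 0) (passUp μ 0) loc hi c B : ℝ) ≤
      40 * μ * consumed B (search 0 hi c B).val.2 := by
  have hpos := one_le_length_takeBefore hB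
  have htime := time_takeBefore_le hi B
  have hconsumed : consumed B (search 0 hi c B).val.2 = (takeBefore hi B).val.1.length := by
    rw [consumed, sub_eq_iff_eq_add]
    exact_mod_cast (takeBefore_length_add hi B).symm
  have hpassTime : (passUp μ 0 loc c (search 0 hi c B).val.1).time =
    (takeBefore hi B).val.1.length := rfl
  have hpassLength : (passUp μ 0 loc c (search 0 hi c B).val.1).val.2.length =
      (takeBefore hi B).val.1.length :=
    (congrArg List.length (val_passUp_zero μ loc c (takeBefore hi B).val.1)).trans
      ((length_insertions _).trans (List.length_map _))
  have hwork : workload (search 0) (passUp μ 0) loc hi c B ≤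
      12 * (takeBefore hi B).val.1.length := by
    rw [workload, hpassTime, hpassLength, search]
    omega
  rw [hconsumed]
  exact_mod_cast hwork.trans (Nat.mul_le_mul_right _ (by omega))

theorem ChildCost.workload_le_mul {μ h : ℕ} (hμ : 2 ≤ μ)
    (hcost : ChildCost (Tree.ArityOK μ h) (40 * μ * (h + 1)) (fun _ => 0) (search h)
      (passUp (T := T) (V := V) μ h))
    (loc : Loc) (hi : WithTop T) (y : Tree T V (h + 1)) (B : List (T × V))
    (hy : NodeArityOK μ 1 h y) (hB : before hi B) :
    (workload (search (h + 1)) (passUp μ (h + 1)) loc hi y B : ℝ) ≤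
      40 * μ * ((h + 1 : ℕ) + 1) * consumed B (search (h + 1) hi y B).val.2 := by
  have hμ' : (2 : ℝ) ≤ μ := by exact_mod_cast hμ
  have hscan := (hcost.scanBound (recCount_passUp μ h) (fun _ _ => le_rfl) loc.right hi y.rest
    loc.left y.first B hy.2.2.1 hy.2.2.2).add_mul_length (recCount_passUp μ h) le_rfl
      (γ := h + 8) (by nlinarith [Nat.cast_nonneg (α := ℝ) h])
  have hwork := hscan.workload_le hμ hy.2.1
  have hone : (1 : ℝ) ≤ consumed B (search (h + 1) hi y B).val.2 := one_le_consumed hB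
  have hμone : 40 * (μ : ℝ) * 1 ≤ 40 * μ * consumed B (search (h + 1) hi y B).val.2 := by gcongr
  rw [childSum_zero] at hwork
  push_cast
  linarith

/-- This bound is good for subtrees of small height. -/
theorem childCost_mul_height {μ : ℕ} (hμ : 2 ≤ μ) : ∀ h : ℕ,
    ChildCost (Tree.ArityOK μ h) (40 * μ * (h + 1)) (fun _ => 0) (search h)
      (passUp (T := T) (V := V) μ h)
  | 0, _, loc, hi, c, B, _, hB => by
    simpa using workload_zero_le hμ loc hi c _ hB
  | h + 1, _, loc, hi, c, B, hc, hB => by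
    rw [add_zero]
    exact (childCost_mul_height hμ h).workload_le_mul hμ loc hi c _
      ((arityOK_succ.1 hc).mono (by omega)) hB

/-- This bound is good for subtrees of height at least `l` all of whose timestamps are later than
the earliest entry of the bulk. -/
theorem childCost_sizeCost {μ : ℕ} (hμ : 2 ≤ μ) (l : ℕ) : ∀ u : ℕ,
    ChildCost (Tree.ArityOK μ (l + u)) (40 * μ * (l + 1))
      (fun y => sizeCost μ l u (Tree.keys (l + u) y).length) (search (l + u))
      (passUp (T := T) (V := V) μ (l + u))
  | 0, _, loc, hi, c, B, hc, hB =>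
    (childCost_mul_height hμ l _ loc hi c B hc hB).trans
      ((add_le_add_iff_left _).2 (sizeCost_nonneg (two_pow_le_length_keys hμ l c hc)))
  | u + 1, b, loc, hi, y, B, hy, _ => by
    have hscan := ((childCost_sizeCost hμ l u).scanBound (recCount_passUp μ (l + u))
      (fun c hc => sizeCost_nonneg (two_pow_le_length_keys hμ (l + u) c hc)) loc.right hi y.rest
      loc.left y.first (b :: B) hy.2.2.1 hy.2.2.2).add_mul_length (recCount_passUp μ (l + u))
        (by positivity) (add_le_scanRate hμ l u)
    exact (hscan.workload_le hμ hy.2.1).trans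
      ((add_le_add_iff_left _).2 (sizeCost_scan_le hμ y hy.1))

theorem workload_le_of_childCostFrom {μ : ℕ} (hμ : 2 ≤ μ) (l u : ℕ) {b : T × V}
    (hfirst : ChildCostFrom b
      (fun y => Tree.ArityOK μ (l + u) y ∧ (Tree.keys (l + u) y).Pairwise (· < ·))
      (40 * μ * (l + 1))
      (fun y => 40 * μ * u + 60 * μ / 2 ^ l * lateCount b.1 (Tree.keys (l + u) y))
      (search (l + u)) (passUp (T := T) (V := V) μ (l + u)))
    (loc : Loc) (hi : WithTop T) (y : Tree T V (l + u + 1)) (B : List (T × V))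
    (hy : NodeArityOK μ 1 (l + u) y) (hk : (Tree.keys (l + u + 1) y).Pairwise (· < ·)) :
    (workload (search (l + u + 1)) (passUp μ (l + u + 1)) loc hi y (b :: B) : ℝ) ≤
      40 * μ * (l + 1) * consumed (b :: B) (search (l + u + 1) hi y (b :: B)).val.2 +
        (40 * μ * (u + 1 : ℕ) + 60 * μ / 2 ^ l * lateCount b.1 (Tree.keys (l + u + 1) y)) := by
  rw [Tree.keys_succ] at hk ⊢
  have hrate : ((l + u : ℕ) : ℝ) + 8 ≤ 40 * μ * (l + 1) + 30 * μ * (u + 2) :=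
    (add_le_scanRate hμ l u).trans (by gcongr; linarith)
  have hscan := (childCost_sizeCost hμ l u).scanBound_lateCount (β := 60 * μ / 2 ^ l)
    (s := 30 * μ * (u + 2)) hfirst (recCount_passUp μ (l + u))
    (fun c hc => sizeCost_nonneg (two_pow_le_length_keys hμ (l + u) c hc)) (by positivity)
    (by positivity) (by positivity) hrate loc.right hi B y.rest loc.left y.first hy.2.2.1 hy.2.2.2
    hk
  have hwork := hscan.workload_le hμ hy.2.1
  push_cast
  linarith [Nat.cast_nonneg (α := ℝ) μ]

theorem childCostFrom_lateCount {μ : ℕ} (hμ : 2 ≤ μ) (l : ℕ) (b : T × V) : ∀ u : ℕ,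
    ChildCostFrom b
      (fun y => Tree.ArityOK μ (l + u) y ∧ (Tree.keys (l + u) y).Pairwise (· < ·))
      (40 * μ * (l + 1))
      (fun y => 40 * μ * u + 60 * μ / 2 ^ l * lateCount b.1 (Tree.keys (l + u) y))
      (search (l + u)) (passUp (T := T) (V := V) μ (l + u))
  | 0, loc, hi, y, B, hy, hB =>
    (childCost_mul_height hμ l b loc hi y B hy.1 hB).trans
      ((add_le_add_iff_left _).2 (by positivity))
  | u + 1, loc, hi, y, B, hy, _ =>
    workload_le_of_childCostFrom hμ l u (childCostFrom_lateCount hμ l b u) loc hi y B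
      ((arityOK_succ.1 hy.1).mono (by omega)) hy.2

/-- The level `l` at which the counting of heights changes to the counting of entries is left open:
it will be about `log (d / m)`. -/
theorem workload_le {μ : ℕ} (hμ : 2 ≤ μ) (l h : ℕ) (loc : Loc) (y : Tree T V (h + 1)) (b : T × V)
    (B : List (T × V)) (hy : NodeArityOK μ 1 h y)
    (hk : (Tree.keys (h + 1) y).Pairwise (· < ·)) :
    (workload (search (h + 1)) (passUp μ (h + 1)) loc ⊤ y (b :: B) : ℝ) ≤
      40 * μ * (l + 1) * (b :: B).length + 40 * μ * (h + 1) +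
        60 * μ / 2 ^ l * lateCount b.1 (Tree.keys (h + 1) y) := by
  have hle := consumed_le_length (b :: B) (search (h + 1) ⊤ y (b :: B)).val.2
  have hB : before ⊤ (b :: B) := by simp [before]
  have hone : 1 ≤ consumed (b :: B) (search (h + 1) ⊤ y (b :: B)).val.2 := one_le_consumed hB
  rcases Nat.lt_or_ge h l with hl | hl
  · have hwork := (childCost_mul_height hμ h).workload_le_mul hμ loc ⊤ y (b :: B) hy hB
    have hmul : 40 * (μ : ℝ) * ((h + 1 : ℕ) + 1) * consumed (b :: B)
        (search (h + 1) ⊤ y (b :: B)).val.2 ≤ 40 * μ * (l + 1) * (b :: B).length := by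
      have : ((h + 1 : ℕ) : ℝ) ≤ l := by exact_mod_cast hl
      gcongr
    have hrest : 0 ≤ 40 * (μ : ℝ) * (h + 1) + 60 * μ / 2 ^ l *
      lateCount b.1 (Tree.keys (h + 1) y) := by positivity
    linarith
  · obtain ⟨u, rfl⟩ := Nat.exists_eq_add_of_le hl
    have hwork := workload_le_of_childCostFrom hμ l u (childCostFrom_lateCount hμ l b u) loc ⊤ y B
      hy hk
    have hmul : 40 * (μ : ℝ) * (l + 1) * consumed (b :: B)
        (search (l + u + 1) ⊤ y (b :: B)).val.2 ≤ 40 * μ * (l + 1) * (b :: B).length := by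
      gcongr
    have hheight : 40 * (μ : ℝ) * (u + 1 : ℕ) ≤ 40 * μ * ((l + u : ℕ) + 1) := by
      gcongr
      push_cast
      linarith [Nat.cast_nonneg (α := ℝ) l]
    linarith

end workload

/-! ### The walk up from the right finger -/

section finger

variable {T V : Type u}

theorem Node.exists_concat {C : Type u} (y : Node T V C) (hy : 2 ≤ y.arity) :
    ∃ a f l e c, y = ⟨a, f, l ++ [(e, c)]⟩ := by
  rcases y.eq_nil_or_concat with hnil | ⟨l, e, c, hconcat⟩
  · rw [hnil] at hy
    simp [Node.arity] at hy
  · exact ⟨_, _, l, e, c, hconcat⟩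

theorem NodeArityOK.last {μ a h : ℕ} {y : Tree T V (h + 1)} (hy : NodeArityOK μ a h y) :
    Tree.ArityOK μ h (Node.last y) := by
  rcases Node.eq_nil_or_concat y with hnil | ⟨l, e, c, hconcat⟩
  · rw [hnil]
    exact hy.2.2.1
  · rw [hconcat] at hy ⊢
    rw [Node.last_concat]
    exact hy.2.2.2 (e, c) (by simp)

theorem keys_mk_concat (h : ℕ) (x : V) (f c : Tree T V h) (l : List ((T × V) × Tree T V h))
    (e : T × V) : Tree.keys (h + 1) (⟨x, f, l ++ [(e, c)]⟩ : Node T V (Tree T V h)) =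
      (Tree.keys h f ++ flatKeys (Tree.keys h) l) ++ e.1 :: Tree.keys h c := by
  simp [Tree.keys_mk]

theorem keys_last_suffix {h : ℕ} (y : Tree T V (h + 1)) :
    Tree.keys h (Node.last y) <:+ Tree.keys (h + 1) y := by
  rcases Node.eq_nil_or_concat y with hnil | ⟨l, e, c, hconcat⟩
  · rw [hnil, Tree.keys_mk, flatKeys_nil, List.append_nil]
    exact List.suffix_rfl
  · rw [hconcat, Node.last_concat, keys_mk_concat]
    exact (List.suffix_cons _ _).trans (List.suffix_append _ _)

variable [LinearOrder T]

/-- The number of timestamps later than `t`: the out-of-order distance of `t`. -/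
def laterCount (t : T) (l : List T) : ℕ := l.countP fun x => decide (t < x)

theorem lateCount_le_of_sublist {t : T} {l l' : List T} (h : l.Sublist l') :
    lateCount t l ≤ lateCount t l' := h.countP_le

theorem laterCount_le_of_sublist {t : T} {l l' : List T} (h : l.Sublist l') :
    laterCount t l ≤ laterCount t l' := h.countP_le

theorem laterCount_eq_length {t : T} {l : List T} (h : ∀ x ∈ l, t < x) :
    laterCount t l = l.length :=
  List.countP_eq_length.2 fun x hx => decide_eq_true (h x hx)

theorem lateCount_le_laterCount_add_one (t : T) : ∀ l : List T, l.Pairwise (· < ·) →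
    lateCount t l ≤ laterCount t l + 1
  | [], _ => by simp [lateCount]
  | x :: l, hl => by
    obtain ⟨hx, hl⟩ := List.pairwise_cons.1 hl
    rcases lt_or_ge x t with hxt | htx
    · have htail := lateCount_le_laterCount_add_one t l hl
      simpa [lateCount, laterCount, hxt.not_ge, hxt.le.not_gt] using htail
    · calc lateCount t (x :: l) ≤ l.length + 1 := List.countP_le_length
        _ = laterCount t l + 1 := by
          rw [laterCount_eq_length fun z hz => htx.trans_lt (hx z hz)]
        _ ≤ laterCount t (x :: l) + 1 := by
          gcongr
          exact laterCount_le_of_sublist (List.sublist_cons_self _ _)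

theorem exists_mem_keys_le_of_startsBy {t : T} {h : ℕ} {y : Tree T V (h + 1)}
    (hy : Node.startsBy y t = true) : ∃ x ∈ Tree.keys (h + 1) y, x ≤ t := by
  obtain ⟨a, c, _ | ⟨e, r⟩⟩ := y
  · exact absurd hy (by simp [Node.startsBy])
  · exact ⟨e.1.1, by simp [Tree.keys_mk], by simpa [Node.startsBy] using hy⟩

theorem two_pow_le_laterCount_of_not_startsBy {μ : ℕ} (hμ : 2 ≤ μ) {t : T} {h : ℕ} :
    ∀ {y : Tree T V (h + 1)}, Tree.ArityOK μ (h + 1) y →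
    (Tree.keys (h + 1) y).Pairwise (· < ·) → Node.startsBy y t = false →
    2 ^ h ≤ laterCount t (Tree.keys (h + 1) y)
  | ⟨_, _, []⟩, hy, _, _ => absurd (hμ.trans hy.1) (by simp [Node.arity])
  | ⟨_, c, e :: r⟩, hy, hk, hstart => by
    have ht : t < e.1.1 := by simpa [Node.startsBy] using hstart
    have hsize := two_pow_le_length_keys hμ h e.2 (hy.2.2.2 e List.mem_cons_self)
    rw [Tree.keys_mk, flatKeys_cons] at hk ⊢
    have hafter := (List.pairwise_cons.1 (List.pairwise_append.1 hk).2.1).1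
    have hlater : ∀ x ∈ e.1.1 :: Tree.keys h e.2, t < x := by
      intro x hx
      rcases List.mem_cons.1 hx with rfl | hx
      · exact ht
      · exact ht.trans (hafter x (List.mem_append_left _ hx))
    calc 2 ^ h ≤ (e.1.1 :: Tree.keys h e.2).length := hsize
      _ = laterCount t (e.1.1 :: Tree.keys h e.2) := (laterCount_eq_length hlater).symm
      _ ≤ _ := laterCount_le_of_sublist
        (((List.sublist_append_left _ _).cons_cons _).trans (List.sublist_append_right _ _))

theorem getD_lowestOnSpine_zero (t : T) (y : Tree T V 1) :
    (lowestOnSpine t 0 y).getD 1 = 1 := by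
  rw [lowestOnSpine]
  split <;> rfl

theorem getD_lowestOnSpine_succ_of_none {t : T} {h : ℕ} {y : Tree T V (h + 1 + 1)}
    (hlast : lowestOnSpine t h (Node.last y) = none) :
    (lowestOnSpine t (h + 1) y).getD (h + 2) = h + 2 := by
  rw [lowestOnSpine, hlast, Option.none_or]
  split <;> rfl

theorem lowestOnSpine_succ_of_some {t : T} {h k : ℕ} {y : Tree T V (h + 1 + 1)}
    (hlast : lowestOnSpine t h (Node.last y) = some k) :
    lowestOnSpine t (h + 1) y = some k := by
  rw [lowestOnSpine, hlast]
  rfl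

theorem not_startsBy_of_lowestOnSpine_eq_none {t : T} : ∀ (h : ℕ) (y : Tree T V (h + 1)),
    lowestOnSpine t h y = none → Node.startsBy y t = false
  | 0, _, hy => by simpa [lowestOnSpine] using hy
  | h + 1, y, hy => by
    rw [lowestOnSpine, Option.or_eq_none_iff] at hy
    simpa using hy.2

theorem lowestOnSpine_eq_some {t : T} : ∀ (h : ℕ) (y : Tree T V (h + 1)) (k : ℕ),
    lowestOnSpine t h y = some k → k ≤ h + 1 ∧ ∃ x ∈ Tree.keys (h + 1) y, x ≤ t
  | 0, y, k, hk => by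
    obtain ⟨hstart, rfl⟩ : Node.startsBy y t = true ∧ 1 = k := by simpa [lowestOnSpine] using hk
    exact ⟨le_rfl, exists_mem_keys_le_of_startsBy hstart⟩
  | h + 1, y, k, hk => by
    rw [lowestOnSpine, Option.or_eq_some_iff] at hk
    rcases hk with hk | ⟨-, hk⟩
    · obtain ⟨hle, x, hx, hxt⟩ := lowestOnSpine_eq_some h _ k hk
      exact ⟨by omega, x, (keys_last_suffix y).subset hx, hxt⟩
    · obtain ⟨hstart, rfl⟩ : Node.startsBy y t = true ∧ h + 2 = k := by simpa using hk
      exact ⟨le_rfl, exists_mem_keys_le_of_startsBy hstart⟩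

/-- The node below the one at which the walk stops lies completely after `t`. -/
theorem two_pow_getD_lowestOnSpine_le {μ : ℕ} (hμ : 2 ≤ μ) (t : T) :
    ∀ (h : ℕ) (y : Tree T V (h + 1)), NodeArityOK μ 1 h y →
      (Tree.keys (h + 1) y).Pairwise (· < ·) →
      2 ^ (lowestOnSpine t h y).getD (h + 1) ≤ 4 * (laterCount t (Tree.keys (h + 1) y) + 1)
  | 0, y, _, _ => by
    rw [getD_lowestOnSpine_zero]
    omega
  | h + 1, y, hy, hk => by
    have hsub := (keys_last_suffix y).sublist
    have hmono := laterCount_le_of_sublist (t := t) hsub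
    cases hlow : lowestOnSpine t h (Node.last y) with
    | some k =>
      have hlast := two_pow_getD_lowestOnSpine_le hμ t h (Node.last y)
        ((arityOK_succ.1 hy.last).mono (by omega)) (hk.sublist hsub)
      rw [hlow] at hlast
      rw [lowestOnSpine_succ_of_some hlow]
      simp only [Option.getD_some] at hlast ⊢
      omega
    | none =>
      have hlast := two_pow_le_laterCount_of_not_startsBy hμ hy.last (hk.sublist hsub)
        (not_startsBy_of_lowestOnSpine_eq_none h _ hlow)
      rw [getD_lowestOnSpine_succ_of_none hlow, pow_add]
      omega

end finger

/-! ### The pass up along the right spine -/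

section spine

theorem Timed.bind_def {α β : Type u} (x : Timed α) (f : α → Timed β) :
    x >>= f = ⟨(f x.val).val, x.time + (f x.val).time⟩ := rfl

variable {T V : Type u}

/-- The bound for the workload `w` that a bulk of `m` entries causes in a subtree of height `k` in
which `n` timestamps are not before the bulk. The level `l` can be chosen later. -/
def WorkloadBound (μ k m n w : ℕ) : Prop :=
  ∀ l : ℕ, (w : ℝ) ≤ 40 * μ * (l + 1) * m + 40 * μ * k + 60 * μ / 2 ^ l * n

theorem WorkloadBound.mono {μ k m n n' w : ℕ} (hw : WorkloadBound μ k m n w) (h : n ≤ n') :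
    WorkloadBound μ k m n' w :=
  fun l => (hw l).trans (by gcongr)

variable [LinearOrder T] [Monoid V]

/-- The result `p` of the pass up along the right spine from height `k` to height `p.2`, at a node
`y` whose arity must be at least `a`; here `w` is the workload of the subtree at height `k`. The
last field bounds the potential, which is the number of nodes of arity `2μ`. -/
structure SpineProcessed (μ a k h w : ℕ) (lo : WithBot T) (y : Tree T V (h + 1))
    (p : Timed ((Tree T V (h + 1) × List (Treelet T V (Tree T V (h + 1)))) × ℕ))
    (R : List ((T × V) × Tree T V (h + 1))) : Prop
    extends NodeProcessed μ a h lo ⊤ p.val.1 R where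
  time_le : p.time + 9 * R.length + 10 * μ * k ≤ w + 10 * μ * p.val.2
  le_top : k ≤ p.val.2
  top_le : p.val.2 ≤ h + 1
  top_eq : R ≠ [] → p.val.2 = h + 1
  length_le : R.length ≤ w
  potential_le : p.val.2 + (Tree.fullCount μ (h + 1) p.val.1.1 +
    childSum (Tree.fullCount μ (h + 1)) R) + 2 * R.length ≤ k + Tree.fullCount μ (h + 1) y + 2 * w

theorem spineProcessed_start {μ a h : ℕ} (hμ : 2 ≤ μ) (haμ : a ≤ μ) (ha : 1 ≤ a) (loc : Loc)
    (lo : WithBot T) (y : Tree T V (h + 1)) (b : T × V) (B : List (T × V))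
    (hy : NodeArityOK μ a h y) (hk : Bounded lo ⊤ (Tree.keys (h + 1) y))
    (hB : (b :: B).Pairwise fun a b => a.1 < b.1) (hlo : ∀ x ∈ b :: B, lo < (x.1 : WithBot T)) :
    ∃ w R, WorkloadBound μ (h + 1) (b :: B).length (lateCount b.1 (Tree.keys (h + 1) y)) w ∧
      SpineProcessed μ a (h + 1) h w lo y (search (h + 1) ⊤ y (b :: B) >>= fun s =>
        passUp μ (h + 1) loc y s.1 >>= fun p => pure (p, h + 1)) R := by
  obtain ⟨-, R, hnode, hfull⟩ := passUp_nodeProcessed hμ (passUp_childCorrect hμ h) a haμ loc lo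
    ⊤ y (b :: B) hk hy hB hlo
  have hw : workload (search (h + 1)) (passUp μ (h + 1)) loc ⊤ y (b :: B) =
      (search (h + 1) ⊤ y (b :: B)).time +
        (passUp μ (h + 1) loc y (search (h + 1) ⊤ y (b :: B)).val.1).time + 9 * R.length := by
    rw [workload, hnode.eq_insertions, length_insertions]
  refine ⟨workload (search (h + 1)) (passUp μ (h + 1)) loc ⊤ y (b :: B), R, fun l => ?_, ?_⟩
  · exact_mod_cast workload_le hμ l h loc y b B (hy.mono ha) hk.1
  · refine ⟨hnode, ?_, le_rfl, le_rfl, fun _ => rfl, ?_, ?_⟩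
    · simp only [Timed.val_bind, Timed.time_bind, Timed.val_pure, Timed.time_pure]
      omega
    · omega
    · simp only [Timed.val_bind, Timed.val_pure]
      omega

/-- One step of `passUpSpine`: from the result `p` at the last child of `y` to the result at `y`. -/
def spineStep (μ h : ℕ) (loc : Loc) (y : Tree T V (h + 1 + 1))
    (p : (Tree T V (h + 1) × List (Treelet T V (Tree T V (h + 1)))) × ℕ) :
    Timed ((Tree T V (h + 1 + 1) × List (Treelet T V (Tree T V (h + 1 + 1)))) × ℕ) :=
  let y' : Node T V (Tree T V (h + 1)) := Node.setLast y p.1.1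
  if p.1.2.isEmpty then pure ((y', []), p.2)
  else processTarget μ (h + 1) loc y'.first y'.rest p.1.2 >>= fun q => pure (q, h + 2)

theorem passUpSpine_succ {μ k h : ℕ} {B : List (T × V)} {loc : Loc} {y : Tree T V (h + 1 + 1)}
    (hk : k ≤ h + 1) : passUpSpine μ k B (h + 1) loc y =
      passUpSpine μ k B h ⟨false, loc.right⟩ (Node.last y) >>= spineStep μ h loc y := by
  rw [passUpSpine, if_neg (by omega)]
  rfl

theorem spineStep_concat_of_nil {μ h top : ℕ} {loc : Loc} {x : V} {f c c' : Tree T V (h + 1)}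
    {l : List ((T × V) × Tree T V (h + 1))} {e : T × V} :
    spineStep μ h loc ⟨x, f, l ++ [(e, c)]⟩ ((c', []), top) =
      pure ((⟨x, f, l ++ [(e, c')]⟩, []), top) := by
  simp [spineStep, Node.setLast_concat]

theorem spineStep_concat_of_ne_nil {μ h top : ℕ} {loc : Loc} {x : V} {f c c' : Tree T V (h + 1)}
    {l : List ((T × V) × Tree T V (h + 1))} {e : T × V}
    {L : List (Treelet T V (Tree T V (h + 1)))} (hL : L ≠ []) :
    spineStep μ h loc ⟨x, f, l ++ [(e, c)]⟩ ((c', L), top) =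
      processTarget μ (h + 1) loc f (l ++ [(e, c')]) L >>= fun q => pure (q, h + 2) := by
  simp [spineStep, Node.setLast_concat, hL]

theorem NodeProcessed.interleave_concat {μ h : ℕ} {e : T × V}
    {l : List ((T × V) × Tree T V (h + 1))} {lo : WithBot T} {f : Tree T V (h + 1)}
    {p : Tree T V (h + 1) × List (Treelet T V (Tree T V (h + 1)))}
    {R : List ((T × V) × Tree T V (h + 1))} (hp : NodeProcessed μ μ h e.1 ⊤ p R)
    (hleft : Bounded lo (e.1 : WithTop T)
      (Tree.keys (h + 1) f ++ flatKeys (Tree.keys (h + 1)) l)) :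
    (interleave (l ++ [(e, p.1)]) p.2).val = l ++ [(e, p.1)] ++ R := by
  have he : ∀ x ∈ R, e.1 < x.1.1 := fun x hx => WithBot.coe_lt_coe.1 (hp.bounded.2 x.1.1
    (List.mem_append_right _ (List.mem_flatMap.2 ⟨x, hx, List.mem_cons_self⟩))).1
  have hl : ∀ q ∈ l, q.1.1 < e.1 := fun q hq => WithTop.coe_lt_coe.1 (hleft.2 q.1.1
    (List.mem_append_right _ (List.mem_flatMap.2 ⟨q, hq, List.mem_cons_self⟩))).2
  rw [hp.eq_insertions]
  refine interleave_insertions_of_lt R _ fun q hq x hx => ?_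
  rcases List.mem_append.1 hq with hq | hq
  · exact (hl q hq).trans (he x hx)
  · rw [List.mem_singleton.1 hq]
    exact he x hx

theorem NodeProcessed.processTarget_concat {μ a h : ℕ} (hμ : 2 ≤ μ) (ha : a ≤ μ) {loc : Loc}
    {lo : WithBot T} {x : V} {f c : Tree T V (h + 1)} {l : List ((T × V) × Tree T V (h + 1))}
    {e : T × V} {p : Tree T V (h + 1) × List (Treelet T V (Tree T V (h + 1)))}
    {R : List ((T × V) × Tree T V (h + 1))} (hp : NodeProcessed μ μ h e.1 ⊤ p R) (hR : R ≠ [])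
    (hy : NodeArityOK μ a (h + 1) (⟨x, f, l ++ [(e, c)]⟩ : Node T V (Tree T V (h + 1))))
    (hk : Bounded lo ⊤ (Tree.keys (h + 1 + 1)
      (⟨x, f, l ++ [(e, c)]⟩ : Node T V (Tree T V (h + 1))))) :
    ∃ R', NodeProcessed μ a (h + 1) lo ⊤
        (processTarget μ (h + 1) loc f (l ++ [(e, p.1)]) p.2).val R' ∧
      R'.length ≤ R.length ∧
      (processTarget μ (h + 1) loc f (l ++ [(e, p.1)]) p.2).time + 9 * R'.length ≤
        10 * μ + 7 * R.length ∧
      Tree.fullCount μ (h + 1 + 1) (processTarget μ (h + 1) loc f (l ++ [(e, p.1)]) p.2).val.1 +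
          childSum (Tree.fullCount μ (h + 1 + 1)) R' + 2 * R'.length + 1 +
          Tree.fullCount μ (h + 1) c ≤
        Tree.fullCount μ (h + 1 + 1) (⟨x, f, l ++ [(e, c)]⟩ : Node T V (Tree T V (h + 1))) +
          (Tree.fullCount μ (h + 1) p.1 + childSum (Tree.fullCount μ (h + 1)) R) +
          2 * R.length := by
  obtain ⟨harity, hle, hf, hl⟩ := nodeArityOK_mk.1 hy
  rw [keys_mk_concat] at hk
  obtain ⟨hleft, -, hlo⟩ := bounded_append_cons.1 hk
  have hinterleave := hp.interleave_concat hleft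
  have hchildren : ∀ q ∈ l ++ [(e, p.1)] ++ R, Tree.ArityOK μ (h + 1) q.2 := by
    simp only [List.mem_append, List.mem_singleton]
    rintro q ((hq | rfl) | hq)
    · exact hl q (List.mem_append_left _ hq)
    · exact hp.nodeArityOK
    · exact hp.arityOK q hq
  obtain ⟨R', hR', htarget⟩ := processTarget_targetProcessed hμ loc f (l ++ [(e, p.1)]) p.2 hf
    (hinterleave ▸ hchildren)
  rw [hinterleave] at htarget
  simp only [List.length_append, List.length_singleton] at harity hle
  have hm : 1 ≤ R.length := List.length_pos_iff.2 hR
  have hI : (l ++ [(e, p.1)] ++ R).length = l.length + 1 + R.length := by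
    rw [List.length_append, List.length_append, List.length_singleton]
  have hlen := (htarget.length_le hμ hI hle hm).1
  have hpot := htarget.potential_le hμ hI hle hm
  have hcost := (processTarget_cost hμ loc f (l ++ [(e, p.1)]) p.2 (by simpa using hle)).1
  have hL : p.2.length = R.length := by rw [hp.eq_insertions, length_insertions]
  refine ⟨R', ⟨hR', ?_, htarget.nodeArityOK a ha (by omega), htarget.nodeArityOK_of_ne_nil,
    htarget.arityOK⟩, hlen, ?_, ?_⟩
  · rw [htarget.keys_eq]
    simpa using bounded_append_cons.2 ⟨hleft, hp.bounded, hlo⟩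
  · rwa [hR', length_insertions, hL] at hcost
  · rw [Tree.fullCount_mk μ (h + 1) x]
    simp only [childSum_append, childSum_cons, childSum_nil, List.length_append,
      List.length_singleton] at hpot ⊢
    omega

theorem SpineProcessed.step_of_nil {μ a k h w : ℕ} {loc : Loc} {lo : WithBot T} {x : V}
    {f c : Tree T V (h + 1)} {l : List ((T × V) × Tree T V (h + 1))} {e : T × V}
    {p : Timed ((Tree T V (h + 1) × List (Treelet T V (Tree T V (h + 1)))) × ℕ)}
    (hp : SpineProcessed μ μ k h w e.1 c p [])
    (hy : NodeArityOK μ a (h + 1) (⟨x, f, l ++ [(e, c)]⟩ : Node T V (Tree T V (h + 1))))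
    (hk : Bounded lo ⊤ (Tree.keys (h + 1 + 1)
      (⟨x, f, l ++ [(e, c)]⟩ : Node T V (Tree T V (h + 1))))) :
    SpineProcessed μ a k (h + 1) w lo ⟨x, f, l ++ [(e, c)]⟩
      (p >>= spineStep μ h loc ⟨x, f, l ++ [(e, c)]⟩) [] := by
  obtain ⟨⟨⟨c', L⟩, top⟩, s⟩ := p
  obtain ⟨⟨hL, hbdd, hc', -, -⟩, htime, hle_top, htop_le, -, -, hpot⟩ := hp
  obtain ⟨harity, hle, hf, hl⟩ := nodeArityOK_mk.1 hy
  obtain rfl : L = [] := hL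
  replace hpot : top + (Tree.fullCount μ (h + 1) c' + 0) + 0 ≤
    k + Tree.fullCount μ (h + 1) c + 2 * w := hpot
  rw [keys_mk_concat] at hk
  obtain ⟨hleft, -, hlo⟩ := bounded_append_cons.1 hk
  rw [Timed.bind_def, spineStep_concat_of_nil]
  refine ⟨⟨rfl, ?_, nodeArityOK_mk.2 ⟨by simpa using harity, by simpa using hle, hf, ?_⟩,
    fun h => absurd rfl h, by simp⟩, htime, hle_top, htop_le.trans (Nat.le_succ _),
    fun h => absurd rfl h, Nat.zero_le _, ?_⟩
  · rw [flatKeys_nil, List.append_nil] at hbdd ⊢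
    change Bounded lo ⊤ (Tree.keys (h + 1 + 1)
      (⟨x, f, l ++ [(e, c')]⟩ : Node T V (Tree T V (h + 1))))
    rw [keys_mk_concat]
    exact bounded_append_cons.2 ⟨hleft, hbdd, hlo⟩
  · simp only [List.mem_append, List.mem_singleton]
    rintro q (hq | rfl)
    · exact hl q (List.mem_append_left _ hq)
    · exact hc'
  · change top + (Tree.fullCount μ (h + 1 + 1)
      (⟨x, f, l ++ [(e, c')]⟩ : Node T V (Tree T V (h + 1))) + 0) + 0 ≤ _
    simp only [Tree.fullCount_mk, childSum_append, childSum_cons, childSum_nil,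
      List.length_append, List.length_singleton]
    omega

theorem SpineProcessed.step_of_ne_nil {μ a k h w : ℕ} (hμ : 2 ≤ μ) (ha : a ≤ μ) {loc : Loc}
    {lo : WithBot T} {x : V} {f c : Tree T V (h + 1)} {l : List ((T × V) × Tree T V (h + 1))}
    {e : T × V} {p : Timed ((Tree T V (h + 1) × List (Treelet T V (Tree T V (h + 1)))) × ℕ)}
    {R : List ((T × V) × Tree T V (h + 1))} (hp : SpineProcessed μ μ k h w e.1 c p R) (hR : R ≠ [])
    (hy : NodeArityOK μ a (h + 1) (⟨x, f, l ++ [(e, c)]⟩ : Node T V (Tree T V (h + 1))))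
    (hk : Bounded lo ⊤ (Tree.keys (h + 1 + 1)
      (⟨x, f, l ++ [(e, c)]⟩ : Node T V (Tree T V (h + 1))))) :
    ∃ R', SpineProcessed μ a k (h + 1) w lo ⟨x, f, l ++ [(e, c)]⟩
      (p >>= spineStep μ h loc ⟨x, f, l ++ [(e, c)]⟩) R' := by
  obtain ⟨⟨⟨c', L⟩, top⟩, s⟩ := p
  obtain ⟨hnode, htime, hle_top, -, htop_eq, hRw, hpot⟩ := hp
  obtain ⟨R', hnode', hlen, hcost, hpot'⟩ := hnode.processTarget_concat hμ ha (loc := loc) hR hy hk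
  have hL : L ≠ [] := by
    rw [show L = insertions R from hnode.eq_insertions]
    simpa [insertions] using hR
  obtain rfl : top = h + 1 := htop_eq hR
  replace htime : s + 9 * R.length + 10 * μ * k ≤ w + 10 * μ * (h + 1) := htime
  replace hpot : h + 1 + (Tree.fullCount μ (h + 1) c' + childSum (Tree.fullCount μ (h + 1)) R) +
    2 * R.length ≤ k + Tree.fullCount μ (h + 1) c + 2 * w := hpot
  rw [Timed.bind_def, spineStep_concat_of_ne_nil hL]
  refine ⟨R', hnode', ?_, Nat.le_succ_of_le hle_top, le_rfl, fun _ => rfl, hlen.trans hRw, ?_⟩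
  · change s + ((processTarget μ (h + 1) loc f (l ++ [(e, c')]) L).time + 0) + 9 * R'.length +
      10 * μ * k ≤ w + 10 * μ * (h + 1 + 1)
    dsimp only at hcost
    simp only [Nat.mul_add] at htime ⊢
    omega
  · change h + 1 + 1 + (Tree.fullCount μ (h + 1 + 1)
      (processTarget μ (h + 1) loc f (l ++ [(e, c')]) L).val.1 + _) + _ ≤ _
    dsimp only at hpot'
    omega

theorem passUpSpine_spineProcessed {μ : ℕ} (hμ : 2 ≤ μ) {b : T × V} {B : List (T × V)}
    (hB : (b :: B).Pairwise fun a b => a.1 < b.1) : ∀ (h a : ℕ) (loc : Loc) (lo : WithBot T)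
    (y : Tree T V (h + 1)), a ≤ μ → rootMinArity h ≤ a → NodeArityOK μ a h y →
    Bounded lo ⊤ (Tree.keys (h + 1) y) → (∀ x ∈ b :: B, lo < (x.1 : WithBot T)) →
    ∃ w R, WorkloadBound μ ((lowestOnSpine b.1 h y).getD (h + 1)) (b :: B).length
        (lateCount b.1 (Tree.keys (h + 1) y)) w ∧
      SpineProcessed μ a ((lowestOnSpine b.1 h y).getD (h + 1)) h w lo y
        (passUpSpine μ ((lowestOnSpine b.1 h y).getD (h + 1)) (b :: B) h loc y) R
  | 0, a, loc, lo, y, haμ, ha, hy, hk, hlo => by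
    rw [getD_lowestOnSpine_zero]
    exact spineProcessed_start hμ haμ ha loc lo y b B hy hk hB hlo
  | h + 1, a, loc, lo, y, haμ, ha, hy, hk, hlo => by
    cases hlow : lowestOnSpine b.1 h (Node.last y) with
    | none =>
      rw [getD_lowestOnSpine_succ_of_none hlow, passUpSpine, if_pos le_rfl]
      exact spineProcessed_start hμ haμ ((one_le_rootMinArity _).trans ha) loc lo y b B hy hk hB hlo
    | some k =>
      obtain ⟨hkh, z, hz, hzb⟩ := lowestOnSpine_eq_some h _ k hlow
      rw [lowestOnSpine_succ_of_some hlow, Option.getD_some, passUpSpine_succ hkh]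
      have hsub := (keys_last_suffix y).sublist
      have ha2 : 2 ≤ a := by simpa [rootMinArity] using ha
      obtain ⟨x, f, l, e, c, rfl⟩ := Node.exists_concat y (ha2.trans hy.1)
      rw [Node.last_concat] at hz hlow hsub ⊢
      obtain ⟨-, hright, -⟩ := bounded_append_cons.1 (keys_mk_concat (h + 1) x f c l e ▸ hk)
      have hafter : ∀ q ∈ b :: B, ((e.1 : T) : WithBot T) < (q.1 : WithBot T) := by
        have heb : ((e.1 : T) : WithBot T) < (b.1 : WithBot T) :=
          (hright.2 z hz).1.trans_le (WithBot.coe_le_coe.2 hzb)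
        exact List.forall_mem_cons.2 ⟨heb, fun q hq => heb.trans
          (WithBot.coe_lt_coe.2 ((List.pairwise_cons.1 hB).1 q hq))⟩
      obtain ⟨w, R, hw, hp⟩ := passUpSpine_spineProcessed hμ hB h μ ⟨false, loc.right⟩ e.1 c le_rfl
        ((rootMinArity_le_two h).trans hμ) (arityOK_succ.1 (hy.2.2.2 (e, c) (by simp))) hright
        hafter
      rw [hlow, Option.getD_some] at hw hp
      have hw' := hw.mono (lateCount_le_of_sublist hsub)
      by_cases hR : R = []
      · subst hR
        exact ⟨w, [], hw', hp.step_of_nil hy hk⟩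
      · obtain ⟨R', hR'⟩ := hp.step_of_ne_nil hμ haμ hR hy hk
        exact ⟨w, R', hw', hR'⟩

end spine

/-! ### New roots -/

section root

variable {T V : Type u} [LinearOrder T]

/-- What `growRoot` returns for the tree `y` of height `h + 1` whose root has been split into `y`
and the nodes in `R`: a valid window, with its height, its potential, and the time it takes. -/
structure RootGrown (μ h : ℕ) (y : Tree T V (h + 1)) (R : List ((T × V) × Tree T V (h + 1)))
    (G : Timed (Window T V)) : Prop where
  valid : G.val.Valid μ
  le_height : h ≤ G.val.height
  height_le : G.val.height ≤ h + R.length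
  potential_le : G.val.height + G.val.fullCount μ ≤
    h + (Tree.fullCount μ (h + 1) y + childSum (Tree.fullCount μ (h + 1)) R) + 2 * R.length
  time_le : G.time + 10 * μ * h ≤ 9 * R.length + 10 * μ * G.val.height

theorem rootGrown_pure {μ h : ℕ} (hμ : 1 ≤ μ)
    {p : Tree T V (h + 1) × List (Treelet T V (Tree T V (h + 1)))}
    (hp : NodeProcessed μ (rootMinArity h) h ⊥ ⊤ p []) :
    RootGrown μ h p.1 [] (pure ⟨h, p.1⟩) := by
  have hkeys := hp.bounded.1
  rw [flatKeys_nil, List.append_nil] at hkeys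
  exact ⟨(Window.valid_iff hμ _).2 ⟨hp.nodeArityOK, hkeys⟩, le_rfl, le_rfl, le_rfl,
    (Nat.zero_add _).le.trans (Nat.le_add_left _ _)⟩

variable [Monoid V]

theorem growRoot_nil (μ : ℕ) : ∀ (n h : ℕ) (y : Tree T V (h + 1)),
    growRoot μ n h y [] = pure ⟨h, y⟩
  | 0, _, _ => rfl
  | _ + 1, _, _ => rfl

theorem growRoot_succ (μ n h : ℕ) (y : Tree T V (h + 1))
    {L : List (Treelet T V (Tree T V (h + 1)))} (hL : L ≠ []) :
    growRoot μ (n + 1) h y L = processTarget μ (h + 1) ⟨true, true⟩ y [] L >>= fun p =>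
      growRoot μ n (h + 1) p.1 p.2 := by
  rw [growRoot, if_neg (by simpa using hL)]

theorem growRoot_rootGrown {μ : ℕ} (hμ : 2 ≤ μ) (n : ℕ) : ∀ (h : ℕ)
    (p : Tree T V (h + 1) × List (Treelet T V (Tree T V (h + 1))))
    (R : List ((T × V) × Tree T V (h + 1))), NodeProcessed μ (rootMinArity h) h ⊥ ⊤ p R →
    R.length ≤ n → RootGrown μ h p.1 R (growRoot μ n h p.1 p.2) := by
  induction n with
  | zero =>
    intro h p R hp hn
    obtain rfl := List.length_eq_zero_iff.1 (Nat.le_zero.1 hn)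
    exact rootGrown_pure (by omega) hp
  | succ n ih =>
    intro h p R hp hn
    rcases eq_or_ne R [] with rfl | hR
    · rw [show p.2 = [] from hp.eq_insertions, growRoot_nil]
      exact rootGrown_pure (by omega) hp
    have hm : 1 ≤ R.length := List.length_pos_iff.2 hR
    have hL : p.2.length = R.length := by rw [hp.eq_insertions, length_insertions]
    have hI : (interleave [] p.2).val = R := by rw [hp.eq_insertions, interleave_nil_insertions]
    obtain ⟨R', hR', htarget⟩ := processTarget_targetProcessed hμ ⟨true, true⟩ p.1 [] p.2
      (arityOK_succ.2 (hp.nodeArityOK_of_ne_nil hR)) (hI ▸ hp.arityOK)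
    have hcost := (processTarget_cost hμ ⟨true, true⟩ p.1 [] p.2 (by simp; omega)).1
    rw [hI] at htarget
    rw [hR', length_insertions, hL] at hcost
    have hlt := (htarget.length_le hμ (Nat.zero_add _).symm (by omega) hm).2.2 rfl
    have hpot := htarget.potential_le hμ (Nat.zero_add _).symm (by omega) hm
    rw [fullIndicator_eq_zero (by omega)] at hpot
    obtain ⟨hvalid, hle, hheight, hpot', htime⟩ := ih (h + 1) _ R'
      ⟨hR', htarget.keys_eq ▸ hp.bounded,
        htarget.nodeArityOK _ ((rootMinArity_le_two _).trans hμ)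
          ((rootMinArity_le_two _).trans (by omega)),
        htarget.nodeArityOK_of_ne_nil, htarget.arityOK⟩ (by omega)
    rw [growRoot_succ μ n h p.1 (List.length_pos_iff.1 (hL ▸ hm))]
    refine ⟨hvalid, ?_, ?_, ?_, ?_⟩ <;>
      simp only [Timed.val_bind, Timed.time_bind, Nat.mul_add] at htime ⊢ <;> omega

end root

/-! ### The pass down -/

section passDown

variable {T V : Type u} [Monoid V]

theorem time_repairRight_succ (top h : ℕ) (x : V) (y : Tree T V (h + 1)) :
    (repairRight top (h + 1) x y).time = (if h + 1 ≤ top then 2 * Node.arity y + 1 else 0) +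
      (repairRight top h (if h + 1 ≤ top then x * y.first.agg * innerAgg h y.rest else y.agg)
        (Node.last y)).time := by
  rw [repairRight]
  split
  · exact congrArg (_ + ·) (Nat.zero_add _)
  · rfl

theorem time_repairLeft_succ (top h : ℕ) (x : V) (y : Tree T V (h + 1)) :
    (repairLeft top (h + 1) x y).time = (if h + 1 ≤ top then 2 * Node.arity y + 1 else 0) +
      (repairLeft top h (if h + 1 ≤ top then innerAgg h y.rest * (Node.last y).agg * x else y.agg)
        y.first).time := by
  rw [repairLeft]
  split
  · exact congrArg (_ + ·) (Nat.zero_add _)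
  · rfl

theorem time_repairRight_le {μ : ℕ} (top : ℕ) : ∀ (h : ℕ) (x : V) (y : Tree T V h),
    Tree.ArityOK μ h y → (repairRight top h x y).time ≤ (4 * μ + 1) * min top h
  | 0, _, _, _ => by simp [repairRight]
  | h + 1, x, y, hy => by
    have harity : Node.arity y ≤ 2 * μ := hy.2.1
    have ih := fun x => time_repairRight_le top h x (Node.last y) (arityOK_succ.1 hy).last
    rw [time_repairRight_succ]
    rcases le_or_gt (h + 1) top with hle | hlt
    · rw [min_eq_right (Nat.le_of_succ_le hle)] at ih
      rw [if_pos hle, if_pos hle, min_eq_right hle, Nat.mul_succ]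
      have := ih (x * y.first.agg * innerAgg h y.rest)
      omega
    · rw [min_eq_left (Nat.le_of_lt_succ hlt)] at ih
      rw [if_neg hlt.not_ge, if_neg hlt.not_ge, Nat.zero_add, min_eq_left hlt.le]
      exact ih y.agg

theorem time_repairLeft_le {μ : ℕ} (top : ℕ) : ∀ (h : ℕ) (x : V) (y : Tree T V h),
    Tree.ArityOK μ h y → (repairLeft top h x y).time ≤ (4 * μ + 1) * h
  | 0, _, _, _ => by simp [repairLeft]
  | h + 1, x, y, hy => by
    have harity : Node.arity y ≤ 2 * μ := hy.2.1
    have ih := fun x => time_repairLeft_le top h x y.first hy.2.2.1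
    rw [time_repairLeft_succ, Nat.mul_succ, Nat.add_comm]
    refine Nat.add_le_add (ih _) ?_
    split <;> omega

theorem time_passDown_le {μ a : ℕ} (top : ℕ) (left : Bool) (F : Window T V)
    (hF : NodeArityOK μ a F.height F.root) : (passDown top left F).time ≤
      (4 * μ + 1) * top + if left then (4 * μ + 1) * F.height else 0 := by
  obtain ⟨h, y⟩ := F
  have hright := (time_repairRight_le top h 1 (Node.last y) hF.last).trans
    (Nat.mul_le_mul_left _ (min_le_left _ _))
  cases left with
  | false => simpa [passDown] using hright
  | true =>
    have hroot : Tree.skeleton (h + 1) (Node.setLast y (repairRight top h 1 (Node.last y)).val) =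
        Tree.skeleton (h + 1) y :=
      Tree.skeleton_setLast h y.agg y _ (Tree.skeleton_repairRight top h _ _)
    have hfirst : Tree.ArityOK μ h
        (Node.setLast y (repairRight top h 1 (Node.last y)).val).first := by
      have hfirst_skeleton : Tree.skeleton h
          (Node.setLast y (repairRight top h 1 (Node.last y)).val).first =
        Tree.skeleton h y.first := congrArg Node.first hroot
      rw [← Tree.arityOK_skeleton, hfirst_skeleton, Tree.arityOK_skeleton]
      exact hF.2.2.1
    have hleft := time_repairLeft_le h h 1 _ hfirst
    simpa [passDown] using Nat.add_le_add hright hleft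

theorem valid_passDown [LinearOrder T] {μ top : ℕ} {left : Bool} {F : Window T V} :
    (passDown top left F).val.Valid μ ↔ F.Valid μ := by
  rw [← Window.valid_skeleton, skeleton_passDown, Window.valid_skeleton]

theorem fullCount_passDown {μ top : ℕ} {left : Bool} {F : Window T V} :
    (passDown top left F).val.fullCount μ = F.fullCount μ := by
  rw [← Window.fullCount_skeleton, skeleton_passDown, Window.fullCount_skeleton]

end passDown

/-! ### Bulk insertion -/

section distance

variable {T V : Type u} [LinearOrder T]

theorem outOfOrderDistance_cons (F : Window T V) (b : T × V) (B : List (T × V)) :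
    outOfOrderDistance F (b :: B) = laterCount b.1 F.keys := by
  simp only [outOfOrderDistance, laterCount, Window.keys, Tree.keys, List.countP_map]
  rfl

theorem outOfOrderDistance_le_length (F : Window T V) :
    ∀ B : List (T × V), outOfOrderDistance F B ≤ F.entries.length
  | [] => Nat.zero_le _
  | _ :: _ => List.countP_le_length

theorem two_pow_height_le {μ : ℕ} (hμ : 2 ≤ μ) {F : Window T V} (hF : F.Valid μ) :
    2 ^ F.height ≤ F.entries.length + 1 := by
  have harity := ((Window.valid_iff (by omega) F).1 hF).1
  have hlength : F.entries.length = (Tree.keys (F.height + 1) F.root).length := by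
    simp [Window.entries, Tree.keys]
  refine (two_pow_le_length_keys hμ F.height F.root.first harity.2.2.1).trans ?_
  rw [hlength, Tree.keys_succ, List.length_append]
  omega

end distance

section insertion

variable {T V : Type u} [LinearOrder T] [Monoid V]

/-- Bounds on an insertion into `F` that returns `G`, in terms of the height `k` of the walk up
from the finger, the workload `w` of the subtree at that height, and the height `top` of the
highest processed node. -/
structure InsertionBounds (μ k w top : ℕ) (F : Window T V) (G : Timed (Window T V)) : Prop where
  valid : G.val.Valid μ
  time_le : G.time ≤ k + w + 10 * μ * top + (4 * μ + 1) * (2 * top + k)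
  potential_le : top + G.val.fullCount μ ≤ k + F.fullCount μ + 2 * w
  top_le : top ≤ F.height + 1 + w

variable {μ k w : ℕ} {F : Window T V}
  {p : Timed ((Tree T V (F.height + 1) × List (Treelet T V (Tree T V (F.height + 1)))) × ℕ)}
  {R : List ((T × V) × Tree T V (F.height + 1))} {G : Timed (Window T V)}

theorem insertionBounds_of_height_lt (hμ : 1 ≤ μ)
    (hp : SpineProcessed μ (rootMinArity F.height) k F.height w ⊥ F.root p R)
    (hG : RootGrown μ F.height p.val.1.1 R G) (hlt : F.height < G.val.height) :
    InsertionBounds μ k w (G.val.height + 1) F ⟨(passDown G.val.height true G.val).val,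
      k + (p.time + (G.time + (passDown G.val.height true G.val).time))⟩ := by
  have hpass := time_passDown_le G.val.height true G.val ((Window.valid_iff hμ _).1 hG.valid).1
  obtain ⟨hvalid, -, hheight, hpot, htime⟩ := hG
  have hR : R ≠ [] := List.length_pos_iff.1 (by omega)
  obtain ⟨-, hptime, -, -, htop, hlen, hppot⟩ := hp
  rw [htop hR] at hptime hppot
  rw [if_pos rfl] at hpass
  refine ⟨valid_passDown.2 hvalid, ?_, ?_, by omega⟩
  · dsimp only
    have hsum : (4 * μ + 1) * (2 * (G.val.height + 1) + k) =
        2 * ((4 * μ + 1) * G.val.height) + (4 * μ + 1) * (k + 2) := by ring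
    rw [hsum]
    simp only [Nat.mul_add (10 * μ)] at hptime ⊢
    omega
  · rw [fullCount_passDown]
    change _ ≤ k + Tree.fullCount μ (F.height + 1) F.root + 2 * w
    omega

theorem insertionBounds_of_height_le (hμ : 1 ≤ μ)
    (hp : SpineProcessed μ (rootMinArity F.height) k F.height w ⊥ F.root p R)
    (hG : RootGrown μ F.height p.val.1.1 R G) (hle : G.val.height ≤ F.height) {left : Bool}
    (hleft : left → k = F.height + 1) :
    InsertionBounds μ k w p.val.2 F ⟨(passDown p.val.2 left G.val).val,
      k + (p.time + (G.time + (passDown p.val.2 left G.val).time))⟩ := by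
  have hpass := time_passDown_le p.val.2 left G.val ((Window.valid_iff hμ _).1 hG.valid).1
  obtain ⟨hvalid, hge, -, hpot, htime⟩ := hG
  obtain ⟨-, hptime, -, htop, -, -, hppot⟩ := hp
  have hheight : G.val.height = F.height := le_antisymm hle hge
  have hleft_time : (if left then (4 * μ + 1) * G.val.height else 0) ≤ (4 * μ + 1) * k := by
    split
    case isTrue hl =>
      have := hleft hl
      exact Nat.mul_le_mul_left _ (by omega)
    case isFalse => exact Nat.zero_le _
  rw [hheight] at htime hpot
  refine ⟨valid_passDown.2 hvalid, ?_, ?_, htop.trans (Nat.le_add_right _ _)⟩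
  · dsimp only
    have hsum : (4 * μ + 1) * (2 * p.val.2 + k) =
        2 * ((4 * μ + 1) * p.val.2) + (4 * μ + 1) * k := by ring
    rw [hsum]
    omega
  · rw [fullCount_passDown]
    change _ ≤ k + Tree.fullCount μ (F.height + 1) F.root + 2 * w
    omega

theorem exists_insertionBounds_passDown (hμ : 1 ≤ μ)
    (hp : SpineProcessed μ (rootMinArity F.height) k F.height w ⊥ F.root p R)
    (hG : RootGrown μ F.height p.val.1.1 R G) {left : Bool} (hleft : left → k = F.height + 1) :
    ∃ top, InsertionBounds μ k w top F (tick k >>= fun _ => p >>= fun p => G >>= fun G =>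
      if F.height < G.height then passDown G.height true G else passDown p.2 left G) := by
  rcases lt_or_ge F.height G.val.height with hlt | hle
  · refine ⟨G.val.height + 1, ?_⟩
    simp only [Timed.bind_def, if_pos hlt]
    exact insertionBounds_of_height_lt hμ hp hG hlt
  · refine ⟨p.val.2, ?_⟩
    simp only [Timed.bind_def, if_neg hle.not_gt]
    exact insertionBounds_of_height_le hμ hp hG hle hleft

theorem exists_insertionBounds (hμ : 2 ≤ μ) (hF : F.Valid μ) :
    ∀ {B : List (T × V)}, IsBulk B → ∃ k w top : ℕ,
      2 ^ k ≤ 4 * (outOfOrderDistance F B + 1) ∧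
      WorkloadBound μ k B.length (outOfOrderDistance F B + 1) w ∧
      InsertionBounds μ k w top F (bulkInsert μ F B)
  | [], hB => absurd rfl hB.1
  | b :: B, hB => by
    obtain ⟨harity, hkeys⟩ := (Window.valid_iff (by omega) F).1 hF
    obtain ⟨w, R, hw, hp⟩ := passUpSpine_spineProcessed hμ hB.2 F.height (rootMinArity F.height)
      ⟨true, true⟩ ⊥ F.root ((rootMinArity_le_two _).trans hμ) le_rfl harity
      (bounded_bot_top.2 hkeys) (fun x _ => WithBot.bot_lt_coe _)
    have hG := growRoot_rootGrown hμ _ F.height _ R hp.toNodeProcessed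
      (hp.eq_insertions ▸ length_insertions R).ge
    have hwalk := two_pow_getD_lowestOnSpine_le hμ b.1 F.height F.root
      (harity.mono (one_le_rootMinArity _)) hkeys
    obtain ⟨top, hbounds⟩ := exists_insertionBounds_passDown (by omega) hp hG
      (left := decide (fingerWalk b.1 F = F.height + 1) && !(Node.startsBy F.root b.1))
      fun h => of_decide_eq_true (Bool.and_eq_true_iff.1 h).1
    rw [outOfOrderDistance_cons]
    exact ⟨fingerWalk b.1 F, w, top, hwalk,
      hw.mono (lateCount_le_laterCount_add_one b.1 F.keys hkeys), hbounds⟩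

end insertion

/-! ### Logarithms -/

section logarithms

open Real

theorem le_two_mul_log_of_two_pow_le {k : ℕ} {x : ℝ} (h : (2 : ℝ) ^ k ≤ x) :
    (k : ℝ) ≤ 2 * log x := by
  have hlog : (k : ℝ) * log 2 ≤ log x := by
    rw [← log_pow]
    exact log_le_log (by positivity) h
  have hhalf : (k : ℝ) * (1 / 2) ≤ k * log 2 :=
    mul_le_mul_of_nonneg_left (by linarith [log_two_gt_d9]) (Nat.cast_nonneg k)
  linarith

theorem le_two_mul_posLog_of_two_pow_le {k : ℕ} {x : ℝ} (h : (2 : ℝ) ^ k ≤ x) :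
    (k : ℝ) ≤ 2 * log⁺ x :=
  (le_two_mul_log_of_two_pow_le h).trans (by gcongr; exact le_max_right _ _)

theorem le_three_add_two_mul_posLog {k d : ℕ} (h : 2 ^ k ≤ 4 * (d + 1)) :
    (k : ℝ) ≤ 3 + 2 * log⁺ (d : ℝ) := by
  rcases Nat.lt_or_ge k 3 with hk | hk
  · have : (k : ℝ) ≤ 3 := by exact_mod_cast hk.le
    linarith [posLog_nonneg (x := (d : ℝ))]
  · obtain ⟨j, rfl⟩ := Nat.exists_eq_add_of_le hk
    have hj : 1 ≤ 2 ^ j := Nat.one_le_two_pow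
    rw [pow_add] at h
    have hd : 2 ^ j ≤ d := by omega
    have := le_two_mul_posLog_of_two_pow_le (k := j) (x := d) (by exact_mod_cast hd)
    push_cast
    linarith

theorem natLog_two_le_one_add_two_mul_posLog (d : ℕ) {m : ℕ} (hm : 1 ≤ m) :
    (Nat.log 2 ((d + 1) / m) : ℝ) ≤ 1 + 2 * log⁺ ((d : ℝ) / m) := by
  have hm' : (0 : ℝ) < m := by exact_mod_cast hm
  rcases hlog : Nat.log 2 ((d + 1) / m) with _ | j
  · have := posLog_nonneg (x := (d : ℝ) / m)
    push_cast
    linarith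
  · have hne : (d + 1) / m ≠ 0 := fun h => by simp [h] at hlog
    have hpow := Nat.pow_log_le_self 2 hne
    rw [Nat.le_div_iff_mul_le hm, hlog, pow_succ, mul_right_comm] at hpow
    have hpos : 1 ≤ 2 ^ j * m := Nat.mul_pos (by positivity) hm
    have hle : 2 ^ j * m ≤ d := by omega
    have := le_two_mul_posLog_of_two_pow_le (k := j) (x := (d : ℝ) / m) (by
      rw [le_div_iff₀ hm']
      exact_mod_cast hle)
    push_cast
    linarith

theorem add_one_div_two_pow_natLog_le (d : ℕ) {m : ℕ} (hm : 1 ≤ m) :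
    ((d : ℝ) + 1) / 2 ^ Nat.log 2 ((d + 1) / m) ≤ 2 * m := by
  have hlt := Nat.lt_pow_succ_log_self one_lt_two ((d + 1) / m)
  rw [Nat.div_lt_iff_lt_mul hm, pow_succ] at hlt
  rw [div_le_iff₀ (by positivity)]
  have : ((d + 1 : ℕ) : ℝ) ≤ _ := Nat.cast_le.2 hlt.le
  push_cast at this
  linarith

theorem log_add_one_le_mul_log {m : ℕ} (hm : 1 ≤ m) (n : ℕ) :
    log ((n : ℝ) + 1) ≤ m * log (((m : ℝ) + n) / m) := by
  have hm' : (0 : ℝ) < m := by exact_mod_cast hm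
  have hbernoulli := one_add_mul_le_pow (a := (n : ℝ) / m)
    (le_trans (by norm_num) (by positivity : (0 : ℝ) ≤ n / m)) m
  rw [mul_div_cancel₀ _ hm'.ne'] at hbernoulli
  rw [← log_pow, add_div, div_self hm'.ne']
  exact log_le_log (by positivity) (by linarith)

theorem posLog_div_le_log {d m n : ℕ} (hm : 1 ≤ m) (hd : d ≤ n) :
    log⁺ ((d : ℝ) / m) ≤ log (((m : ℝ) + n) / m) := by
  have hm' : (0 : ℝ) < m := by exact_mod_cast hm
  have hone : 1 ≤ ((m : ℝ) + n) / m := by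
    rw [le_div_iff₀ hm', one_mul]
    exact le_add_of_nonneg_right (Nat.cast_nonneg n)
  rw [← posLog_eq_log (hone.trans (le_abs_self _))]
  refine posLog_le_posLog (by positivity) ?_
  gcongr
  exact (Nat.cast_le.2 hd).trans (le_add_of_nonneg_left hm'.le)

end logarithms

/-! ### The amortized and the worst-case bound -/

section bounds

variable {T V : Type u}

theorem fullCount_empty [Monoid V] {μ : ℕ} (hμ : 1 ≤ μ) :
    (Window.empty : Window T V).fullCount μ = 0 :=
  fullIndicator_eq_zero (n := 0) (by omega)

variable [LinearOrder T] {F : Window T V} {B : List (T × V)}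

theorem amortizedBound_nonneg (F : Window T V) (B : List (T × V)) : 0 ≤ amortizedBound F B :=
  add_nonneg Real.posLog_nonneg (mul_nonneg (Nat.cast_nonneg _)
    (add_nonneg zero_le_one Real.posLog_nonneg))

theorem IsBulk.one_le_length (hB : IsBulk B) : 1 ≤ B.length :=
  List.length_pos_iff.2 hB.1

theorem amortizedBound_le_worstCaseBound (F : Window T V) (hB : IsBulk B) :
    amortizedBound F B ≤ worstCaseBound F B := by
  have := posLog_div_le_log hB.one_le_length (outOfOrderDistance_le_length F B)
  unfold amortizedBound worstCaseBound
  gcongr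

theorem height_add_one_le_worstCaseBound {μ : ℕ} (hμ : 2 ≤ μ) (hF : F.Valid μ) (hB : IsBulk B) :
    (F.height : ℝ) + 1 ≤ 3 * worstCaseBound F B := by
  have hheight := le_two_mul_log_of_two_pow_le (k := F.height) (x := (F.entries.length : ℝ) + 1)
    (by exact_mod_cast two_pow_height_le hμ hF)
  have hlog := log_add_one_le_mul_log hB.one_le_length F.entries.length
  have hlength : (1 : ℝ) ≤ B.length := by exact_mod_cast hB.one_le_length
  have hdist := Real.posLog_nonneg (x := (outOfOrderDistance F B : ℝ))
  unfold worstCaseBound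
  linarith

theorem walk_le_amortizedBound {k : ℕ} (hB : IsBulk B)
    (hk : 2 ^ k ≤ 4 * (outOfOrderDistance F B + 1)) : (k : ℝ) ≤ 3 * amortizedBound F B := by
  have hwalk := le_three_add_two_mul_posLog hk
  have hlength : (1 : ℝ) ≤ B.length := by exact_mod_cast hB.one_le_length
  have hdist := Real.posLog_nonneg (x := (outOfOrderDistance F B : ℝ))
  have hratio : 0 ≤ (B.length : ℝ) *
      Real.posLog ((outOfOrderDistance F B : ℝ) / B.length) :=
    mul_nonneg (Nat.cast_nonneg _) Real.posLog_nonneg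
  unfold amortizedBound
  linarith

theorem WorkloadBound.le_amortizedBound {μ k w : ℕ} (hB : IsBulk B)
    (hw : WorkloadBound μ k B.length (outOfOrderDistance F B + 1) w)
    (hk : 2 ^ k ≤ 4 * (outOfOrderDistance F B + 1)) :
    (w : ℝ) ≤ 320 * μ * amortizedBound F B := by
  have hwalk := le_three_add_two_mul_posLog hk
  have hdepth := natLog_two_le_one_add_two_mul_posLog (outOfOrderDistance F B) hB.one_le_length
  have hrest := add_one_div_two_pow_natLog_le (outOfOrderDistance F B) hB.one_le_length
  have hwork := hw (Nat.log 2 ((outOfOrderDistance F B + 1) / B.length))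
  have hlength : (1 : ℝ) ≤ B.length := by exact_mod_cast hB.one_le_length
  unfold amortizedBound
  set l := Nat.log 2 ((outOfOrderDistance F B + 1) / B.length)
  set m : ℝ := (B.length : ℝ)
  set d : ℝ := (outOfOrderDistance F B : ℝ) with hd
  have hdist : 0 ≤ Real.posLog d := Real.posLog_nonneg
  have hratio : 0 ≤ m * Real.posLog (d / m) := mul_nonneg (by linarith) Real.posLog_nonneg
  have hlevels : ((l : ℝ) + 1) * m ≤ (2 + 2 * Real.posLog (d / m)) * m :=
    mul_le_mul_of_nonneg_right (by linarith) (by linarith)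
  calc (w : ℝ) ≤ μ * (40 * ((l + 1) * m) + 40 * k + 60 * ((d + 1) / 2 ^ l)) := by
        rw [hd]
        push_cast at hwork
        exact hwork.trans_eq (by ring)
    _ ≤ μ * (320 * (Real.posLog d + m * (1 + Real.posLog (d / m)))) := by
        gcongr
        linarith
    _ = 320 * μ * (Real.posLog d + m * (1 + Real.posLog (d / m))) := by ring

/-- The weight of a node of maximal arity in the potential: the factor of the height of the highest
processed node in `InsertionBounds.time_le`. -/
def potentialFactor (μ : ℕ) : ℝ := 18 * μ + 2

/-- The constant of the amortized bound. -/
def amortizedFactor (μ : ℕ) : ℝ := (22 * μ + 4) * 3 + (36 * μ + 5) * (320 * μ)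

/-- The constant of the worst-case bound. -/
def worstCaseFactor (μ : ℕ) : ℝ := (4 * μ + 2) * 3 + 320 * μ + potentialFactor μ * (3 + 320 * μ)

theorem potentialFactor_nonneg (μ : ℕ) : 0 ≤ potentialFactor μ := by
  unfold potentialFactor
  positivity

theorem InsertionBounds.time_le_real {μ k w top : ℕ} {G : Timed (Window T V)}
    (h : InsertionBounds μ k w top F G) :
    (G.time : ℝ) ≤ (4 * μ + 2) * k + w + potentialFactor μ * top := by
  have : (G.time : ℝ) ≤ k + w + 10 * μ * top + (4 * μ + 1) * (2 * top + k) := by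
    exact_mod_cast h.time_le
  unfold potentialFactor
  linarith

variable [Monoid V]

theorem bulkInsert_valid {μ : ℕ} (hμ : 2 ≤ μ) (hF : F.Valid μ) (hB : IsBulk B) :
    (bulkInsert μ F B).val.Valid μ := by
  obtain ⟨_, _, _, -, -, hbounds⟩ := exists_insertionBounds hμ hF hB
  exact hbounds.valid

theorem time_bulkInsert_add_potential_le {μ : ℕ} (hμ : 2 ≤ μ) (hF : F.Valid μ) (hB : IsBulk B) :
    ((bulkInsert μ F B).time : ℝ) + potentialFactor μ * (bulkInsert μ F B).val.fullCount μ ≤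
      amortizedFactor μ * amortizedBound F B + potentialFactor μ * F.fullCount μ := by
  obtain ⟨k, w, top, hk, hw, hbounds⟩ := exists_insertionBounds hμ hF hB
  have hpot : (top : ℝ) + (bulkInsert μ F B).val.fullCount μ ≤ k + F.fullCount μ + 2 * w := by
    exact_mod_cast hbounds.potential_le
  have htop := mul_le_mul_of_nonneg_left hpot (potentialFactor_nonneg μ)
  have hwalk := mul_le_mul_of_nonneg_left (walk_le_amortizedBound hB hk)
    (by positivity : (0 : ℝ) ≤ 22 * μ + 4)
  have hwork := mul_le_mul_of_nonneg_left (hw.le_amortizedBound hB hk)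
    (by positivity : (0 : ℝ) ≤ 36 * μ + 5)
  have htime := hbounds.time_le_real
  unfold potentialFactor amortizedFactor at *
  linarith

theorem time_bulkInsert_le_worstCaseBound {μ : ℕ} (hμ : 2 ≤ μ) (hF : F.Valid μ) (hB : IsBulk B) :
    ((bulkInsert μ F B).time : ℝ) ≤ worstCaseFactor μ * worstCaseBound F B := by
  obtain ⟨k, w, top, hk, hw, hbounds⟩ := exists_insertionBounds hμ hF hB
  have hle := amortizedBound_le_worstCaseBound F hB
  have hwork : (w : ℝ) ≤ 320 * μ * worstCaseBound F B :=
    (hw.le_amortizedBound hB hk).trans (mul_le_mul_of_nonneg_left hle (by positivity))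
  have hwalk : (k : ℝ) ≤ 3 * worstCaseBound F B :=
    (walk_le_amortizedBound hB hk).trans (mul_le_mul_of_nonneg_left hle (by norm_num))
  have htop : (top : ℝ) ≤ (3 + 320 * μ) * worstCaseBound F B := by
    have : (top : ℝ) ≤ F.height + 1 + w := by exact_mod_cast hbounds.top_le
    linarith [height_add_one_le_worstCaseBound hμ hF hB]
  calc ((bulkInsert μ F B).time : ℝ)
      ≤ (4 * μ + 2) * k + w + potentialFactor μ * top := hbounds.time_le_real
    _ ≤ (4 * μ + 2) * (3 * worstCaseBound F B) + 320 * μ * worstCaseBound F B +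
        potentialFactor μ * ((3 + 320 * μ) * worstCaseBound F B) := by
      gcongr
      exact potentialFactor_nonneg μ
    _ = worstCaseFactor μ * worstCaseBound F B := by
      unfold worstCaseFactor
      ring

theorem totalInsertTime_le {μ : ℕ} (hμ : 2 ≤ μ) : ∀ (ops : List (Op T V)) (F : Window T V),
    F.Valid μ → (∀ op ∈ ops, op.WellFormed) →
    (totalInsertTime μ F ops : ℝ) ≤
      amortizedFactor μ * totalAmortizedBound μ F ops + potentialFactor μ * F.fullCount μ
  | [], F, _, _ => by
    simpa [totalInsertTime, totalAmortizedBound] using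
      mul_nonneg (potentialFactor_nonneg μ) (Nat.cast_nonneg (F.fullCount μ))
  | .insert B :: ops, F, hF, hops => by
    have hB : IsBulk B := hops (.insert B) List.mem_cons_self
    have hinsert := time_bulkInsert_add_potential_le hμ hF hB
    have ih := totalInsertTime_le hμ ops _ (bulkInsert_valid hμ hF hB) fun op hop =>
      hops op (List.mem_cons_of_mem _ hop)
    simp only [totalInsertTime, totalAmortizedBound]
    push_cast
    linarith
  | .evict t :: ops, F, hF, hops => by
    have ih := totalInsertTime_le hμ ops _ (bulkEvict_valid hμ t hF) fun op hop =>
      hops op (List.mem_cons_of_mem _ hop)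
    have hevict : potentialFactor μ * (bulkEvict μ t F).fullCount μ ≤
        potentialFactor μ * F.fullCount μ :=
      mul_le_mul_of_nonneg_left (Nat.cast_le.2 (fullCount_bulkEvict_le hμ t hF))
        (potentialFactor_nonneg μ)
    exact ih.trans (add_le_add_right hevict _)

theorem totalAmortizedBound_nonneg (μ : ℕ) : ∀ (ops : List (Op T V)) (F : Window T V),
    0 ≤ totalAmortizedBound μ F ops
  | [], _ => le_rfl
  | .insert B :: ops, F =>
    add_nonneg (amortizedBound_nonneg F B) (totalAmortizedBound_nonneg μ ops _)
  | .evict _ :: ops, _ => totalAmortizedBound_nonneg μ ops _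

theorem valid_empty (μ : ℕ) : (Window.empty : Window T V).Valid μ :=
  ⟨⟨Or.inr ⟨rfl, rfl⟩, trivial, fun _ _ => trivial⟩, List.Pairwise.nil⟩

end bounds

end FiBA

theorem mainTheorem2 (μ : ℕ) (hμ : 2 ≤ μ) :
    ∃ C : ℝ, ∀ (T V : Type u) [LinearOrder T] [Monoid V],
      (∀ ops : List (FiBA.Op T V), (∀ op ∈ ops, op.WellFormed) →
        (FiBA.totalInsertTime μ FiBA.Window.empty ops : ℝ) ≤
          C * FiBA.totalAmortizedBound μ FiBA.Window.empty ops) ∧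
      (∀ (F : FiBA.Window T V) (B : List (T × V)), F.Valid μ → FiBA.IsBulk B →
        ((FiBA.bulkInsert μ F B).time : ℝ) ≤ C * FiBA.worstCaseBound F B) := by
  refine ⟨max (FiBA.amortizedFactor μ) (FiBA.worstCaseFactor μ), fun T V _ _ => ⟨?_, ?_⟩⟩
  · intro ops hops
    have htotal := FiBA.totalInsertTime_le hμ ops _ (FiBA.valid_empty μ) hops
    rw [FiBA.fullCount_empty (by omega), Nat.cast_zero, mul_zero, add_zero] at htotal
    exact htotal.trans (mul_le_mul_of_nonneg_right (le_max_left _ _)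
      (FiBA.totalAmortizedBound_nonneg μ ops _))
  · intro F B hF hB
    exact (FiBA.time_bulkInsert_le_worstCaseBound hμ hF hB).trans
      (mul_le_mul_of_nonneg_right (le_max_right _ _)
        ((FiBA.amortizedBound_nonneg F B).trans (FiBA.amortizedBound_le_worstCaseBound F hB)))
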